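/- Let $\Lambda=(-1,1)$ and let $\alpha\ge 0$ be real; functions are complex valued. For $v\in L^2(\Lambda)$ let $\tilde v\in L^2(\mathbb R)$ be its extension by zero, and write $\widehat w(\xi)=\int_{\mathbb R}w(x)e^{-i\xi x}\,dx$ for the Fourier transform on $L^2(\mathbb R)$. Let $$H^\alpha_*(\Lambda)=\{v:\ \tilde v\in H^\alpha(\mathbb R)\},\qquad \|v\|_{\alpha,*}=\Big(\frac1{2\pi}\int_{\mathbb R}(1+\xi^2)^\alpha|\widehat{\tilde v}(\xi)|^2\,d\xi\Big)^{1/2}.$$ For $v\in H^\alpha_*(\Lambda)$ let $D^\alpha v\in L^2(\mathbb R)$ be the Riesz fractional derivative, the function with $\widehat{D^\alpha v}(\xi)=(-1)^{\lfloor(\alpha+1)/2\rfloor}|\xi|^\alpha\,\widehat{\tilde v}(\xi)$, and put $(D^\alpha u,D^\alpha v)=\int_{\mathbb R}D^\alpha u(x)\,\overline{D^\alpha v(x)}\,dx$ for $u,v\in H^\alpha_*(\Lambda)$. For $m\in\mathbb N_0$ let $J_m(x)=(1-x^2)^\alpha P_m^{\alpha,\alpha}(x)$, $x\in\Lambda$,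 where $P_m^{a,b}$ is the classical Jacobi polynomial, normalised by $P_m^{a,b}(1)=\Gamma(m+a+1)/(m!\,\Gamma(a+1))$. Theorem. The functions $J_m$, $m\ge 0$, form a complete orthogonal system in $H^\alpha_*(\Lambda)$ with respect to the form $(D^\alpha\cdot,D^\alpha\cdot)$. That is: 1. $J_m\in H^\alpha_*(\Lambda)$ for every $m\ge 0$; 2. for all $m,n\ge 0$, $$(D^\alpha J_m,D^\alpha J_n)=\frac{2^{2\alpha+1}\,\Gamma(m+\alpha+1)^2}{(m!)^2\,(2m+2\alpha+1)}\,\delta_{mn};$$ 3. the linear span of $\{J_m: m\ge 0\}$ is dense in $H^\alpha_*(\Lambda)$ for the norm $\|\cdot\|_{\alpha,*}$; and if $u\in H^\alpha_*(\Lambda)$ satisfies $(D^\alpha u,D^\alpha J_m)=0$ for all $m\ge0$, then $u=0$. -/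

import Mathlib

namespace RieszJacobi

noncomputable section

open MeasureTheory Set FourierTransform TemperedDistribution
open scoped SchwartzMap

/-- The interval `Λ = (-1, 1)`. -/
abbrev Lam : Set ℝ := Ioo (-1) 1

/-- `L²(Λ)`, complex valued. -/
abbrev L2Lam := Lp ℂ 2 ((volume : Measure ℝ).restrict Lam)

/-- `L²(ℝ)`, complex valued. -/
abbrev L2R := Lp ℂ 2 (volume : Measure ℝ)

theorem memLp_indicator (v : L2Lam) : MemLp (Lam.indicator (v : ℝ → ℂ)) 2 volume :=
  (memLp_indicator_iff_restrict measurableSet_Ioo).2 (Lp.memLp v)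

theorem indicator_ae_congr {f g : ℝ → ℂ} (h : f =ᵐ[volume.restrict Lam] g) :
    Lam.indicator f =ᵐ[volume] Lam.indicator g :=
  (ae_eq_restrict_iff_indicator_ae_eq measurableSet_Ioo).1 h

/-- Extension by zero `v ↦ ṽ` from `L²(Λ)` to `L²(ℝ)`. -/
def zeroExt : L2Lam →ₗ[ℂ] L2R where
  toFun v := (memLp_indicator v).toLp _
  map_add' u v := by
    rw [← MemLp.toLp_add]
    refine MemLp.toLp_congr _ _ ((indicator_ae_congr (Lp.coeFn_add u v)).trans ?_)
    exact Filter.Eventually.of_forall fun x => by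
      rw [Set.indicator_add' Lam]
  map_smul' c v := by
    rw [RingHom.id_apply, ← MemLp.toLp_const_smul]
    refine MemLp.toLp_congr _ _ ((indicator_ae_congr (Lp.coeFn_smul c v)).trans ?_)
    exact Filter.Eventually.of_forall fun x => by
      simp only [Set.indicator, Pi.smul_apply]; split_ifs <;> simp

/-- The Fourier transform of `w ∈ L²(ℝ)` in the normalisation
`ŵ(ξ) = ∫ w(x) exp(-i ξ x) dx`; Mathlib's `𝓕` has the kernel `exp(-2 π i ξ x)`. -/
def fhat (w : L2R) (ξ : ℝ) : ℂ := (𝓕 w : L2R) (ξ / (2 * Real.pi))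

/-- `H^s_*(Λ)` for `s ≥ 0`: the functions on `Λ` whose extension by zero lies in `H^s(ℝ)`
(as `H^s(ℝ) ⊆ L²(ℝ)` for `s ≥ 0`, all of these lie in `L²(Λ)`). -/
def hStar (s : ℝ) : Submodule ℂ L2Lam where
  carrier := {v | MemSobolev s 2 (zeroExt v : 𝓢'(ℝ, ℂ))}
  zero_mem' := by
    simp only [mem_ofPred_eq, map_zero, ← Lp.toTemperedDistributionCLM_apply]
    exact memSobolev_fun_zero ℝ ℂ s 2
  add_mem' {u v} hu hv := by
    simp only [mem_ofPred_eq, map_add, ← Lp.toTemperedDistributionCLM_apply] at *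
    exact hu.add hv
  smul_mem' c v hv := by
    simp only [mem_ofPred_eq, map_smul, ← Lp.toTemperedDistributionCLM_apply] at *
    exact hv.smul c

/-- The norm `‖v‖_{s,*} = ( (2π)⁻¹ ∫ (1 + ξ²)^s |ṽ^(ξ)|² dξ )^{1/2}`. -/
def starNorm (s : ℝ) (v : hStar s) : ℝ :=
  √((2 * Real.pi)⁻¹ * ∫ ξ : ℝ, (1 + ξ ^ 2) ^ s * ‖fhat (zeroExt v) ξ‖ ^ 2)

/-- For `w ∈ L²(ℝ)`, membership in the Sobolev space means that `(1 + η²)^{s/2} 𝓕 w` is in `L²`. -/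
theorem memSobolev_iff_memLp (s : ℝ) (w : L2R) :
    MemSobolev s 2 (w : 𝓢'(ℝ, ℂ)) ↔
      MemLp (fun η : ℝ => (((1 + ‖η‖ ^ 2) ^ (s / 2) : ℝ) : ℂ) * (𝓕 w : L2R) η) 2 volume := by
  have hg : Function.HasTemperateGrowth
      (fun x : ℝ => (((1 + ‖x‖ ^ 2) ^ (s / 2) : ℝ) : ℂ)) := by fun_prop
  rw [memSobolev_iff_exists_smulLeftCLM_fourier, Lp.fourier_toTemperedDistribution_eq]
  constructor
  · rintro ⟨f', hf'⟩
    have hae : ∀ᵐ η : ℝ, (((1 + ‖η‖ ^ 2) ^ (s / 2) : ℝ) : ℂ) * (𝓕 w : L2R) η = f' η := by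
      apply ae_eq_of_integral_contDiff_smul_eq
      · have h1 : LocallyIntegrable ((𝓕 w : L2R) : ℝ → ℂ) volume :=
          (Lp.memLp _).locallyIntegrable (by norm_num)
        exact h1.continuous_mul hg.1.continuous
      · exact (Lp.memLp _).locallyIntegrable (by norm_num)
      · intro g g_smooth g_cpt
        have hg₁ : HasCompactSupport (Complex.ofRealCLM ∘ g) := g_cpt.comp_left rfl
        have hg₂ : ContDiff ℝ (⊤ : ℕ∞) (Complex.ofRealCLM ∘ g) := by fun_prop
        have := congrArg (fun T : 𝓢'(ℝ, ℂ) => T (hg₁.toSchwartzMap hg₂)) hf'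
        simp only [smulLeftCLM_apply_apply, Lp.toTemperedDistribution_apply] at this
        refine Eq.trans (integral_congr_ae (Filter.Eventually.of_forall fun x => ?_))
          (this.trans (integral_congr_ae (Filter.Eventually.of_forall fun x => ?_)))
        · simp only [SchwartzMap.smulLeftCLM_apply_apply hg]
          simp; ring
        · simp
    exact (memLp_congr_ae hae).2 (Lp.memLp f')
  · intro h
    refine ⟨h.toLp _, ?_⟩
    ext φ
    simp only [smulLeftCLM_apply_apply, Lp.toTemperedDistribution_apply]
    refine integral_congr_ae ?_
    filter_upwards [h.coeFn_toLp] with η hη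
    rw [hη, SchwartzMap.smulLeftCLM_apply_apply hg]
    simp only [smul_eq_mul]; ring

/-- The symbol `(-1)^⌊(s+1)/2⌋ |ξ|^s` of the Riesz fractional derivative of order `s`. -/
def rieszSymbol (s ξ : ℝ) : ℂ := (-1 : ℂ) ^ ⌊(s + 1) / 2⌋ * ((|ξ| ^ s : ℝ) : ℂ)

theorem memLp_riesz {s : ℝ} (hs : 0 ≤ s) (v : hStar s) :
    MemLp (fun η : ℝ => rieszSymbol s (2 * Real.pi * η) * (𝓕 (zeroExt v) : L2R) η) 2 volume := by
  have h := (memSobolev_iff_memLp s _).1 v.2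
  refine MemLp.of_le_mul (c := (2 * Real.pi) ^ s) h ?_ ?_
  · refine AEStronglyMeasurable.mul ?_ (Lp.aestronglyMeasurable _)
    have : Measurable (fun η : ℝ => rieszSymbol s (2 * Real.pi * η)) := by
      unfold rieszSymbol; fun_prop
    exact this.aestronglyMeasurable
  · refine Filter.Eventually.of_forall fun η => ?_
    have hpi : 0 < 2 * Real.pi := by positivity
    have h1 : |2 * Real.pi * η| ^ s ≤ (2 * Real.pi) ^ s * (1 + ‖η‖ ^ 2) ^ (s / 2) := by
      rw [abs_mul, abs_of_pos hpi, Real.mul_rpow hpi.le (abs_nonneg _)]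
      gcongr
      have : |η| ^ s = (|η| ^ 2) ^ (s / 2) := by
        rw [← Real.rpow_natCast, ← Real.rpow_mul (abs_nonneg _)]; congr 1; push_cast; ring
      rw [this, Real.norm_eq_abs]
      exact Real.rpow_le_rpow (by positivity) (by linarith) (by positivity)
    rw [norm_mul, norm_mul, ← mul_assoc]
    gcongr
    rw [rieszSymbol, norm_mul, norm_zpow, norm_neg, norm_one, one_zpow, one_mul,
      Complex.norm_of_nonneg (by positivity), Complex.norm_of_nonneg (by positivity)]
    exact h1

/-- The Riesz fractional derivative `D^s v ∈ L²(ℝ)` of `v ∈ H^s_*(Λ)`: the function with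
`F(D^s v)(ξ) = (-1)^⌊(s+1)/2⌋ |ξ|^s F(ṽ)(ξ)`. -/
def rieszDeriv (s : ℝ) (hs : 0 ≤ s) (v : hStar s) : L2R := 𝓕⁻ ((memLp_riesz hs v).toLp _)

theorem fhat_rieszDeriv (s : ℝ) (hs : 0 ≤ s) (v : hStar s) :
    fhat (rieszDeriv s hs v) =ᵐ[volume] fun ξ => rieszSymbol s ξ * fhat (zeroExt v) ξ := by
  have h := (memLp_riesz hs v).coeFn_toLp
  have hq := Measure.quasiMeasurePreserving_smul (volume : Measure ℝ)
    (r := (2 * Real.pi)⁻¹) (by positivity)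
  filter_upwards [hq.ae h] with ξ hξ
  have e : (2 * Real.pi)⁻¹ • ξ = ξ / (2 * Real.pi) := by rw [smul_eq_mul]; ring
  rw [e] at hξ
  rw [fhat, rieszDeriv, fourier_fourierInv_eq, hξ, fhat]
  congr 2
  field_simp

/-- The form `(D^s u, D^s v) = ∫_ℝ D^s u(x) conj(D^s v(x)) dx`. -/
def form (s : ℝ) (hs : 0 ≤ s) (u v : hStar s) : ℂ :=
  inner ℂ (rieszDeriv s hs v) (rieszDeriv s hs u)

/-- The classical Jacobi polynomial
`P_n^{a,b}(x) = ∑ₘ (n+a+b+1)ₘ (a+m+1)ₙ₋ₘ / (m! (n-m)!) ((x-1)/2)^m`. -/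
def jacobiP (n : ℕ) (a b : ℝ) : Polynomial ℝ :=
  ∑ m ∈ Finset.range (n + 1),
    Polynomial.C ((ascPochhammer ℝ m).eval (n + a + b + 1) *
      (ascPochhammer ℝ (n - m)).eval (a + m + 1) / (m.factorial * (n - m).factorial)) *
      (Polynomial.C (1 / 2) * (Polynomial.X - 1)) ^ m

/-- The generalized Jacobi function `(1 - x²)^α P_n^{α,α}(x)` as a function. -/
def gjfFun (α : ℝ) (n : ℕ) (x : ℝ) : ℝ := (1 - x ^ 2) ^ α * (jacobiP n α α).eval x

theorem memLp_gjf {α : ℝ} (hα : 0 ≤ α) (n : ℕ) :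
    MemLp (fun x => (gjfFun α n x : ℂ)) 2 (volume.restrict Lam) := by
  have hc : Continuous (fun x => (gjfFun α n x : ℂ)) := by
    unfold gjfFun
    have h1 : Continuous fun x : ℝ => (1 - x ^ 2) ^ α :=
      Continuous.rpow_const (by fun_prop) fun _ => Or.inr hα
    have h2 : Continuous fun x : ℝ => (jacobiP n α α).eval x := Polynomial.continuous _
    fun_prop
  obtain ⟨C, hC⟩ := (isCompact_Icc (a := (-1 : ℝ)) (b := 1)).exists_bound_of_continuousOn
    hc.continuousOn
  refine MemLp.of_bound hc.aestronglyMeasurable C ?_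
  filter_upwards [ae_restrict_mem measurableSet_Ioo] with x hx
  exact hC x (Ioo_subset_Icc_self hx)

/-- The generalized Jacobi function of degree `n` as an element of `L²(Λ)`. -/
def gjf (α : ℝ) (hα : 0 ≤ α) (n : ℕ) : L2Lam := (memLp_gjf hα n).toLp _

end

end RieszJacobi

/-! Write Φ_ν for the Fourier transform of (1-x²)^ν on (-1,1) (`wft`). By Rodrigues' formula J_m is,
up to a constant, the m-th derivative of (1-x²)^{α+m}, so its transform is (-iξ)^m Φ_{α+m}(ξ) / (2^m
m!) (`intervalFT_gjfFun`). The bound Φ_ν(ξ) = O((1+|ξ|)^{-ν-1}) puts J_m in the Sobolev space. On ξ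
> 0, multiplication by ξ^α turns the transform of J_m into a constant multiple of the spherical
Bessel function j_{α+m} (`sphBessel ν` is 2 j_ν), and Plancherel turns the form into ∫_0^∞ j_{α+m}
j_{α+n} (`form_eq`, `form_gjf`).

Orthogonality: if m+n is odd, the integrand over ℝ is odd. If m-n is even and nonzero, the
contiguous relations of the j_ν force the integral to vanish (`sphPair_even`).

Norms: (2ν+1)∫j_ν² is unchanged under ν ↦ ν+1 (`sphPair_self_succ`), so 0 ≤ ν < 1 suffices. There a
recursion for the moments ∫ x^{2α} Φ_{α+k} Φ_{α+1}, followed to k → ∞, reduces ∫ x^{2α} Φ_α² to ∫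
x^{2α} Φ_{α+1} (`wftMoment_self`). That integral is found by writing a Gaussian as a mixture of
dilated Φ's (`integral_rpow_mul_wft`).

Completeness: suppose g in L² is orthogonal to all weighted transforms (1+ξ²)^{α/2} Ĵ_m. The P_m
span the polynomials, so g annihilates the transforms of all (1-x²)^α x^n. Summing the exponential
series gives all translates of Φ_α, and Fourier inversion then gives (1-x²)^α h for every Schwartz
function h. This class contains every test function supported inside (-1,1). Contracting and
mollifying reaches every u in H^α_* as a bounded, pointwise limit on the Fourier side
(`integral_mul_weightedFT_eq_zero`). Density follows from the double orthogonal complement, and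
uniqueness from a choice of g that makes the pairing with u equal to ∫ |ξ|^{2α}|û|². -/

namespace RieszJacobi

noncomputable section

open MeasureTheory Set

/-! ### Decay of the Fourier transforms of (1-x²)^β xⁿ. -/

/-- The Fourier integral `∫_{-1}^1 f(x) exp(-i x ξ) dx`. -/
def intervalFT (f : ℝ → ℂ) (ξ : ℝ) : ℂ :=
  ∫ x in (-1 : ℝ)..1, f x * Complex.exp (-(x * ξ) * Complex.I)

theorem hasDerivAt_exp_neg_mul_I (ξ x : ℝ) :
    HasDerivAt (fun x : ℝ => Complex.exp (-(x * ξ) * Complex.I))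
      (Complex.exp (-(x * ξ) * Complex.I) * (-ξ * Complex.I)) x := by
  have h : HasDerivAt (fun x : ℝ => -((x : ℂ) * ξ) * Complex.I) (-(1 * ξ) * Complex.I) x :=
    (((Complex.ofRealCLM.hasDerivAt (x := x)).mul_const (ξ : ℂ)).neg).mul_const Complex.I
  rw [one_mul] at h
  exact h.cexp

theorem continuous_exp_neg_mul_I (ξ : ℝ) :
    Continuous (fun x : ℝ => Complex.exp (-(x * ξ) * Complex.I)) := by fun_prop

theorem norm_exp_neg_mul_I (x ξ : ℝ) : ‖Complex.exp (-(x * ξ) * Complex.I)‖ = 1 := by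
  have := Complex.norm_exp_ofReal_mul_I (-(x * ξ))
  push_cast at this
  exact this

/-- Integration by parts without boundary terms. Only integrability of `f'` is asked for, because
the derivative of (1-x²)^β is unbounded at ±1 when 0 < β < 1. -/
theorem intervalFT_deriv {f f' : ℝ → ℂ} (hc : ContinuousOn f (Icc (-1) 1)) (h1 : f (-1) = 0)
    (h2 : f 1 = 0) (hd : ∀ x ∈ Ioo (-1 : ℝ) 1, HasDerivAt f (f' x) x)
    (hi : IntervalIntegrable f' volume (-1) 1) (ξ : ℝ) :
    intervalFT f' ξ = Complex.I * ξ * intervalFT f ξ := by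
  have hle : (-1 : ℝ) ≤ 1 := by norm_num
  have h := intervalIntegral.integral_mul_deriv_eq_deriv_mul_of_hasDerivAt (a := -1) (b := 1)
    (u := fun x : ℝ => Complex.exp (-(x * ξ) * Complex.I)) (v := f)
    (u' := fun x : ℝ => Complex.exp (-(x * ξ) * Complex.I) * (-ξ * Complex.I)) (v' := f')
    (continuous_exp_neg_mul_I ξ).continuousOn (by rwa [uIcc_of_le hle])
    (fun x _ => hasDerivAt_exp_neg_mul_I ξ x)
    (fun x hx => hd x (by simpa [hle] using hx))
    (Continuous.intervalIntegrable (by fun_prop) _ _) hi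
  rw [h1, h2] at h
  simp only [mul_zero, sub_zero, zero_sub] at h
  unfold intervalFT
  rw [intervalIntegral.integral_congr (g := fun x : ℝ =>
    Complex.exp (-(x * ξ) * Complex.I) * f' x) (fun x _ => mul_comm _ _), h,
    ← intervalIntegral.integral_neg, ← intervalIntegral.integral_const_mul]
  refine intervalIntegral.integral_congr fun x _ => ?_
  ring

theorem intervalIntegrable_ofReal {f : ℝ → ℝ} {a b : ℝ} (h : IntervalIntegrable f volume a b) :
    IntervalIntegrable (fun x => (f x : ℂ)) volume a b := ⟨h.1.ofReal, h.2.ofReal⟩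

/-- The weighted monomial `(1 - x²)^β xⁿ`. -/
def wmon (β : ℝ) (n : ℕ) (x : ℝ) : ℝ := (1 - x ^ 2) ^ β * x ^ n

theorem one_sub_sq_rpow {x : ℝ} (hx : x ∈ Icc (-1 : ℝ) 1) (β : ℝ) :
    (1 - x ^ 2) ^ β = (1 - x) ^ β * (1 + x) ^ β := by
  rw [← Real.mul_rpow (by linarith [hx.2]) (by linarith [hx.1])]
  congr 1; ring

theorem wmon_neg (β : ℝ) (n : ℕ) (x : ℝ) : wmon β n (-x) = (-1) ^ n * wmon β n x := by
  unfold wmon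
  rw [neg_sq, neg_pow x n]; ring

theorem intervalIntegrable_one_sub_rpow {β : ℝ} (hβ : -1 < β) (a : ℝ) :
    IntervalIntegrable (fun x : ℝ => (1 - x) ^ β) volume a 1 := by
  have := (intervalIntegral.intervalIntegrable_rpow' (a := 1 - a) (b := 0) hβ).comp_sub_left 1
  simpa using this

theorem continuousOn_one_add_rpow (β : ℝ) (n : ℕ) :
    ContinuousOn (fun x : ℝ => (1 + x) ^ β * x ^ n) (uIcc 0 1) := by
  refine ContinuousOn.mul (ContinuousOn.rpow_const (by fun_prop) fun x hx => Or.inl ?_)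
    (by fun_prop)
  rw [uIcc_of_le zero_le_one] at hx
  linarith [hx.1]

theorem intervalIntegrable_wmon_right {β : ℝ} (hβ : -1 < β) (n : ℕ) :
    IntervalIntegrable (wmon β n) volume 0 1 := by
  refine ((intervalIntegrable_one_sub_rpow hβ 0).mul_continuousOn
    (continuousOn_one_add_rpow β n)).congr fun x hx => ?_
  rw [uIoc_of_le zero_le_one] at hx
  simp only [wmon]
  rw [one_sub_sq_rpow ⟨by linarith [hx.1], hx.2⟩]; ring

theorem intervalIntegrable_wmon {β : ℝ} (hβ : -1 < β) (n : ℕ) :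
    IntervalIntegrable (wmon β n) volume (-1) 1 := by
  refine IntervalIntegrable.trans (b := 0) ?_ (intervalIntegrable_wmon_right hβ n)
  have h := ((intervalIntegrable_wmon_right hβ n).comp_mul_left (c := -1) ).const_mul ((-1) ^ n)
  simp only [neg_mul, one_mul, wmon_neg] at h
  have h2 : (-1 : ℝ) ^ n * (-1) ^ n = 1 := by rw [← mul_pow]; simp
  simp only [← mul_assoc, h2, one_mul] at h
  simpa using h.symm

theorem wmon_le {β : ℝ} (hβ : β ≤ 0) (n : ℕ) {x : ℝ} (hx : x ∈ Icc (0 : ℝ) 1) :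
    |wmon β n x| ≤ (1 - x) ^ β := by
  have h1 : (1 + x) ^ β ≤ 1 := Real.rpow_le_one_of_one_le_of_nonpos (by linarith [hx.1]) hβ
  have h2 : x ^ n ≤ 1 := pow_le_one₀ hx.1 hx.2
  have h3 : 0 ≤ (1 - x) ^ β := Real.rpow_nonneg (by linarith [hx.2]) _
  have h4 : 0 ≤ (1 + x) ^ β := Real.rpow_nonneg (by linarith [hx.1]) _
  have h5 : 0 ≤ x ^ n := pow_nonneg hx.1 _
  rw [wmon, one_sub_sq_rpow ⟨by linarith [hx.1], hx.2⟩, abs_of_nonneg (by positivity)]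
  calc (1 - x) ^ β * (1 + x) ^ β * x ^ n ≤ (1 - x) ^ β * 1 * 1 := by gcongr
    _ = _ := by ring

theorem hasDerivAt_wmon (β : ℝ) (n : ℕ) {x : ℝ} (hx : x ∈ Ioo (-1 : ℝ) 1) :
    HasDerivAt (wmon β n)
      (-2 * β * wmon (β - 1) (n + 1) x + n * wmon β (n - 1) x) x := by
  have hpos : 0 < 1 - x ^ 2 := by nlinarith [hx.1, hx.2]
  have h1 : HasDerivAt (fun x : ℝ => 1 - x ^ 2) (-(2 * x)) x := by
    simpa using (hasDerivAt_pow 2 x).const_sub 1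
  have h2 := (h1.rpow_const (p := β) (Or.inl hpos.ne')).mul (hasDerivAt_pow n x)
  refine h2.congr_deriv ?_
  simp only [wmon]
  ring

/-- Cut at distance δ = 1/|ξ| from the singularity. Within δ the total mass is at most
δ^{β+1}/(β+1). On the rest one integration by parts gains a factor δ, while the boundary terms and
the total variation cost O((n+1) δ^β). The growth in n is kept explicit because a series over n is
summed later. -/
theorem norm_half_le {β : ℝ} (hβ : -1 < β) (hβ0 : β ≤ 0) (n : ℕ) {ξ : ℝ} (hξ : 1 ≤ |ξ|) :
    ‖∫ x in (0 : ℝ)..1, (wmon β n x : ℂ) * Complex.exp (-(x * ξ) * Complex.I)‖ ≤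
      (1 / (β + 1) + 4) * (n + 1) * |ξ| ^ (-(β + 1)) := by
  set δ : ℝ := |ξ|⁻¹ with hδ
  have hξ0 : 0 < |ξ| := by linarith
  have hξne : ξ ≠ 0 := abs_pos.1 hξ0
  have hδ0 : 0 < δ := by positivity
  have hδ1 : δ ≤ 1 := inv_le_one_of_one_le₀ hξ
  have hpow : |ξ| ^ (-(β + 1)) = δ ^ (β + 1) := by
    rw [hδ, Real.inv_rpow hξ0.le, Real.rpow_neg hξ0.le]
  have hδp : δ ^ (β + 1) = δ * δ ^ β := by rw [Real.rpow_add hδ0, Real.rpow_one]; ring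
  have hδβ : 1 ≤ δ ^ β := Real.one_le_rpow_of_pos_of_le_one_of_nonpos hδ0 hδ1 hβ0
  have hii : ∀ a ∈ Icc (0 : ℝ) 1, ∀ b ∈ Icc (0 : ℝ) 1, IntervalIntegrable
      (fun x : ℝ => (wmon β n x : ℂ) * Complex.exp (-(x * ξ) * Complex.I)) volume a b := by
    intro a ha b hb
    refine IntervalIntegrable.mul_continuousOn ?_ (continuous_exp_neg_mul_I ξ).continuousOn
    refine intervalIntegrable_ofReal ((intervalIntegrable_wmon_right hβ n).mono_set ?_)
    rw [uIcc_of_le zero_le_one]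
    exact uIcc_subset_Icc ha hb
  have m0 : (0 : ℝ) ∈ Icc (0 : ℝ) 1 := by simp
  have m1 : (1 : ℝ) ∈ Icc (0 : ℝ) 1 := by simp
  have md : 1 - δ ∈ Icc (0 : ℝ) 1 := ⟨by linarith, by linarith⟩
  rw [← intervalIntegral.integral_add_adjacent_intervals (hii 0 m0 _ md) (hii _ md 1 m1)]
  -- the part near the end point
  have near : ‖∫ x in (1 - δ)..1, (wmon β n x : ℂ) * Complex.exp (-(x * ξ) * Complex.I)‖ ≤
      δ ^ (β + 1) / (β + 1) := by
    have e : ∫ x in (1 - δ)..1, (1 - x) ^ β = δ ^ (β + 1) / (β + 1) := by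
      rw [intervalIntegral.integral_comp_sub_left (fun x => x ^ β) 1, integral_rpow (Or.inl hβ)]
      simp [Real.zero_rpow (show β + 1 ≠ 0 by linarith)]
    rw [← e]
    refine intervalIntegral.norm_integral_le_of_norm_le (by linarith) ?_
      (intervalIntegrable_one_sub_rpow hβ _)
    refine Filter.Eventually.of_forall fun x hx => ?_
    rw [norm_mul, norm_exp_neg_mul_I, mul_one, Complex.norm_real, Real.norm_eq_abs]
    exact wmon_le hβ0 n ⟨by linarith [hx.1], hx.2⟩
  -- the remaining part
  have hsub : ∀ x ∈ Icc 0 (1 - δ), x ∈ Ioo (-1 : ℝ) 1 :=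
    fun x hx => ⟨by linarith [hx.1], by linarith [hx.2]⟩
  have hcw : ∀ (γ : ℝ) (k : ℕ), ContinuousOn (wmon γ k) (Icc 0 (1 - δ)) := fun γ k x hx =>
    (hasDerivAt_wmon γ k (hsub x hx)).continuousAt.continuousWithinAt
  have hle : (0 : ℝ) ≤ 1 - δ := by linarith
  have far : ‖∫ x in (0 : ℝ)..(1 - δ), (wmon β n x : ℂ) *
      Complex.exp (-(x * ξ) * Complex.I)‖ ≤ δ * (δ ^ β * (n + 4)) := by
    have ibp := intervalIntegral.integral_mul_deriv_eq_deriv_mul_of_hasDerivAt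
      (a := 0) (b := 1 - δ) (u := fun x : ℝ => (wmon β n x : ℂ))
      (v := fun x : ℝ => Complex.exp (-(x * ξ) * Complex.I))
      (u' := fun x : ℝ => ((-2 * β * wmon (β - 1) (n + 1) x + n * wmon β (n - 1) x : ℝ) : ℂ))
      (v' := fun x : ℝ => Complex.exp (-(x * ξ) * Complex.I) * (-ξ * Complex.I))
      (by rw [uIcc_of_le hle]; exact Complex.continuous_ofReal.comp_continuousOn (hcw β n))
      (continuous_exp_neg_mul_I ξ).continuousOn
      (fun x hx => HasDerivAt.ofReal_comp (hasDerivAt_wmon β n (hsub x (by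
        simp only [hle, inf_of_le_left, sup_of_le_right] at hx; exact Ioo_subset_Icc_self hx))))
      (fun x _ => hasDerivAt_exp_neg_mul_I ξ x)
      (by
        refine ContinuousOn.intervalIntegrable ?_
        rw [uIcc_of_le hle]
        exact Complex.continuous_ofReal.comp_continuousOn
          ((continuousOn_const.mul (hcw _ _)).add (continuousOn_const.mul (hcw _ _))))
      (Continuous.intervalIntegrable (by fun_prop) _ _)
    have e1 : (∫ x in (0 : ℝ)..(1 - δ), (wmon β n x : ℂ) *
        (Complex.exp (-(x * ξ) * Complex.I) * (-ξ * Complex.I))) =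
        (∫ x in (0 : ℝ)..(1 - δ), (wmon β n x : ℂ) * Complex.exp (-(x * ξ) * Complex.I)) *
          (-ξ * Complex.I) := by
      rw [← intervalIntegral.integral_mul_const]
      exact intervalIntegral.integral_congr fun x _ => by ring
    rw [e1] at ibp
    have hb1 : ‖∫ x in (0 : ℝ)..(1 - δ),
        ((-2 * β * wmon (β - 1) (n + 1) x + n * wmon β (n - 1) x : ℝ) : ℂ) *
          Complex.exp (-(x * ξ) * Complex.I)‖ ≤ δ ^ β * (n + 2) := by
      -- A majorant of the derivative of the weight with an explicit primitive: the first summand is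
      -- bounded by -2β(1-x)^{β-1}, the second by the constant nδ^β, since x ≤ 1-δ and β ≤ 0.
      have hd : ∀ x ∈ uIcc 0 (1 - δ), HasDerivAt (fun x : ℝ => 2 * (1 - x) ^ β + n * δ ^ β * x)
          (-2 * β * (1 - x) ^ (β - 1) + n * δ ^ β) x := by
        intro x hx
        rw [uIcc_of_le hle] at hx
        have h1 : HasDerivAt (fun x : ℝ => 1 - x) (-1) x := (hasDerivAt_id x).const_sub 1
        have h2 := ((h1.rpow_const (p := β) (Or.inl (by linarith [hx.2]))).const_mul 2).add
          ((hasDerivAt_id x).const_mul (n * δ ^ β))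
        exact h2.congr_deriv (by ring)
      have hint : IntervalIntegrable (fun x : ℝ => -2 * β * (1 - x) ^ (β - 1) + n * δ ^ β)
          volume 0 (1 - δ) := by
        refine ContinuousOn.intervalIntegrable ?_
        refine (continuousOn_const.mul (ContinuousOn.rpow_const (by fun_prop) fun x hx =>
          Or.inl ?_)).add continuousOn_const
        rw [uIcc_of_le hle] at hx
        linarith [hx.2]
      have e2 := intervalIntegral.integral_eq_sub_of_hasDerivAt hd hint
      have e3 : ∫ x in (0 : ℝ)..(1 - δ), (-2 * β * (1 - x) ^ (β - 1) + n * δ ^ β) ≤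
          δ ^ β * (n + 2) := by
        rw [e2]
        have : 0 ≤ (n : ℝ) * δ ^ β * δ := by positivity
        simp only [sub_sub_cancel, sub_zero, Real.one_rpow]
        linarith
      refine le_trans (intervalIntegral.norm_integral_le_of_norm_le hle ?_ hint) e3
      refine Filter.Eventually.of_forall fun x hx => ?_
      have hx1 : x ∈ Icc (0 : ℝ) 1 := ⟨hx.1.le, by linarith [hx.2]⟩
      rw [norm_mul, norm_exp_neg_mul_I, mul_one, Complex.norm_real, Real.norm_eq_abs]
      refine (abs_add_le _ _).trans (add_le_add ?_ ?_)
      · rw [abs_mul, abs_of_nonneg (show 0 ≤ -2 * β by linarith)]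
        exact mul_le_mul_of_nonneg_left (wmon_le (by linarith) _ hx1) (by linarith)
      · rw [abs_mul, Nat.abs_cast]
        refine mul_le_mul_of_nonneg_left ((wmon_le hβ0 _ hx1).trans ?_) (by positivity)
        exact Real.rpow_le_rpow_of_nonpos hδ0 (by linarith [hx.2]) hβ0
    have hn : ∀ z : ℂ, ‖z‖ = ‖z * (-ξ * Complex.I)‖ * δ := by
      intro z
      rw [norm_mul, norm_mul, norm_neg, Complex.norm_I, mul_one, Complex.norm_real,
        Real.norm_eq_abs, mul_assoc, hδ, mul_inv_cancel₀ hξ0.ne', mul_one]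
    rw [hn, ibp, mul_comm]
    refine mul_le_mul_of_nonneg_left ?_ hδ0.le
    have hw : ∀ x ∈ Icc (0 : ℝ) (1 - δ),
        ‖(wmon β n x : ℂ) * Complex.exp (-(x * ξ) * Complex.I)‖ ≤ δ ^ β := by
      intro x hx
      rw [norm_mul, norm_exp_neg_mul_I, mul_one, Complex.norm_real, Real.norm_eq_abs]
      refine (wmon_le hβ0 n ⟨hx.1, by linarith [hx.2]⟩).trans ?_
      exact Real.rpow_le_rpow_of_nonpos hδ0 (by linarith [hx.2]) hβ0
    calc _ ≤ δ ^ β + δ ^ β + δ ^ β * (n + 2) :=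
          (norm_sub_le _ _).trans (add_le_add ((norm_sub_le _ _).trans (add_le_add
            (hw _ ⟨hle, le_rfl⟩) (hw 0 ⟨le_rfl, hle⟩))) hb1)
      _ = _ := by ring
  rw [hpow]
  refine (norm_add_le _ _).trans ((add_le_add far near).trans ?_)
  have hp : 0 < δ ^ (β + 1) := by positivity
  have hb : 0 < 1 / (β + 1) := one_div_pos.2 (by linarith)
  calc δ * (δ ^ β * (n + 4)) + δ ^ (β + 1) / (β + 1)
      = δ ^ (β + 1) * (n + 4 + 1 / (β + 1)) := by rw [hδp]; ring
    _ ≤ δ ^ (β + 1) * ((1 / (β + 1) + 4) * (n + 1)) := by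
        refine mul_le_mul_of_nonneg_left ?_ hp.le
        have : (0 : ℝ) ≤ n := n.cast_nonneg
        nlinarith [mul_nonneg hb.le this]
    _ = _ := by ring

theorem intervalFT_wmon_base {β : ℝ} (hβ : -1 < β) (hβ0 : β ≤ 0) (n : ℕ) {ξ : ℝ}
    (hξ : 1 ≤ |ξ|) :
    ‖intervalFT (fun x => wmon β n x) ξ‖ ≤
      2 * (1 / (β + 1) + 4) * (n + 1) * |ξ| ^ (-(β + 1)) := by
  have hi := intervalIntegrable_ofReal (intervalIntegrable_wmon hβ n)
  have hi2 := hi.mul_continuousOn (continuous_exp_neg_mul_I ξ).continuousOn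
  have h0 : (0 : ℝ) ∈ uIcc (-1 : ℝ) 1 := by rw [uIcc_of_le (by norm_num)]; simp
  rw [intervalFT, ← intervalIntegral.integral_add_adjacent_intervals (b := 0)
    (hi2.mono_set (uIcc_subset_uIcc_left h0)) (hi2.mono_set (uIcc_subset_uIcc_right h0))]
  have e : ∫ x in (-1 : ℝ)..0, (wmon β n x : ℂ) * Complex.exp (-(x * ξ) * Complex.I) =
      (-1) ^ n * ∫ x in (0 : ℝ)..1, (wmon β n x : ℂ) *
        Complex.exp (-(x * (-ξ : ℝ)) * Complex.I) := by
    have := intervalIntegral.integral_comp_neg (a := -1) (b := 0)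
      (fun x : ℝ => (wmon β n (-x) : ℂ) * Complex.exp (x * ξ * Complex.I))
    simp only [neg_neg, neg_zero] at this
    rw [← intervalIntegral.integral_const_mul]
    refine Eq.trans (intervalIntegral.integral_congr fun x _ => ?_)
      (this.trans (intervalIntegral.integral_congr fun x _ => ?_))
    · push_cast; ring_nf
    · simp only [wmon_neg]; push_cast; ring_nf
  rw [e]
  refine (norm_add_le _ _).trans ?_
  rw [norm_mul, norm_pow, norm_neg, norm_one, one_pow, one_mul]
  have h1 := norm_half_le hβ hβ0 n (ξ := -ξ) (by rwa [abs_neg])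
  rw [abs_neg] at h1
  linarith [norm_half_le hβ hβ0 n hξ]

/-- Both summands carry the exponent β-1, so that an induction lowering β by one closes. For n = 0
the truncated `n - 1` is harmless because its coefficient vanishes. -/
theorem hasDerivAt_wmon' (β : ℝ) (n : ℕ) {x : ℝ} (hx : x ∈ Ioo (-1 : ℝ) 1) :
    HasDerivAt (wmon β n)
      (n * wmon (β - 1) (n - 1) x - (n + 2 * β) * wmon (β - 1) (n + 1) x) x := by
  refine (hasDerivAt_wmon β n hx).congr_deriv ?_
  have hpos : 0 < 1 - x ^ 2 := by nlinarith [hx.1, hx.2]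
  have e : (1 - x ^ 2) ^ β = (1 - x ^ 2) ^ (β - 1) * (1 - x ^ 2) := by
    rw [← Real.rpow_add_one hpos.ne']; congr 1; ring
  simp only [wmon]
  rw [e]
  rcases n with _ | n
  · simp
  · simp only [Nat.add_sub_cancel]; ring

theorem continuous_wmon {β : ℝ} (hβ : 0 ≤ β) (n : ℕ) : Continuous (wmon β n) := by
  unfold wmon
  exact (Continuous.rpow_const (by fun_prop) fun _ => Or.inr hβ).mul (by fun_prop)

theorem wmon_endpoints {β : ℝ} (hβ : 0 < β) (n : ℕ) : wmon β n (-1) = 0 ∧ wmon β n 1 = 0 := by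
  simp [wmon, Real.zero_rpow hβ.ne']

theorem intervalFT_add {f g : ℝ → ℂ} (hf : IntervalIntegrable f volume (-1) 1)
    (hg : IntervalIntegrable g volume (-1) 1) (ξ : ℝ) :
    intervalFT (fun x => f x + g x) ξ = intervalFT f ξ + intervalFT g ξ := by
  unfold intervalFT
  rw [← intervalIntegral.integral_add
    (hf.mul_continuousOn (continuous_exp_neg_mul_I ξ).continuousOn)
    (hg.mul_continuousOn (continuous_exp_neg_mul_I ξ).continuousOn)]
  exact intervalIntegral.integral_congr fun x _ => by ring

theorem intervalFT_const_mul (c : ℂ) (f : ℝ → ℂ) (ξ : ℝ) :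
    intervalFT (fun x => c * f x) ξ = c * intervalFT f ξ := by
  unfold intervalFT
  rw [← intervalIntegral.integral_const_mul]
  exact intervalIntegral.integral_congr fun x _ => by ring

theorem intervalFT_congr {f g : ℝ → ℂ} (h : ∀ x ∈ Ioo (-1 : ℝ) 1, f x = g x) (ξ : ℝ) :
    intervalFT f ξ = intervalFT g ξ := by
  refine intervalIntegral.integral_congr_ae ?_
  have : ∀ᵐ x : ℝ, x ≠ 1 := by simp [ae_iff]
  filter_upwards [this] with x hx1 hx
  rw [uIoc_of_le (by norm_num)] at hx
  rw [h x ⟨hx.1, lt_of_le_of_ne hx.2 hx1⟩]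

theorem intervalFT_wmon_deriv {β : ℝ} (hβ : 0 < β) (n : ℕ) (ξ : ℝ) :
    Complex.I * ξ * intervalFT (fun x => wmon β n x) ξ =
      n * intervalFT (fun x => wmon (β - 1) (n - 1) x) ξ -
        (n + 2 * β) * intervalFT (fun x => wmon (β - 1) (n + 1) x) ξ := by
  have hi : ∀ k, IntervalIntegrable (fun x => (wmon (β - 1) k x : ℂ)) volume (-1) 1 :=
    fun k => intervalIntegrable_ofReal (intervalIntegrable_wmon (by linarith) k)
  rw [← intervalFT_deriv (f := fun x => (wmon β n x : ℂ)) (f' := fun x => (n : ℂ) * wmon (β - 1) (n - 1) x +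
      (-(n + 2 * β)) * wmon (β - 1) (n + 1) x)
    (Complex.continuous_ofReal.comp (continuous_wmon hβ.le n)).continuousOn
    (by simp [wmon_endpoints hβ]) (by simp [wmon_endpoints hβ])
    (fun x hx => (hasDerivAt_wmon' β n hx).ofReal_comp.congr_deriv (by push_cast; ring))
    (((hi _).const_mul _).add ((hi _).const_mul _)),
    intervalFT_add ((hi _).const_mul _) ((hi _).const_mul _), intervalFT_const_mul,
    intervalFT_const_mul]
  ring

/-- Each use of `intervalFT_wmon_deriv` trades one unit of β for one power of ξ. The constants `C`
and `k` depend on β alone: passing from n to n ± 1 costs at most 2^k, and the coefficients n and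
n+2β raise the degree `k` by one. -/
theorem intervalFT_wmon_decay_aux (j : ℕ) : ∀ β : ℝ, -1 < β → β ≤ j →
    ∃ C : ℝ, ∃ k : ℕ, 0 ≤ C ∧ ∀ n : ℕ, ∀ ξ : ℝ, 1 ≤ |ξ| →
      ‖intervalFT (fun x => wmon β n x) ξ‖ ≤ C * (n + 1) ^ k * |ξ| ^ (-(β + 1)) := by
  induction j with
  | zero =>
    intro β h1 h2
    refine ⟨2 * (1 / (β + 1) + 4), 1, ?_, fun n ξ hξ => ?_⟩
    · have : 0 < 1 / (β + 1) := one_div_pos.2 (by linarith)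
      positivity
    · rw [pow_one]; exact intervalFT_wmon_base h1 (by simpa using h2) n hξ
  | succ j ih =>
    intro β h1 h2
    rcases le_or_gt β 0 with h0 | h0
    · exact ih β h1 (h0.trans j.cast_nonneg)
    obtain ⟨C, k, hC, h⟩ := ih (β - 1) (by linarith) (by push_cast at h2; linarith)
    refine ⟨C * 2 ^ k * (2 + 2 * β), k + 1, by positivity, fun n ξ hξ => ?_⟩
    have hξ0 : 0 < |ξ| := by linarith
    have hn : (0 : ℝ) ≤ n := n.cast_nonneg
    set p := |ξ| ^ (-(β - 1 + 1)) with hp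
    have hp0 : 0 < p := by positivity
    have hpp : |ξ| ^ (-(β + 1)) * |ξ| = p := by
      rw [← Real.rpow_add_one hξ0.ne', hp]; congr 1; ring
    have e := congrArg norm (intervalFT_wmon_deriv h0 n ξ)
    rw [norm_mul, norm_mul, Complex.norm_I, one_mul, Complex.norm_real, Real.norm_eq_abs] at e
    have b1 : ‖intervalFT (fun x => wmon (β - 1) (n - 1) x) ξ‖ ≤ C * (2 * (n + 1)) ^ k * p := by
      refine (h (n - 1) ξ hξ).trans ?_
      have : ((n - 1 : ℕ) : ℝ) ≤ n := by exact_mod_cast Nat.sub_le n 1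
      gcongr
      linarith
    have b2 : ‖intervalFT (fun x => wmon (β - 1) (n + 1) x) ξ‖ ≤ C * (2 * (n + 1)) ^ k * p := by
      refine (h (n + 1) ξ hξ).trans ?_
      push_cast
      gcongr
      linarith
    have b3 : ‖(n : ℂ) + 2 * β‖ = n + 2 * β := by
      have : (n : ℂ) + 2 * β = ((n + 2 * β : ℝ) : ℂ) := by push_cast; ring
      rw [this, Complex.norm_real, Real.norm_of_nonneg (by positivity)]
    have b4 : |ξ| * ‖intervalFT (fun x => wmon β n x) ξ‖ ≤
        (C * 2 ^ k * (2 + 2 * β) * (n + 1) ^ (k + 1)) * p := by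
      rw [e]
      refine (norm_sub_le _ _).trans ?_
      rw [norm_mul, norm_mul, b3, Complex.norm_natCast]
      calc _ ≤ n * (C * (2 * (n + 1)) ^ k * p) + (n + 2 * β) * (C * (2 * (n + 1)) ^ k * p) := by
            gcongr
        _ = (C * (2 * (n + 1)) ^ k * p) * (2 * n + 2 * β) := by ring
        _ ≤ (C * (2 * (n + 1)) ^ k * p) * ((2 + 2 * β) * (n + 1)) := by
            gcongr
            nlinarith [mul_nonneg h0.le hn]
        _ = _ := by rw [mul_pow]; ring
    rw [← hpp] at b4
    refine le_of_mul_le_mul_left ?_ hξ0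
    linarith

theorem norm_intervalFT_le {f : ℝ → ℂ} {C : ℝ} (h : ∀ x ∈ Icc (-1 : ℝ) 1, ‖f x‖ ≤ C) (ξ : ℝ) :
    ‖intervalFT f ξ‖ ≤ 2 * C := by
  have := intervalIntegral.norm_integral_le_of_norm_le_const (a := -1) (b := 1) (C := C)
    (f := fun x : ℝ => f x * Complex.exp (-(x * ξ) * Complex.I)) fun x hx => by
      rw [uIoc_of_le (by norm_num)] at hx
      rw [norm_mul, norm_exp_neg_mul_I, mul_one]
      exact h x (Ioc_subset_Icc_self hx)
  refine this.trans (le_of_eq ?_)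
  norm_num [mul_comm]

theorem abs_wmon_le_one {β : ℝ} (hβ : 0 ≤ β) (n : ℕ) {x : ℝ} (hx : x ∈ Icc (-1 : ℝ) 1) :
    |wmon β n x| ≤ 1 := by
  have h1 : x ^ 2 ≤ 1 := by nlinarith [hx.1, hx.2]
  rw [wmon, abs_mul, abs_pow, abs_of_nonneg (Real.rpow_nonneg (by linarith) _)]
  exact mul_le_one₀ (Real.rpow_le_one (by linarith) (by nlinarith) hβ) (by positivity)
    (pow_le_one₀ (abs_nonneg _) (abs_le.2 ⟨hx.1, hx.2⟩))

theorem intervalFT_wmon_decay {β : ℝ} (hβ : 0 ≤ β) :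
    ∃ C : ℝ, ∃ k : ℕ, 0 ≤ C ∧ ∀ n : ℕ, ∀ ξ : ℝ,
      ‖intervalFT (fun x => wmon β n x) ξ‖ ≤ C * (n + 1) ^ k * (1 + |ξ|) ^ (-(β + 1)) := by
  obtain ⟨j, hj⟩ := exists_nat_ge β
  obtain ⟨C, k, hC, h⟩ := intervalFT_wmon_decay_aux j β (by linarith) hj
  refine ⟨(C + 2) * 2 ^ (β + 1), k, by positivity, fun n ξ => ?_⟩
  have hn : (1 : ℝ) ≤ (n + 1) ^ k := one_le_pow₀ (by linarith [n.cast_nonneg (α := ℝ)])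
  have key : ∀ t : ℝ, 0 < t → 1 + |ξ| ≤ 2 * t →
      t ^ (-(β + 1)) ≤ 2 ^ (β + 1) * (1 + |ξ|) ^ (-(β + 1)) := by
    intro t ht h2
    have h3 : (2 * t) ^ (-(β + 1)) ≤ (1 + |ξ|) ^ (-(β + 1)) :=
      Real.rpow_le_rpow_of_nonpos (by positivity) h2 (by linarith)
    rw [Real.mul_rpow (by norm_num) ht.le, Real.rpow_neg (by norm_num : (0 : ℝ) ≤ 2)] at h3
    rwa [← div_le_iff₀' (by positivity), div_eq_inv_mul]
  rcases le_or_gt 1 |ξ| with h1 | h1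
  · calc _ ≤ C * (n + 1) ^ k * |ξ| ^ (-(β + 1)) := h n ξ h1
      _ ≤ (C + 2) * (n + 1) ^ k * (2 ^ (β + 1) * (1 + |ξ|) ^ (-(β + 1))) := by
          gcongr
          · linarith
          · exact key _ (by linarith) (by linarith)
      _ = _ := by ring
  · have := key 1 one_pos (by linarith)
    rw [Real.one_rpow] at this
    calc _ ≤ 2 * 1 := norm_intervalFT_le (fun x hx => by
            rw [Complex.norm_real]; exact abs_wmon_le_one hβ n hx) ξ
      _ ≤ (C + 2) * (n + 1) ^ k * (2 ^ (β + 1) * (1 + |ξ|) ^ (-(β + 1))) := by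
          refine mul_le_mul ?_ this zero_le_one (by positivity)
          nlinarith
      _ = _ := by ring

end

end RieszJacobi

/-! ### Spherical Bessel functions and their orthogonality on the half line. -/

namespace RieszJacobi

noncomputable section

open MeasureTheory Set

/-- The real Fourier integral `∫_{-1}^1 (1 - x²)^ν cos(x ξ) dx`. -/
def wft (ν ξ : ℝ) : ℝ := ∫ x in (-1 : ℝ)..1, wmon ν 0 x * Real.cos (x * ξ)

theorem intervalFT_wmon_zero {ν : ℝ} (hν : -1 < ν) (ξ : ℝ) :
    intervalFT (fun x => wmon ν 0 x) ξ = wft ν ξ := by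
  have hi := intervalIntegrable_wmon hν 0
  have h1 : IntervalIntegrable (fun x => wmon ν 0 x * Real.cos (x * ξ)) volume (-1) 1 :=
    hi.mul_continuousOn (by fun_prop)
  have h2 : IntervalIntegrable (fun x => wmon ν 0 x * Real.sin (x * ξ)) volume (-1) 1 :=
    hi.mul_continuousOn (by fun_prop)
  have odd : ∫ x in (-1 : ℝ)..1, wmon ν 0 x * Real.sin (x * ξ) = 0 := by
    have := intervalIntegral.integral_comp_neg (a := -1) (b := 1)
      (fun x : ℝ => wmon ν 0 x * Real.sin (x * ξ))
    simp only [wmon_neg, pow_zero, one_mul, neg_mul, Real.sin_neg, mul_neg, neg_neg,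
      intervalIntegral.integral_neg] at this
    linarith
  have e : ∀ x : ℝ, (wmon ν 0 x : ℂ) * Complex.exp (-(x * ξ) * Complex.I) =
      ((wmon ν 0 x * Real.cos (x * ξ) : ℝ) : ℂ) -
        ((wmon ν 0 x * Real.sin (x * ξ) : ℝ) : ℂ) * Complex.I := by
    intro x
    rw [neg_mul, Complex.exp_neg, ← neg_neg (((x : ℂ) * ξ) * Complex.I), Complex.exp_neg, inv_inv,
      ← neg_mul, Complex.exp_mul_I, Complex.cos_neg, Complex.sin_neg]
    push_cast; ring
  unfold intervalFT
  simp_rw [e]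
  rw [intervalIntegral.integral_sub (intervalIntegrable_ofReal h1)
    ((intervalIntegrable_ofReal h2).mul_const _), intervalIntegral.integral_mul_const,
    intervalIntegral.integral_ofReal, intervalIntegral.integral_ofReal, odd]
  simp [wft]

theorem wft_neg (ν ξ : ℝ) : wft ν (-ξ) = wft ν ξ := by
  simp [wft]

theorem wft_decay {ν : ℝ} (hν : 0 ≤ ν) :
    ∃ C : ℝ, 0 ≤ C ∧ ∀ ξ : ℝ, |wft ν ξ| ≤ C * (1 + |ξ|) ^ (-(ν + 1)) := by
  obtain ⟨C, k, hC, h⟩ := intervalFT_wmon_decay hν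
  refine ⟨C, hC, fun ξ => ?_⟩
  have := h 0 ξ
  rw [intervalFT_wmon_zero (by linarith), Complex.norm_real, Real.norm_eq_abs] at this
  simpa using this

theorem hasDerivAt_intervalFT {f : ℝ → ℂ} (hf : IntervalIntegrable f volume (-1) 1) (ξ : ℝ) :
    HasDerivAt (intervalFT f) (-Complex.I * intervalFT (fun x => f x * x) ξ) ξ := by
  have hm : ∀ η : ℝ, AEStronglyMeasurable
      (fun x : ℝ => f x * Complex.exp (-(x * η) * Complex.I))
      (volume.restrict (uIoc (-1 : ℝ) 1)) := fun η =>
    (intervalIntegrable_iff.1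
      (hf.mul_continuousOn (continuous_exp_neg_mul_I η).continuousOn)).aestronglyMeasurable
  have hx : IntervalIntegrable (fun x : ℝ => f x * x) volume (-1) 1 :=
    hf.mul_continuousOn Complex.continuous_ofReal.continuousOn
  have h := intervalIntegral.hasDerivAt_integral_of_dominated_loc_of_deriv_le (μ := volume)
    (a := -1) (b := 1) (x₀ := ξ) (s := univ) (bound := fun x => ‖f x‖)
    (F := fun (η : ℝ) (x : ℝ) => f x * Complex.exp (-(x * η) * Complex.I))
    (F' := fun (η : ℝ) (x : ℝ) =>
      f x * (Complex.exp (-(x * η) * Complex.I) * (-x * Complex.I)))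
    Filter.univ_mem (Filter.Eventually.of_forall hm)
    (hf.mul_continuousOn (continuous_exp_neg_mul_I ξ).continuousOn)
    (by
      have := (intervalIntegrable_iff.1 ((hx.mul_continuousOn
        (continuous_exp_neg_mul_I ξ).continuousOn).mul_const (-Complex.I))).aestronglyMeasurable
      exact this.congr (Filter.Eventually.of_forall fun x => by ring))
    (Filter.Eventually.of_forall fun x hx η _ => by
      rw [norm_mul, norm_mul, norm_exp_neg_mul_I, one_mul, norm_mul, Complex.norm_I, norm_neg,
        Complex.norm_real, mul_one, Real.norm_eq_abs]
      rw [uIoc_of_le (by norm_num)] at hx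
      exact mul_le_of_le_one_right (norm_nonneg _) (abs_le.2 ⟨hx.1.le, hx.2⟩))
    hf.norm
    (Filter.Eventually.of_forall fun x _ η _ => by
      have := hasDerivAt_exp_neg_mul_I x η
      simp only [mul_comm _ (x : ℂ)] at this
      exact this.const_mul (f x))
  refine h.2.congr_deriv ?_
  unfold intervalFT
  rw [← intervalIntegral.integral_const_mul]
  exact intervalIntegral.integral_congr fun x _ => by ring

theorem wft_eq_re {ν : ℝ} (hν : -1 < ν) (ξ : ℝ) :
    wft ν ξ = (intervalFT (fun x => wmon ν 0 x) ξ).re := by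
  rw [intervalFT_wmon_zero hν, Complex.ofReal_re]

theorem intervalFT_wmon_one {ν : ℝ} (hν : -1 < ν) (ξ : ℝ) :
    (2 * (ν + 1)) * intervalFT (fun x => wmon ν 1 x) ξ = -(Complex.I * ξ * wft (ν + 1) ξ) := by
  rw [← intervalFT_wmon_zero (by linarith), intervalFT_wmon_deriv (by linarith)]
  simp

/-- Differentiating in ξ multiplies the integrand by -ix, and x(1-x²)^ν is a multiple of the
derivative of (1-x²)^{ν+1}. -/
theorem hasDerivAt_wft {ν : ℝ} (hν : -1 < ν) (ξ : ℝ) :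
    HasDerivAt (wft ν) (-(ξ / (2 * (ν + 1))) * wft (ν + 1) ξ) ξ := by
  have h := hasDerivAt_intervalFT (intervalIntegrable_ofReal (intervalIntegrable_wmon hν 0)) ξ
  have h2 := (Complex.reCLM.hasFDerivAt.comp_hasDerivAt ξ h)
  have e : wft ν = Complex.reCLM ∘ intervalFT (fun x => wmon ν 0 x) :=
    funext fun ξ => wft_eq_re hν ξ
  rw [e]
  refine h2.congr_deriv ?_
  have h3 := intervalFT_wmon_one hν ξ
  have hne : (2 * (ν + 1) : ℂ) ≠ 0 := by
    have : ((2 * (ν + 1) : ℝ) : ℂ) ≠ 0 := Complex.ofReal_ne_zero.2 (by linarith)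
    push_cast at this; exact this
  have e2 : intervalFT (fun x => (wmon ν 0 x : ℂ) * x) ξ = intervalFT (fun x => wmon ν 1 x) ξ := by
    congr 1; funext x; simp [wmon]
  have e3 : intervalFT (fun x => wmon ν 1 x) ξ =
      -(Complex.I * ξ * wft (ν + 1) ξ) / (2 * (ν + 1)) := by
    rw [← h3, mul_div_cancel_left₀ _ hne]
  rw [e2, e3]
  have e4 : -Complex.I * (-(Complex.I * ξ * wft (ν + 1) ξ) / (2 * (ν + 1))) =
      ((-(ξ / (2 * (ν + 1))) * wft (ν + 1) ξ : ℝ) : ℂ) := by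
    push_cast
    linear_combination (ξ * wft (ν + 1) ξ / (2 * (ν + 1)) : ℂ) * Complex.I_mul_I
  rw [e4, Complex.reCLM_apply, Complex.ofReal_re]

theorem continuous_wft {ν : ℝ} (hν : -1 < ν) : Continuous (wft ν) :=
  continuous_iff_continuousAt.2 fun ξ => (hasDerivAt_wft hν ξ).continuousAt

/-- Two derivatives fall on (1-x²)^{ν+1}, and the factor x² which they produce is replaced by
1-(1-x²). Positivity of ν makes the exponent ν-1 integrable. -/
theorem wft_rec {ν : ℝ} (hν : 0 < ν) (ξ : ℝ) :
    ξ ^ 2 * wft (ν + 1) ξ =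
      2 * (ν + 1) * ((2 * ν + 1) * wft ν ξ - 2 * ν * wft (ν - 1) ξ) := by
  have h1 := intervalFT_wmon_one (show -1 < ν by linarith) ξ
  have h2 := intervalFT_wmon_deriv hν 1 ξ
  have hi : ∀ β : ℝ, -1 < β → IntervalIntegrable (fun x => (wmon β 0 x : ℂ)) volume (-1) 1 :=
    fun β hβ => intervalIntegrable_ofReal (intervalIntegrable_wmon hβ 0)
  have e : intervalFT (fun x => wmon (ν - 1) (1 + 1) x) ξ =
      wft (ν - 1) ξ - wft ν ξ := by
    rw [← intervalFT_wmon_zero (by linarith), ← intervalFT_wmon_zero (by linarith)]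
    have := intervalFT_add (hi (ν - 1) (by linarith)) ((hi ν (by linarith)).const_mul (-1)) ξ
    rw [intervalFT_const_mul] at this
    rw [sub_eq_add_neg (intervalFT _ ξ), ← neg_one_mul (intervalFT _ ξ), ← this]
    refine intervalFT_congr (fun x hx => ?_) ξ
    have hpos : 0 < 1 - x ^ 2 := by nlinarith [hx.1, hx.2]
    have e : (1 - x ^ 2) ^ ν = (1 - x ^ 2) ^ (ν - 1) * (1 - x ^ 2) := by
      rw [← Real.rpow_add_one hpos.ne']; congr 1; ring
    simp only [wmon, e]
    push_cast; ring
  rw [e, Nat.sub_self, intervalFT_wmon_zero (by linarith)] at h2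
  have : ((ξ ^ 2 * wft (ν + 1) ξ : ℝ) : ℂ) =
      ((2 * (ν + 1) * ((2 * ν + 1) * wft ν ξ - 2 * ν * wft (ν - 1) ξ) : ℝ) : ℂ) := by
    push_cast at h2 ⊢
    linear_combination (ξ ^ 2 * wft (ν + 1) ξ : ℂ) * Complex.I_mul_I -
      (Complex.I * ξ : ℂ) * h1 + (2 * (ν + 1) : ℂ) * h2
  exact_mod_cast this

/-- The multiple `x^ν Φ_ν(x) / (2^ν Γ(ν+1))`, `Φ_ν` the Fourier transform of `(1 - x²)^ν`, of the
spherical Bessel function of order `ν`. -/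
def sphBessel (ν x : ℝ) : ℝ := x ^ ν * wft ν x / (2 ^ ν * Real.Gamma (ν + 1))

theorem hasDerivAt_sphBessel {ν : ℝ} (hν : 0 ≤ ν) {x : ℝ} (hx : 0 < x) :
    HasDerivAt (sphBessel ν) (ν / x * sphBessel ν x - sphBessel (ν + 1) x) x := by
  have h := (((Real.hasDerivAt_rpow_const (p := ν) (Or.inl hx.ne')).mul
    (hasDerivAt_wft (show -1 < ν by linarith) x)).div_const (2 ^ ν * Real.Gamma (ν + 1)))
  refine h.congr_deriv ?_
  have hg : 0 < Real.Gamma (ν + 1) := Real.Gamma_pos_of_pos (by linarith)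
  simp only [sphBessel]
  rw [Real.Gamma_add_one (s := ν + 1) (by linarith), Real.rpow_sub_one hx.ne',
    Real.rpow_add_one hx.ne', Real.rpow_add_one (by norm_num)]
  have : (0 : ℝ) < 2 ^ ν := by positivity
  have : ν + 1 ≠ 0 := by linarith
  field_simp
  ring

theorem sphBessel_rec {ν : ℝ} (hν : 0 ≤ ν) {x : ℝ} (hx : 0 < x) :
    sphBessel ν x + sphBessel (ν + 2) x = (2 * ν + 3) / x * sphBessel (ν + 1) x := by
  have hr := wft_rec (show 0 < ν + 1 by linarith) x
  rw [add_sub_cancel_right, show ν + 1 + 1 = ν + 2 by ring] at hr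
  have hg : 0 < Real.Gamma (ν + 1) := Real.Gamma_pos_of_pos (by linarith)
  simp only [sphBessel]
  rw [show ν + 2 + 1 = ν + 1 + 1 + 1 by ring, Real.Gamma_add_one (s := ν + 1 + 1) (by linarith),
    Real.Gamma_add_one (s := ν + 1) (by linarith), show ν + 2 = ν + 1 + 1 by ring,
    Real.rpow_add_one hx.ne' (ν + 1),
    Real.rpow_add_one hx.ne', Real.rpow_add_one (by norm_num) (ν + 1),
    Real.rpow_add_one (by norm_num)]
  have h2 : (0 : ℝ) < 2 ^ ν := by positivity
  have hx' : (0 : ℝ) < x ^ ν := by positivity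
  have h1 : ν + 1 ≠ 0 := by linarith
  have h3 : ν + 1 + 1 ≠ 0 := by linarith
  rw [show ν + 2 = ν + 1 + 1 by ring] at hr
  field_simp
  linear_combination hr

/-- The factor x^ν uses up all but one power of the decay of Φ_ν. The rate 1/(1+x) is the same for
all orders, so a product of two such functions is integrable. -/
theorem sphBessel_decay {ν : ℝ} (hν : 0 ≤ ν) :
    ∃ C : ℝ, 0 ≤ C ∧ ∀ x : ℝ, 0 ≤ x → |sphBessel ν x| ≤ C / (1 + x) := by
  obtain ⟨C, hC, h⟩ := wft_decay hν
  have hg : 0 < Real.Gamma (ν + 1) := Real.Gamma_pos_of_pos (by linarith)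
  refine ⟨C / (2 ^ ν * Real.Gamma (ν + 1)), by positivity, fun x hx => ?_⟩
  have h1 : 0 < 1 + x := by linarith
  have hh := h x
  rw [abs_of_nonneg hx] at hh
  rw [sphBessel, abs_div, abs_mul, abs_of_nonneg (Real.rpow_nonneg hx _),
    abs_of_pos (show 0 < (2 : ℝ) ^ ν * Real.Gamma (ν + 1) by positivity), div_right_comm]
  gcongr
  rw [le_div_iff₀ h1]
  calc x ^ ν * |wft ν x| * (1 + x)
      ≤ (1 + x) ^ ν * (C * (1 + x) ^ (-(ν + 1))) * (1 + x) := by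
        gcongr
        linarith
    _ = C * ((1 + x) ^ ν * (1 + x) ^ (-(ν + 1)) * (1 + x)) := by ring
    _ = C := by
        rw [← Real.rpow_add h1, ← Real.rpow_add_one h1.ne']
        ring_nf
        rw [Real.rpow_zero, mul_one]

theorem continuous_sphBessel {ν : ℝ} (hν : 0 ≤ ν) : Continuous (sphBessel ν) := by
  unfold sphBessel
  exact ((Real.continuous_rpow_const hν).mul (continuous_wft (by linarith))).div_const _

theorem sphBessel_zero {ν : ℝ} (hν : 0 < ν) : sphBessel ν 0 = 0 := by
  simp [sphBessel, Real.zero_rpow hν.ne']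

theorem integrableOn_one_add_rpow {r : ℝ} (hr : 1 < r) :
    IntegrableOn (fun x : ℝ => (1 + x) ^ (-r)) (Ioi 0) := by
  have h : Integrable (fun x : ℝ => (1 + ‖x‖) ^ (-r)) :=
    integrable_one_add_norm (by simpa using hr)
  refine h.integrableOn.congr_fun (fun x hx => ?_) measurableSet_Ioi
  simp only [Real.norm_eq_abs, abs_of_pos (mem_Ioi.1 hx)]

theorem integrableOn_of_decay {f : ℝ → ℝ} {r C : ℝ} (hr : 1 < r) (hc : ContinuousOn f (Ioi 0))
    (hb : ∀ x : ℝ, 0 < x → |f x| ≤ C * (1 + x) ^ (-r)) : IntegrableOn f (Ioi 0) := by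
  refine Integrable.mono' ((integrableOn_one_add_rpow hr).const_mul C)
    (hc.aestronglyMeasurable measurableSet_Ioi) ?_
  filter_upwards [ae_restrict_mem measurableSet_Ioi] with x hx
  exact hb x hx

theorem tendsto_of_decay {f : ℝ → ℝ} {r C : ℝ} (hr : 0 < r)
    (hb : ∀ x : ℝ, 0 < x → |f x| ≤ C * (1 + x) ^ (-r)) :
    Filter.Tendsto f Filter.atTop (nhds 0) := by
  have h1 : Filter.Tendsto (fun x : ℝ => C * (1 + x) ^ (-r)) Filter.atTop (nhds 0) := by
    rw [← mul_zero C]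
    exact ((tendsto_rpow_neg_atTop hr).comp
      (Filter.tendsto_atTop_add_const_left _ 1 Filter.tendsto_id)).const_mul C
  refine squeeze_zero_norm' ?_ h1
  filter_upwards [Filter.eventually_gt_atTop 0] with x hx
  exact hb x hx

theorem sphBessel_mul_decay {μ ν : ℝ} (hμ : 0 ≤ μ) (hν : 0 ≤ ν) :
    ∃ C : ℝ, ∀ x : ℝ, 0 ≤ x → |sphBessel μ x * sphBessel ν x| ≤ C * (1 + x) ^ (-2 : ℝ) := by
  obtain ⟨C, hC, h⟩ := sphBessel_decay hμ
  obtain ⟨D, hD, h'⟩ := sphBessel_decay hν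
  refine ⟨C * D, fun x hx => ?_⟩
  have h1 : 0 < 1 + x := by linarith
  rw [abs_mul]
  calc _ ≤ C / (1 + x) * (D / (1 + x)) := by
        gcongr
        · exact h x hx
        · exact h' x hx
    _ = _ := by
        rw [Real.rpow_neg h1.le, Real.rpow_two]
        field_simp

theorem integrableOn_sphBessel_mul {μ ν : ℝ} (hμ : 0 ≤ μ) (hν : 0 ≤ ν) :
    IntegrableOn (fun x => sphBessel μ x * sphBessel ν x) (Ioi 0) := by
  obtain ⟨C, h⟩ := sphBessel_mul_decay hμ hν
  exact integrableOn_of_decay (by norm_num)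
    ((continuous_sphBessel hμ).mul (continuous_sphBessel hν)).continuousOn fun x hx => h x hx.le

/-- The pairing `∫_0^∞ j_μ j_ν`. -/
def sphPair (μ ν : ℝ) : ℝ := ∫ x in Ioi (0 : ℝ), sphBessel μ x * sphBessel ν x

theorem sphPair_comm (μ ν : ℝ) : sphPair μ ν = sphPair ν μ := by
  simp only [sphPair, mul_comm]

/-- The derivative of x(j_ν² + j_{ν+1}²) is (2ν+1)j_ν² - (2ν+3)j_{ν+1}², and the function vanishes
at 0 and at infinity. -/
theorem sphPair_self_succ {ν : ℝ} (hν : 0 ≤ ν) :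
    (2 * ν + 1) * sphPair ν ν = (2 * ν + 3) * sphPair (ν + 1) (ν + 1) := by
  have hν1 : 0 ≤ ν + 1 := by linarith
  have i0 := integrableOn_sphBessel_mul hν hν
  have i1 := integrableOn_sphBessel_mul hν1 hν1
  have key := integral_Ioi_of_hasDerivAt_of_tendsto (a := 0) (m := 0)
    (f := fun x => x * (sphBessel ν x * sphBessel ν x + sphBessel (ν + 1) x * sphBessel (ν + 1) x))
    (f' := fun x => (2 * ν + 1) * (sphBessel ν x * sphBessel ν x) -
      (2 * ν + 3) * (sphBessel (ν + 1) x * sphBessel (ν + 1) x))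
    (by
      have := continuous_sphBessel hν
      have := continuous_sphBessel hν1
      exact Continuous.continuousWithinAt (by fun_prop))
    (fun x hx => by
      have hx : 0 < x := hx
      have d0 := hasDerivAt_sphBessel hν hx
      have d1 := hasDerivAt_sphBessel hν1 hx
      have r := sphBessel_rec hν hx
      rw [show ν + 1 + 1 = ν + 2 by ring] at d1
      refine ((hasDerivAt_id x).mul ((d0.mul d0).add (d1.mul d1))).congr_deriv ?_
      have e : sphBessel (ν + 2) x =
          (2 * ν + 3) / x * sphBessel (ν + 1) x - sphBessel ν x := by linarith
      simp only [id, Pi.mul_apply, Pi.add_apply]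
      rw [e]
      field_simp
      ring)
    ((i0.const_mul _).sub (i1.const_mul _))
    (by
      obtain ⟨C, hC⟩ := sphBessel_mul_decay hν hν
      obtain ⟨D, hD⟩ := sphBessel_mul_decay hν1 hν1
      refine tendsto_of_decay (r := 1) (C := C + D) one_pos fun x hx => ?_
      have h1 : 0 < 1 + x := by linarith
      rw [abs_mul, abs_of_pos hx]
      calc _ ≤ (1 + x) * (C * (1 + x) ^ (-2 : ℝ) + D * (1 + x) ^ (-2 : ℝ)) := by
            refine mul_le_mul (by linarith) ((abs_add_le _ _).trans
              (add_le_add (hC x hx.le) (hD x hx.le))) (abs_nonneg _) h1.le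
        _ = (C + D) * ((1 + x) ^ (-2 : ℝ) * (1 + x)) := by ring
        _ = _ := by rw [← Real.rpow_add_one h1.ne']; norm_num)
  rw [integral_sub (i0.const_mul _) (i1.const_mul _), integral_const_mul, integral_const_mul] at key
  simp only [zero_mul, sub_zero] at key
  unfold sphPair
  linarith

/-- The recurrence removes the factor 1/x from the derivative, so that integrating a product rule
yields only the pairings `sphPair`. -/
theorem hasDerivAt_sphBessel_succ {ν : ℝ} (hν : 0 ≤ ν) {x : ℝ} (hx : 0 < x) :
    HasDerivAt (sphBessel (ν + 1)) (((ν + 1) * sphBessel ν x -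
      (ν + 2) * sphBessel (ν + 2) x) / (2 * ν + 3)) x := by
  have d1 := hasDerivAt_sphBessel (show 0 ≤ ν + 1 by linarith) hx
  refine d1.congr_deriv ?_
  have r := sphBessel_rec hν hx
  have h3 : 2 * ν + 3 ≠ 0 := by linarith
  have e : sphBessel (ν + 1) x / x = (sphBessel ν x + sphBessel (ν + 2) x) / (2 * ν + 3) := by
    rw [r]; field_simp
  rw [show ν + 1 + 1 = ν + 2 by ring, div_mul_eq_mul_div, mul_div_assoc, e]
  field_simp
  ring

/-- Both sides are ∫ j_{μ+1} j_{ν+1} / x, with j/x expanded by the recurrence in the first or in the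
second factor. -/
theorem sphPair_mixed {μ ν : ℝ} (hμ : 0 ≤ μ) (hν : 0 ≤ ν) :
    (sphPair μ (ν + 1) + sphPair (μ + 2) (ν + 1)) / (2 * μ + 3) =
      (sphPair (μ + 1) ν + sphPair (μ + 1) (ν + 2)) / (2 * ν + 3) := by
  have i := fun {a b : ℝ} (ha : 0 ≤ a) (hb : 0 ≤ b) => integrableOn_sphBessel_mul ha hb
  unfold sphPair
  rw [← integral_add (i hμ (by linarith)) (i (by linarith) (by linarith)),
    ← integral_add (i (by linarith) hν) (i (by linarith) (by linarith)),
    ← integral_div, ← integral_div]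
  refine setIntegral_congr_fun measurableSet_Ioi fun x hx => ?_
  have hx : 0 < x := hx
  have r1 := sphBessel_rec hμ hx
  have r2 := sphBessel_rec hν hx
  rw [← add_mul, ← mul_add, r1, r2]
  have h3 : 2 * ν + 3 ≠ 0 := by linarith
  have h4 : 2 * μ + 3 ≠ 0 := by linarith
  field_simp

/-- The integral of (j_{μ+1} j_{ν+1})', whose boundary values are zero. -/
theorem sphPair_deriv {μ ν : ℝ} (hμ : 0 ≤ μ) (hν : 0 ≤ ν) :
    ((μ + 1) * sphPair μ (ν + 1) - (μ + 2) * sphPair (μ + 2) (ν + 1)) / (2 * μ + 3) +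
      ((ν + 1) * sphPair (μ + 1) ν - (ν + 2) * sphPair (μ + 1) (ν + 2)) / (2 * ν + 3) = 0 := by
  have i := fun {a b : ℝ} (ha : 0 ≤ a) (hb : 0 ≤ b) => integrableOn_sphBessel_mul ha hb
  have hμ1 : 0 ≤ μ + 1 := by linarith
  have hν1 : 0 ≤ ν + 1 := by linarith
  have i1 : IntegrableOn (fun x => ((μ + 1) * (sphBessel μ x * sphBessel (ν + 1) x) -
        (μ + 2) * (sphBessel (μ + 2) x * sphBessel (ν + 1) x)) / (2 * μ + 3)) (Ioi 0) :=
    (((i hμ hν1).const_mul (μ + 1)).sub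
      ((i (show 0 ≤ μ + 2 by linarith) hν1).const_mul (μ + 2))).div_const (2 * μ + 3)
  have i2 : IntegrableOn (fun x => ((ν + 1) * (sphBessel (μ + 1) x * sphBessel ν x) -
        (ν + 2) * (sphBessel (μ + 1) x * sphBessel (ν + 2) x)) / (2 * ν + 3)) (Ioi 0) :=
    (((i hμ1 hν).const_mul (ν + 1)).sub
      ((i hμ1 (show 0 ≤ ν + 2 by linarith)).const_mul (ν + 2))).div_const (2 * ν + 3)
  have key := integral_Ioi_of_hasDerivAt_of_tendsto (a := 0) (m := 0)
    (f := fun x => sphBessel (μ + 1) x * sphBessel (ν + 1) x)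
    (f' := fun x => ((μ + 1) * (sphBessel μ x * sphBessel (ν + 1) x) -
        (μ + 2) * (sphBessel (μ + 2) x * sphBessel (ν + 1) x)) / (2 * μ + 3) +
      ((ν + 1) * (sphBessel (μ + 1) x * sphBessel ν x) -
        (ν + 2) * (sphBessel (μ + 1) x * sphBessel (ν + 2) x)) / (2 * ν + 3))
    ((continuous_sphBessel hμ1).mul (continuous_sphBessel hν1)).continuousWithinAt
    (fun x hx => ((hasDerivAt_sphBessel_succ hμ hx).mul
      (hasDerivAt_sphBessel_succ hν hx)).congr_deriv (by ring))
    (i1.add i2)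
    (by
      obtain ⟨C, hC⟩ := sphBessel_mul_decay hμ1 hν1
      exact tendsto_of_decay (r := 2) two_pos fun x hx => hC x hx.le)
  rw [sphBessel_zero (by linarith), zero_mul, sub_zero] at key
  rw [← key]
  unfold sphPair
  rw [integral_add i1 i2, integral_div, integral_div, integral_sub, integral_sub,
    integral_const_mul, integral_const_mul, integral_const_mul, integral_const_mul]
  all_goals exact Integrable.const_mul (i (by linarith) (by linarith)) _

/-- `sphPair_mixed` and `sphPair_deriv` are two linear relations among four pairings. Once two of
these vanish or cancel, the other two satisfy a nonsingular homogeneous 2×2 system. -/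
theorem sphPair_even (k : ℕ) : ∀ ν : ℝ, 0 ≤ ν → sphPair (ν + 2 * (k + 1 : ℕ)) ν = 0 := by
  induction k with
  | zero =>
    intro ν hν
    have h1 := sphPair_mixed (show 0 ≤ ν + 1 by linarith) hν
    have h2 := sphPair_deriv (show 0 ≤ ν + 1 by linarith) hν
    have h3 := sphPair_self_succ (show 0 ≤ ν + 1 by linarith)
    rw [show ν + 1 + 1 = ν + 2 by ring] at h1 h2 h3
    rw [show ν + 2 * ((0 + 1 : ℕ) : ℝ) = ν + 2 by push_cast; ring]
    have a3 : 2 * ν + 3 ≠ 0 := by linarith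
    have a5 : 2 * ν + 5 ≠ 0 := by linarith
    rw [show 2 * (ν + 1) + 3 = 2 * ν + 5 by ring] at h1 h2 h3
    rw [show 2 * (ν + 1) + 1 = 2 * ν + 3 by ring] at h3
    rw [div_eq_div_iff a5 a3] at h1
    rw [div_add_div _ _ a5 a3, div_eq_zero_iff, or_iff_left (mul_ne_zero a5 a3)] at h2
    refine (mul_eq_zero.1 (?_ : (2 * ν + 5) * sphPair (ν + 2) ν = 0)).resolve_left a5
    -- By `h3` the diagonal pairings of orders ν+1 and ν+2 cancel in both relations. What remains
    -- for X = `sphPair (ν + 2) ν` / (2ν+3) is (ν+1)X - (ν+3)X = 0.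
    linear_combination (-1 / 2) * h2 + ((ν + 2) / 2) * h3 - ((ν + 3) / 2) * (h1 - h3)
  | succ k ih =>
    intro ν hν
    have h1 := sphPair_mixed (μ := ν + 2 * (k + 1 : ℕ) + 1) (by positivity) hν
    have h2 := sphPair_deriv (μ := ν + 2 * (k + 1 : ℕ) + 1) (by positivity) hν
    have z1 := ih (ν + 1) (by linarith)
    have z2 := ih (ν + 2) (by linarith)
    rw [show ν + 1 + 2 * ((k + 1 : ℕ) : ℝ) = ν + 2 * (k + 1 : ℕ) + 1 by ring] at z1
    rw [show ν + 2 + 2 * ((k + 1 : ℕ) : ℝ) = ν + 2 * (k + 1 : ℕ) + 1 + 1 by ring] at z2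
    rw [show ν + 2 * ((k + 1 + 1 : ℕ) : ℝ) = ν + 2 * (k + 1 : ℕ) + 1 + 1 by push_cast; ring]
    have hμν : ν ≤ ν + 2 * (k + 1 : ℕ) + 1 := by
      have : (0 : ℝ) ≤ (k + 1 : ℕ) := Nat.cast_nonneg _
      linarith
    generalize ν + 2 * ((k + 1 : ℕ) : ℝ) + 1 = μ at *
    rw [z1, z2, zero_add, add_zero] at h1
    rw [z1, z2, mul_zero, mul_zero, zero_sub, sub_zero, neg_div, mul_div_assoc, h1] at h2
    have h3 : (2 * ν + 3) ≠ 0 := by linarith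
    -- The coefficient is (ν+1) - (μ+2), which is nonzero because ν ≤ μ.
    have h4 : (ν - μ - 1) * sphPair (μ + 1) ν = 0 := by
      field_simp at h2
      linear_combination h2
    exact (mul_eq_zero.1 h4).resolve_left (by linarith)

end

end RieszJacobi

/-! ### Moment recursions for the norm of j_α, 0 ≤ α < 1. -/

namespace RieszJacobi

noncomputable section

open MeasureTheory Set

/-- The Euler derivative `x Φ_κ'(x)` of the Fourier transform `Φ_κ` of `(1 - x²)^κ`. -/
def wftEuler (κ x : ℝ) : ℝ := -(x ^ 2 / (2 * (κ + 1))) * wft (κ + 1) x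

theorem hasDerivAt_wft_euler {κ : ℝ} (hκ : 0 ≤ κ) {x : ℝ} (hx : 0 < x) :
    HasDerivAt (wft κ) (wftEuler κ x / x) x := by
  refine (hasDerivAt_wft (by linarith) x).congr_deriv ?_
  unfold wftEuler
  field_simp

theorem wftEuler_eq {κ : ℝ} (hκ : 0 < κ) (x : ℝ) :
    wftEuler κ x = 2 * κ * wft (κ - 1) x - (2 * κ + 1) * wft κ x := by
  have h := wft_rec hκ x
  have : κ + 1 ≠ 0 := by linarith
  unfold wftEuler
  field_simp
  linear_combination -h

/-- Bessel's equation in Euler form: with θ = x d/dx, θ²Φ + (2κ+1)θΦ + x²Φ = 0. -/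
theorem hasDerivAt_wftEuler {κ : ℝ} (hκ : 0 ≤ κ) {x : ℝ} (hx : 0 < x) :
    HasDerivAt (wftEuler κ) ((-(2 * κ + 1) * wftEuler κ x - x ^ 2 * wft κ x) / x) x := by
  have h1 := hasDerivAt_wft_euler (show 0 ≤ κ + 1 by linarith) hx
  have h2 := (((hasDerivAt_pow 2 x).div_const (2 * (κ + 1))).neg).mul h1
  refine h2.congr_deriv ?_
  rw [wftEuler_eq (by linarith), add_sub_cancel_right]
  have : κ + 1 ≠ 0 := by linarith
  simp only [wftEuler, Pi.neg_apply]
  field_simp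
  push_cast
  ring

theorem continuous_wftEuler {κ : ℝ} (hκ : 0 ≤ κ) : Continuous (wftEuler κ) := by
  have := continuous_wft (show -1 < κ + 1 by linarith)
  unfold wftEuler
  fun_prop

theorem wft_decay_pos {κ : ℝ} (hκ : 0 ≤ κ) :
    ∃ C : ℝ, 0 ≤ C ∧ ∀ x : ℝ, 0 < x → |wft κ x| ≤ C * (1 + x) ^ (-(κ + 1)) := by
  obtain ⟨C, hC, h⟩ := wft_decay hκ
  exact ⟨C, hC, fun x hx => by simpa [abs_of_pos hx] using h x⟩

theorem wftEuler_decay {κ : ℝ} (hκ : 0 ≤ κ) :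
    ∃ C : ℝ, 0 ≤ C ∧ ∀ x : ℝ, 0 < x → |wftEuler κ x| ≤ C * (1 + x) ^ (-κ) := by
  obtain ⟨C, hC, h⟩ := wft_decay_pos (show 0 ≤ κ + 1 by linarith)
  refine ⟨1 / (2 * (κ + 1)) * C, by positivity, fun x hx => ?_⟩
  have h1 : 0 < 1 + x := by linarith
  rw [wftEuler, abs_mul, abs_neg, abs_of_nonneg (by positivity)]
  calc x ^ 2 / (2 * (κ + 1)) * |wft (κ + 1) x|
      ≤ (1 + x) ^ 2 / (2 * (κ + 1)) * (C * (1 + x) ^ (-(κ + 1 + 1))) := by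
        gcongr
        · linarith
        · exact h x hx
    _ = 1 / (2 * (κ + 1)) * C * ((1 + x) ^ (-(κ + 1 + 1)) * (1 + x) ^ (2 : ℕ)) := by ring
    _ = _ := by
        rw [← Real.rpow_add_natCast h1.ne']
        congr 2
        push_cast; ring

theorem rpow_mul_decay {f g : ℝ → ℝ} {a b s : ℝ} (hs : 0 ≤ s)
    (hf : ∃ C : ℝ, 0 ≤ C ∧ ∀ x : ℝ, 0 < x → |f x| ≤ C * (1 + x) ^ (-a))
    (hg : ∃ C : ℝ, 0 ≤ C ∧ ∀ x : ℝ, 0 < x → |g x| ≤ C * (1 + x) ^ (-b)) :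
    ∃ C : ℝ, 0 ≤ C ∧ ∀ x : ℝ, 0 < x → |x ^ s * (f x * g x)| ≤ C * (1 + x) ^ (-(a + b - s)) := by
  obtain ⟨C, hC, h⟩ := hf
  obtain ⟨D, hD, h'⟩ := hg
  refine ⟨C * D, by positivity, fun x hx => ?_⟩
  have h1 : 0 < 1 + x := by linarith
  rw [abs_mul, abs_mul, abs_of_nonneg (Real.rpow_nonneg hx.le _)]
  calc _ ≤ (1 + x) ^ s * ((C * (1 + x) ^ (-a)) * (D * (1 + x) ^ (-b))) := by
        gcongr
        · linarith
        · exact h x hx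
        · exact h' x hx
    _ = C * D * ((1 + x) ^ s * (1 + x) ^ (-a) * (1 + x) ^ (-b)) := by ring
    _ = _ := by
        rw [← Real.rpow_add h1, ← Real.rpow_add h1]
        congr 2; ring

theorem integrableOn_rpow_mul {f g : ℝ → ℝ} {a b s : ℝ} (hs : 0 ≤ s)
    (hf : ∃ C : ℝ, 0 ≤ C ∧ ∀ x : ℝ, 0 < x → |f x| ≤ C * (1 + x) ^ (-a))
    (hg : ∃ C : ℝ, 0 ≤ C ∧ ∀ x : ℝ, 0 < x → |g x| ≤ C * (1 + x) ^ (-b))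
    (hfc : Continuous f) (hgc : Continuous g) (hab : 1 < a + b - s) :
    IntegrableOn (fun x => x ^ s * (f x * g x)) (Ioi 0) := by
  obtain ⟨C, _, h⟩ := rpow_mul_decay hs hf hg
  exact integrableOn_of_decay hab
    ((Real.continuous_rpow_const hs).mul (hfc.mul hgc)).continuousOn h

/-- `∫_0^∞ x^{2α} Φ_μ(x) Φ_ν(x) dx`. -/
def wftMoment (α μ ν : ℝ) : ℝ := ∫ x in Ioi (0 : ℝ), x ^ (2 * α) * (wft μ x * wft ν x)

/-- `∫_0^∞ x^{2α} (x Φ_μ'(x)) Φ_ν(x) dx`. -/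
def wftEulerMoment (α μ ν : ℝ) : ℝ := ∫ x in Ioi (0 : ℝ), x ^ (2 * α) * (wftEuler μ x * wft ν x)

variable {α μ ν : ℝ}

theorem integrableOn_wftMoment (hα : 0 ≤ α) (hμ : 0 ≤ μ) (hν : 0 ≤ ν) (h : 2 * α < μ + ν + 1) :
    IntegrableOn (fun x => x ^ (2 * α) * (wft μ x * wft ν x)) (Ioi 0) :=
  integrableOn_rpow_mul (by linarith) (wft_decay_pos hμ) (wft_decay_pos hν)
    (continuous_wft (by linarith)) (continuous_wft (by linarith)) (by linarith)

theorem integrableOn_wftEulerMoment (hα : 0 ≤ α) (hμ : 0 ≤ μ) (hν : 0 ≤ ν) (h : 2 * α < μ + ν) :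
    IntegrableOn (fun x => x ^ (2 * α) * (wftEuler μ x * wft ν x)) (Ioi 0) :=
  integrableOn_rpow_mul (by linarith) (wftEuler_decay hμ) (wft_decay_pos hν)
    (continuous_wftEuler hμ) (continuous_wft (by linarith)) (by linarith)

theorem wftMoment_comm (α μ ν : ℝ) : wftMoment α μ ν = wftMoment α ν μ := by
  simp only [wftMoment, mul_comm (wft μ _)]

theorem wftEulerMoment_eq (hα : 0 ≤ α) (hμ : 1 ≤ μ) (hν : 0 ≤ ν) (h : 2 * α < μ + ν) :
    wftEulerMoment α μ ν =
      2 * μ * wftMoment α (μ - 1) ν - (2 * μ + 1) * wftMoment α μ ν := by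
  have i1 := integrableOn_wftMoment hα (show 0 ≤ μ - 1 by linarith) hν (by linarith)
  have i2 := integrableOn_wftMoment hα (show 0 ≤ μ by linarith) hν (by linarith)
  unfold wftEulerMoment wftMoment
  rw [← integral_const_mul, ← integral_const_mul, ← integral_sub (i1.const_mul _) (i2.const_mul _)]
  refine integral_congr_ae (Filter.Eventually.of_forall fun x => ?_)
  simp only [wftEuler_eq (show 0 < μ by linarith)]
  ring

/-- The integral of the derivative of x^{2α+1} Φ_μ Φ_ν, which vanishes at 0 and at infinity. -/
theorem wftMoment_add (hα : 0 ≤ α) (hμ : 0 ≤ μ) (hν : 0 ≤ ν) (h : 2 * α < μ + ν) :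
    (2 * α + 1) * wftMoment α μ ν + wftEulerMoment α μ ν + wftEulerMoment α ν μ = 0 := by
  have i0 := (integrableOn_wftMoment hα hμ hν (by linarith)).const_mul (2 * α + 1)
  have i1 := integrableOn_wftEulerMoment hα hμ hν h
  have i2 := integrableOn_wftEulerMoment hα hν hμ (by linarith)
  have cμ := continuous_wft (show -1 < μ by linarith)
  have cν := continuous_wft (show -1 < ν by linarith)
  obtain ⟨C, _, hC⟩ := rpow_mul_decay (show 0 ≤ 2 * α + 1 by linarith) (wft_decay_pos hμ)
    (wft_decay_pos hν)
  have key := integral_Ioi_of_hasDerivAt_of_tendsto (a := 0) (m := 0)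
    (f := fun x => x ^ (2 * α + 1) * (wft μ x * wft ν x))
    (f' := fun x => (2 * α + 1) * (x ^ (2 * α) * (wft μ x * wft ν x)) +
      x ^ (2 * α) * (wftEuler μ x * wft ν x) + x ^ (2 * α) * (wftEuler ν x * wft μ x))
    ((Real.continuous_rpow_const (by linarith)).mul (cμ.mul cν)).continuousWithinAt
    (fun x hx => by
      have hx : 0 < x := hx
      refine ((Real.hasDerivAt_rpow_const (p := 2 * α + 1) (Or.inl hx.ne')).mul
        ((hasDerivAt_wft_euler hμ hx).mul (hasDerivAt_wft_euler hν hx))).congr_deriv ?_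
      rw [add_sub_cancel_right, Real.rpow_add_one hx.ne']
      simp only [Pi.mul_apply]
      field_simp
      ring)
    ((i0.add i1).add i2)
    (tendsto_of_decay (by linarith) hC)
  have i01 : IntegrableOn (fun x => (2 * α + 1) * (x ^ (2 * α) * (wft μ x * wft ν x)) +
      x ^ (2 * α) * (wftEuler μ x * wft ν x)) (Ioi 0) := i0.add i1
  rw [integral_add i01 i2, integral_add i0 i1, integral_const_mul,
    Real.zero_rpow (by linarith), zero_mul, sub_zero] at key
  exact key

/-- A Wronskian argument: in the derivative of x^{2α+1}(θΦ_μ·Φ_ν - θΦ_ν·Φ_μ) the terms θΦ_μ·θΦ_ν and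
x²Φ_μΦ_ν cancel by Bessel's equation. -/
theorem wftEulerMoment_comm (hα : 0 ≤ α) (hμ : 0 ≤ μ) (hν : 0 ≤ ν) (h : 2 * α < μ + ν) :
    (α - μ) * wftEulerMoment α μ ν = (α - ν) * wftEulerMoment α ν μ := by
  have i1 := (integrableOn_wftEulerMoment hα hμ hν h).const_mul (2 * (α - μ))
  have i2 := (integrableOn_wftEulerMoment hα hν hμ (by linarith)).const_mul (2 * (α - ν))
  have cμ := continuous_wft (show -1 < μ by linarith)
  have cν := continuous_wft (show -1 < ν by linarith)
  have dμ := continuous_wftEuler hμ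
  have dν := continuous_wftEuler hν
  obtain ⟨C, _, hC⟩ := rpow_mul_decay (show 0 ≤ 2 * α + 1 by linarith) (wftEuler_decay hμ)
    (wft_decay_pos hν)
  obtain ⟨D, _, hD⟩ := rpow_mul_decay (show 0 ≤ 2 * α + 1 by linarith) (wftEuler_decay hν)
    (wft_decay_pos hμ)
  have t1 := (tendsto_of_decay (by linarith) hC).sub (tendsto_of_decay (by linarith) hD)
  rw [sub_zero] at t1
  have key := integral_Ioi_of_hasDerivAt_of_tendsto (a := 0) (m := 0)
    (f := fun x => x ^ (2 * α + 1) * (wftEuler μ x * wft ν x) -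
      x ^ (2 * α + 1) * (wftEuler ν x * wft μ x))
    (f' := fun x => 2 * (α - μ) * (x ^ (2 * α) * (wftEuler μ x * wft ν x)) -
      2 * (α - ν) * (x ^ (2 * α) * (wftEuler ν x * wft μ x)))
    (((Real.continuous_rpow_const (by linarith)).mul (dμ.mul cν)).sub
      ((Real.continuous_rpow_const (by linarith)).mul (dν.mul cμ))).continuousWithinAt
    (fun x hx => by
      have hx : 0 < x := hx
      have r := Real.hasDerivAt_rpow_const (x := x) (p := 2 * α + 1) (Or.inl hx.ne')
      refine ((r.mul ((hasDerivAt_wftEuler hμ hx).mul (hasDerivAt_wft_euler hν hx))).sub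
        (r.mul ((hasDerivAt_wftEuler hν hx).mul (hasDerivAt_wft_euler hμ hx)))).congr_deriv ?_
      rw [add_sub_cancel_right, Real.rpow_add_one hx.ne']
      simp only [Pi.mul_apply]
      field_simp
      ring)
    (i1.sub i2) t1
  rw [integral_sub i1 i2, integral_const_mul, integral_const_mul,
    Real.zero_rpow (by linarith), zero_mul, zero_mul, sub_zero, sub_zero] at key
  unfold wftEulerMoment
  linarith

theorem wft_zero_succ (hν : 0 < ν) :
    (2 * ν + 1) * wft ν 0 = 2 * ν * wft (ν - 1) 0 := by
  have h := wft_rec hν 0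
  have : 2 * (ν + 1) ≠ 0 := by linarith
  rw [zero_pow two_ne_zero, zero_mul, eq_comm, mul_eq_zero, or_iff_right this] at h
  linarith

theorem wmon_zero_nonneg (ν : ℝ) {x : ℝ} (hx : x ∈ Icc (-1 : ℝ) 1) : 0 ≤ wmon ν 0 x := by
  have : 0 ≤ 1 - x ^ 2 := by nlinarith [hx.1, hx.2]
  simp only [wmon, pow_zero, mul_one]
  positivity

theorem wft_zero_pos (hν : 0 ≤ ν) : 0 < wft ν 0 := by
  unfold wft
  refine intervalIntegral.intervalIntegral_pos_of_pos_on ?_ (fun x hx => ?_) (by norm_num)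
  · exact ((continuous_wmon hν 0).mul (by fun_prop)).intervalIntegrable _ _
  · have : 0 < 1 - x ^ 2 := by nlinarith [hx.1, hx.2]
    simp only [wmon, pow_zero, mul_one, mul_zero, Real.cos_zero]
    positivity

theorem abs_wft_le (hν : 0 ≤ ν) (ξ : ℝ) : |wft ν ξ| ≤ wft ν 0 := by
  unfold wft
  rw [← Real.norm_eq_abs]
  refine intervalIntegral.norm_integral_le_of_norm_le (by norm_num)
    (Filter.Eventually.of_forall fun x hx => ?_)
    (((continuous_wmon hν 0).mul (by fun_prop)).intervalIntegrable _ _)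
  have h0 := wmon_zero_nonneg ν (Ioc_subset_Icc_self hx)
  rw [mul_zero, Real.cos_zero, mul_one, Real.norm_eq_abs, abs_mul, abs_of_nonneg h0]
  exact mul_le_of_le_one_right h0 (Real.abs_cos_le_one _)

/-- From cos t ≥ 1 - t²/2 and x²(1-x²)^ν = (1-x²)^ν - (1-x²)^{ν+1}. -/
theorem le_wft (hν : 0 ≤ ν) (ξ : ℝ) :
    wft ν 0 - ξ ^ 2 / 2 * (wft ν 0 - wft (ν + 1) 0) ≤ wft ν ξ := by
  have c0 := continuous_wmon hν 0
  have c1 := continuous_wmon (show 0 ≤ ν + 1 by linarith) 0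
  simp only [wft, mul_zero, Real.cos_zero, mul_one]
  rw [← intervalIntegral.integral_sub (c0.intervalIntegrable _ _) (c1.intervalIntegrable _ _),
    ← intervalIntegral.integral_const_mul, ← intervalIntegral.integral_sub
    (c0.intervalIntegrable _ _) (Continuous.intervalIntegrable (by fun_prop) _ _)]
  refine intervalIntegral.integral_mono_on (by norm_num)
    (Continuous.intervalIntegrable (by fun_prop) _ _)
    (Continuous.intervalIntegrable (by fun_prop) _ _) fun x hx => ?_
  have h0 := wmon_zero_nonneg ν hx
  have e : wmon (ν + 1) 0 x = wmon ν 0 x * (1 - x ^ 2) := by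
    have : 0 ≤ 1 - x ^ 2 := by nlinarith [hx.1, hx.2]
    simp only [wmon, pow_zero, mul_one]
    rw [Real.rpow_add_one' this (by linarith)]
  rw [e]
  have := mul_le_mul_of_nonneg_left (Real.one_sub_sq_div_two_le_cos (x := x * ξ)) h0
  linarith

/-- The normalised weights (1-x²)^{α+k} concentrate at the origin: by `wft_zero_succ` their second
moment is 1/(2(α+k)+3). -/
theorem tendsto_wft_div (hα : 0 ≤ α) (ξ : ℝ) :
    Filter.Tendsto (fun k : ℕ => wft (α + k) ξ / wft (α + k) 0) Filter.atTop (nhds 1) := by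
  have hl : Filter.Tendsto (fun k : ℕ => 1 - ξ ^ 2 / 2 * (1 / ((k : ℝ) + 1)))
      Filter.atTop (nhds 1) := by
    have := (tendsto_one_div_add_atTop_nhds_zero_nat (𝕜 := ℝ)).const_mul (ξ ^ 2 / 2)
    simpa using this.const_sub 1
  refine tendsto_of_tendsto_of_tendsto_of_le_of_le hl tendsto_const_nhds (fun k => ?_)
    (fun k => ?_)
  · have hk : 0 ≤ α + k := by positivity
    have hp := wft_zero_pos hk
    have h1 := le_wft hk ξ
    have h2 := wft_zero_succ (show 0 < α + k + 1 by linarith)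
    rw [add_sub_cancel_right] at h2
    simp only
    rw [le_div_iff₀ hp]
    refine le_trans ?_ h1
    have h3 : wft (α + k) 0 - wft (α + k + 1) 0 = wft (α + k) 0 / (2 * (α + k) + 3) := by
      field_simp
      linarith
    rw [h3, sub_mul, one_mul, mul_assoc]
    have h4 : wft (α + k) 0 / (2 * (α + k) + 3) ≤ 1 / ((k : ℝ) + 1) * wft (α + k) 0 := by
      rw [one_div, ← div_eq_inv_mul]
      gcongr
      · linarith
      · norm_num
    gcongr
  · have hk : 0 ≤ α + k := by positivity
    exact (div_le_one (wft_zero_pos hk)).2 ((le_abs_self _).trans (abs_wft_le hk ξ))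

/-- At μ = α+k+1 and ν = α+1 the Wronskian relation reads E(ν,μ) = (k+1)E(μ,ν), where E is
`wftEulerMoment α`. The sum rule then determines E(μ,ν), and `wftEulerMoment_eq` expresses it
through the two moments. -/
theorem wftMoment_step (hα : 0 ≤ α) (k : ℕ) :
    2 * (α + k + 1) * (k + 2) * wftMoment α (α + k) (α + 1) =
      (k + 1) * (2 * (α + k + 1) + 3) * wftMoment α (α + k + 1) (α + 1) := by
  have h1 := wftMoment_add hα (show 0 ≤ α + k + 1 by positivity) (show 0 ≤ α + 1 by linarith)
    (by linarith [k.cast_nonneg (α := ℝ)])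
  have h2 := wftEulerMoment_comm hα (show 0 ≤ α + k + 1 by positivity)
    (show 0 ≤ α + 1 by linarith) (by linarith [k.cast_nonneg (α := ℝ)])
  have h3 := wftEulerMoment_eq hα (show 1 ≤ α + k + 1 by linarith [k.cast_nonneg (α := ℝ)])
    (show 0 ≤ α + 1 by linarith) (by linarith [k.cast_nonneg (α := ℝ)])
  rw [add_sub_cancel_right] at h3
  linear_combination h1 - h2 - (k + 2) * h3

/-- Dominated convergence with majorant x^{2α}|Φ_{α+1}|. This is O(x^{α-2}) at infinity, hence
integrable because α < 1. -/
theorem wftMoment_limit (hα : 0 ≤ α) (hα1 : α < 1) :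
    Filter.Tendsto (fun k : ℕ => wftMoment α (α + k) (α + 1) / wft (α + k) 0) Filter.atTop
      (nhds (∫ x in Ioi (0 : ℝ), x ^ (2 * α) * wft (α + 1) x)) := by
  obtain ⟨C, hC, h⟩ := wft_decay_pos (show 0 ≤ α + 1 by linarith)
  have c1 := continuous_wft (show -1 < α + 1 by linarith)
  have hone : ∃ C : ℝ, 0 ≤ C ∧ ∀ x : ℝ, 0 < x → |(1 : ℝ)| ≤ C * (1 + x) ^ (-(0 : ℝ)) :=
    ⟨1, zero_le_one, fun x _ => by simp⟩
  have hi := integrableOn_rpow_mul (s := 2 * α) (by linarith) hone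
    (wft_decay_pos (show 0 ≤ α + 1 by linarith)) continuous_const c1 (by linarith)
  simp only [one_mul] at hi
  have := tendsto_integral_of_dominated_convergence (μ := volume.restrict (Ioi (0 : ℝ)))
    (F := fun (k : ℕ) x => x ^ (2 * α) * (wft (α + k) x * wft (α + 1) x) / wft (α + k) 0)
    (f := fun x => x ^ (2 * α) * wft (α + 1) x) _
    (fun k => by
      have := continuous_wft (show -1 < α + k by linarith [k.cast_nonneg (α := ℝ)])
      have := Real.continuous_rpow_const (show 0 ≤ 2 * α by linarith)
      exact Continuous.aestronglyMeasurable (by fun_prop))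
    hi.norm
    (fun k => Filter.Eventually.of_forall fun x => by
      have hk : 0 ≤ α + k := by positivity
      have e : x ^ (2 * α) * (wft (α + k) x * wft (α + 1) x) / wft (α + k) 0 =
        (wft (α + k) x / wft (α + k) 0) * (x ^ (2 * α) * wft (α + 1) x) := by ring
      rw [e, norm_mul]
      refine mul_le_of_le_one_left (norm_nonneg _) ?_
      rw [Real.norm_eq_abs, abs_div, abs_of_pos (wft_zero_pos hk)]
      exact (div_le_one (wft_zero_pos hk)).2 (abs_wft_le hk x))
    (Filter.Eventually.of_forall fun x => by
      have := (tendsto_wft_div hα x).mul_const (x ^ (2 * α) * wft (α + 1) x)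
      rw [one_mul] at this
      refine this.congr fun k => by ring)
  simpa only [wftMoment, integral_div] using this

theorem wftMoment_self (hα : 0 ≤ α) (hα1 : α < 1) :
    (α + 1) * wftMoment α α α =
      wft α 0 * ∫ x in Ioi (0 : ℝ), x ^ (2 * α) * wft (α + 1) x := by
  set M := ∫ x in Ioi (0 : ℝ), x ^ (2 * α) * wft (α + 1) x
  -- An invariant of the recursion. Its value at k = 0 is compared with its limit, where the
  -- rational factor tends to 2.
  have hconst : ∀ k : ℕ, wftMoment α (α + k) (α + 1) / wft (α + k) 0 *
      ((2 * (α + k) + 3) / (k + 1)) = wftMoment α α (α + 1) / wft α 0 * (2 * α + 3) := by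
    intro k
    induction k with
    | zero => simp
    | succ k ih =>
      rw [← ih]
      have h1 := wftMoment_step hα k
      have h2 := wft_zero_succ (show 0 < α + k + 1 by positivity)
      rw [add_sub_cancel_right] at h2
      have p1 := wft_zero_pos (show 0 ≤ α + k by positivity)
      have p2 := wft_zero_pos (show 0 ≤ α + k + 1 by positivity)
      push_cast
      rw [← add_assoc α]
      have e : wft (α + k) 0 = (2 * (α + k + 1) + 1) * wft (α + k + 1) 0 / (2 * (α + k + 1)) := by
        field_simp; linarith
      rw [e]
      have : (0 : ℝ) < 2 * (α + k + 1) + 1 := by positivity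
      field_simp
      linear_combination (-(2 * (α + k) + 3)) * h1
  have hlim : Filter.Tendsto (fun k : ℕ => (2 * (α + k) + 3) / ((k : ℝ) + 1)) Filter.atTop
      (nhds 2) := by
    have := ((tendsto_one_div_add_atTop_nhds_zero_nat (𝕜 := ℝ)).const_mul (2 * α + 1)).const_add 2
    rw [mul_zero, add_zero] at this
    refine this.congr fun k => ?_
    field_simp
    ring
  have h0 := (wftMoment_limit hα hα1).mul hlim
  have h1 := tendsto_nhds_unique h0 ((tendsto_const_nhds (x := wftMoment α α (α + 1) /
    wft α 0 * (2 * α + 3))).congr fun k => (hconst k).symm)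
  have p := wft_zero_pos hα
  have h2 := wftEulerMoment_comm hα (show 0 ≤ α + 1 by linarith) hα (by linarith)
  have h3 := wftEulerMoment_eq hα (show 1 ≤ α + 1 by linarith) hα (by linarith)
  rw [add_sub_cancel_right, wftMoment_comm α (α + 1) α] at h3
  rw [sub_self, zero_mul] at h2
  -- The Wronskian relation degenerates when one order equals α. The vanishing of this moment links
  -- `wftMoment α α (α + 1)` to `wftMoment α α α`.
  have h4 : wftEulerMoment α (α + 1) α = 0 := by linarith
  rw [h4] at h3
  field_simp at h1
  linear_combination (-1 / 2) * h3 - (1 / 2) * h1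

end

end RieszJacobi

/-! ### Gaussian mixtures and the value of ∫ j_ν². -/

namespace RieszJacobi

noncomputable section

open MeasureTheory Set

/-- The function `e^{-t} t₊^ν`. -/
def gammaDensity (ν t : ℝ) : ℝ := Real.exp (-t) * max t 0 ^ ν

variable {α ν : ℝ}

theorem gammaDensity_of_nonpos (hν : 0 < ν) {t : ℝ} (ht : t ≤ 0) : gammaDensity ν t = 0 := by
  rw [gammaDensity, max_eq_right ht, Real.zero_rpow hν.ne', mul_zero]

theorem continuous_gammaDensity (hν : 0 ≤ ν) : Continuous (gammaDensity ν) := by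
  unfold gammaDensity
  exact (by fun_prop : Continuous fun t : ℝ => Real.exp (-t)).mul
    ((by fun_prop : Continuous fun t : ℝ => max t 0).rpow_const fun _ => Or.inr hν)

theorem integrable_gammaDensity (hν : 0 < ν) : Integrable (gammaDensity ν) := by
  have h := Real.GammaIntegral_convergent (show 0 < ν + 1 by linarith)
  rw [add_sub_cancel_right] at h
  have h2 : IntegrableOn (gammaDensity ν) (Ioi 0) := by
    refine h.congr_fun (fun t ht => ?_) measurableSet_Ioi
    rw [gammaDensity, max_eq_left (le_of_lt ht)]
  exact (integrableOn_iff_integrable_of_support_subset fun t ht => by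
    by_contra h0
    exact ht (gammaDensity_of_nonpos hν (not_lt.1 h0))).1 h2

theorem integral_gammaDensity (hν : 0 < ν) : ∫ t, gammaDensity ν t = Real.Gamma (ν + 1) := by
  rw [← setIntegral_eq_integral_of_forall_compl_eq_zero (s := Ioi 0) fun t ht =>
    gammaDensity_of_nonpos hν (not_lt.1 ht), Real.Gamma_eq_integral (by linarith),
    add_sub_cancel_right]
  refine setIntegral_congr_fun measurableSet_Ioi fun t ht => ?_
  rw [gammaDensity, max_eq_left (le_of_lt ht)]

theorem integral_exp_neg_sq_mul_cos (ξ : ℝ) :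
    ∫ x : ℝ, Real.exp (-x ^ 2) * Real.cos (x * ξ) = √Real.pi * Real.exp (-ξ ^ 2 / 4) := by
  have h := fourierIntegral_gaussian (b := 1) (by simp) ξ
  have hi : Integrable (fun x : ℝ => Complex.exp (Complex.I * ξ * x) *
      Complex.exp (-1 * (x : ℂ) ^ 2)) := by
    have h2 := (integrable_cexp_neg_mul_sq (b := 1) (by simp))
    refine h2.bdd_mul (c := 1) (Continuous.aestronglyMeasurable (by fun_prop))
      (Filter.Eventually.of_forall fun x => ?_)
    have := Complex.norm_exp_ofReal_mul_I (ξ * x)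
    push_cast at this
    rw [mul_assoc, mul_comm Complex.I, this]
  have h3 := congrArg RCLike.re h
  rw [← integral_re hi] at h3
  have e1 : ∀ x : ℝ, RCLike.re (Complex.exp (Complex.I * ξ * x) * Complex.exp (-1 * (x : ℂ) ^ 2)) =
      Real.exp (-x ^ 2) * Real.cos (x * ξ) := by
    intro x
    have a1 : Complex.exp (Complex.I * ξ * x) = Complex.exp ((x * ξ : ℝ) * Complex.I) := by
      congr 1; push_cast; ring
    have a2 : Complex.exp (-1 * (x : ℂ) ^ 2) = (Real.exp (-x ^ 2) : ℂ) := by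
      push_cast; ring_nf
    rw [a1, a2, RCLike.re_eq_complex_re, Complex.re_mul_ofReal, Complex.exp_ofReal_mul_I_re,
      mul_comm]
  simp_rw [e1] at h3
  rw [h3]
  have e2 : ((Real.pi : ℂ) / 1) ^ (1 / 2 : ℂ) * Complex.exp (-(ξ : ℂ) ^ 2 / (4 * 1)) =
      ((√Real.pi * Real.exp (-ξ ^ 2 / 4) : ℝ) : ℂ) := by
    rw [Real.sqrt_eq_rpow]
    push_cast
    rw [Complex.ofReal_cpow Real.pi_pos.le]
    push_cast
    simp
  rw [e2, RCLike.re_eq_complex_re, Complex.ofReal_re]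

theorem integral_slice_q (ν x : ℝ) (hν : 0 < ν) :
    ∫ q : ℝ, Real.exp (-q) * max (q - x ^ 2) 0 ^ ν = Real.exp (-x ^ 2) * Real.Gamma (ν + 1) := by
  rw [← integral_gammaDensity hν, ← integral_sub_right_eq_self (gammaDensity ν) (x ^ 2), ← integral_const_mul]
  refine integral_congr_ae (Filter.Eventually.of_forall fun q => ?_)
  simp only [gammaDensity]
  rw [← mul_assoc, ← Real.exp_add]
  ring_nf

theorem integral_slice_x (hν : 0 < ν) (q ξ : ℝ) :
    ∫ x : ℝ, max (q - x ^ 2) 0 ^ ν * Real.cos (x * ξ) =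
      max q 0 ^ (ν + 1 / 2) * wft ν (√q * ξ) := by
  rcases le_or_gt q 0 with hq | hq
  · rw [max_eq_right hq, Real.zero_rpow (by linarith), zero_mul]
    refine integral_eq_zero_of_ae (Filter.Eventually.of_forall fun x => ?_)
    simp only [Pi.zero_apply]
    rw [max_eq_right (by nlinarith [sq_nonneg x]), Real.zero_rpow hν.ne', zero_mul]
  set r := √q with hr
  have hr0 : 0 < r := Real.sqrt_pos.2 hq
  have hrq : r ^ 2 = q := Real.sq_sqrt hq.le
  rw [← setIntegral_eq_integral_of_forall_compl_eq_zero (s := Ioc (-r) r)]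
  · rw [← intervalIntegral.integral_of_le (by linarith)]
    have h := intervalIntegral.integral_comp_mul_left (a := -1) (b := 1) (c := r)
      (fun x => max (q - x ^ 2) 0 ^ ν * Real.cos (x * ξ)) hr0.ne'
    rw [mul_neg, mul_one, smul_eq_mul, eq_inv_mul_iff_mul_eq₀ hr0.ne'] at h
    rw [← h, wft, max_eq_left hq.le, ← intervalIntegral.integral_const_mul,
      ← intervalIntegral.integral_const_mul]
    refine intervalIntegral.integral_congr fun x hx => ?_
    rw [uIcc_of_le (by norm_num)] at hx
    have hx2 : 0 ≤ 1 - x ^ 2 := by nlinarith [hx.1, hx.2]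
    have e : q - (r * x) ^ 2 = q * (1 - x ^ 2) := by rw [mul_pow, hrq]; ring
    rw [e, max_eq_left (by positivity), Real.mul_rpow hq.le hx2, Real.rpow_add hq,
      ← Real.sqrt_eq_rpow, ← hr]
    simp only [wmon, pow_zero, mul_one]
    ring_nf
  · intro x hx
    have : r ^ 2 ≤ x ^ 2 := by
      rw [mem_Ioc, not_and_or, not_lt, not_le] at hx
      rcases hx with h | h <;> nlinarith
    rw [max_eq_right (by linarith), Real.zero_rpow hν.ne', zero_mul]

/-- Integrate e^{-q}(q-x²)₊^ν cos(xξ) over the plane in both orders. In q it leaves a Gaussian in x;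
in x, rescaling by √q leaves q^{ν+1/2} Φ_ν(√q ξ). -/
theorem integral_gammaDensity_wft (hν : 0 < ν) (ξ : ℝ) :
    ∫ q : ℝ, gammaDensity (ν + 1 / 2) q * wft ν (√q * ξ) =
      Real.Gamma (ν + 1) * √Real.pi * Real.exp (-ξ ^ 2 / 4) := by
  have hcont : Continuous (fun p : ℝ × ℝ => Real.exp (-p.1) * max (p.1 - p.2 ^ 2) 0 ^ ν) :=
    (by fun_prop : Continuous fun p : ℝ × ℝ => Real.exp (-p.1)).mul
      ((by fun_prop : Continuous fun p : ℝ × ℝ => max (p.1 - p.2 ^ 2) 0).rpow_const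
        fun _ => Or.inr hν.le)
  have hslice : ∀ x : ℝ, Integrable (fun q : ℝ => Real.exp (-q) * max (q - x ^ 2) 0 ^ ν) := by
    intro x
    refine (((integrable_gammaDensity hν).comp_sub_right (x ^ 2)).const_mul
      (Real.exp (-x ^ 2))).congr (Filter.Eventually.of_forall fun q => ?_)
    simp only [gammaDensity]
    rw [← mul_assoc, ← Real.exp_add]
    ring_nf
  have hexp : Integrable (fun x : ℝ => Real.exp (-x ^ 2)) := by
    simpa using integrable_exp_neg_mul_sq (b := 1) one_pos
  have h1 : Integrable (fun p : ℝ × ℝ => Real.exp (-p.1) * max (p.1 - p.2 ^ 2) 0 ^ ν)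
      (volume.prod volume) := by
    rw [integrable_prod_iff' hcont.aestronglyMeasurable]
    refine ⟨Filter.Eventually.of_forall fun x => hslice x, ?_⟩
    refine (hexp.mul_const (Real.Gamma (ν + 1))).congr (Filter.Eventually.of_forall fun x => ?_)
    simp only
    rw [← integral_slice_q ν x hν]
    refine integral_congr_ae (Filter.Eventually.of_forall fun q => ?_)
    simp only
    rw [Real.norm_of_nonneg (by positivity)]
  have h2 : Integrable (Function.uncurry fun q x : ℝ =>
      Real.exp (-q) * max (q - x ^ 2) 0 ^ ν * Real.cos (x * ξ)) (volume.prod volume) := by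
    refine (h1.bdd_mul (c := 1) (f := fun p : ℝ × ℝ => Real.cos (p.2 * ξ))
      (Continuous.aestronglyMeasurable (by fun_prop))
      (Filter.Eventually.of_forall fun p => Real.abs_cos_le_one _)).congr
      (Filter.Eventually.of_forall fun p => ?_)
    simp only [Function.uncurry]
    ring
  have h3 := integral_integral_swap h2
  have e1 : ∀ q : ℝ, ∫ x : ℝ, Real.exp (-q) * max (q - x ^ 2) 0 ^ ν * Real.cos (x * ξ) =
      gammaDensity (ν + 1 / 2) q * wft ν (√q * ξ) := by
    intro q
    simp_rw [mul_assoc]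
    rw [integral_const_mul, integral_slice_x hν, gammaDensity]
    ring
  have e2 : ∀ x : ℝ, ∫ q : ℝ, Real.exp (-q) * max (q - x ^ 2) 0 ^ ν * Real.cos (x * ξ) =
      Real.Gamma (ν + 1) * (Real.exp (-x ^ 2) * Real.cos (x * ξ)) := by
    intro x
    rw [integral_mul_const, integral_slice_q ν x hν]
    ring
  simp_rw [e1, e2] at h3
  rw [h3, integral_const_mul, integral_exp_neg_sq_mul_cos, mul_assoc]

theorem wft_zero_eq (hν : 0 < ν) :
    Real.Gamma (ν + 1 / 2 + 1) * wft ν 0 = Real.Gamma (ν + 1) * √Real.pi := by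
  have h := integral_gammaDensity_wft hν 0
  simp only [mul_zero, integral_mul_const] at h
  rw [integral_gammaDensity (by linarith)] at h
  simpa using h

/-- Multiply `integral_gammaDensity_wft` at ν = α+1 by ξ^{2α} and integrate over ξ > 0. Substituting
x = √q ξ leaves q^{α+3/2} q^{-(α+1/2)} = q, so the mixture contributes only ∫ e^{-q} q dq = 1. The
other side is a Gaussian moment. -/
theorem integral_rpow_mul_wft (hα : 0 ≤ α) (hα1 : α < 1) :
    ∫ x in Ioi (0 : ℝ), x ^ (2 * α) * wft (α + 1) x =
      Real.Gamma (α + 2) * √Real.pi * 4 ^ α * Real.Gamma (α + 1 / 2) := by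
  have c1 := continuous_wft (show -1 < α + 1 by linarith)
  have cr := Real.continuous_rpow_const (show 0 ≤ 2 * α by linarith)
  have hone : ∃ C : ℝ, 0 ≤ C ∧ ∀ x : ℝ, 0 < x → |(1 : ℝ)| ≤ C * (1 + x) ^ (-(0 : ℝ)) :=
    ⟨1, zero_le_one, fun x _ => by simp⟩
  have hi := integrableOn_rpow_mul (s := 2 * α) (by linarith) hone
    (wft_decay_pos (show 0 ≤ α + 1 by linarith)) continuous_const c1 (by linarith)
  simp only [one_mul] at hi
  set g : ℝ → ℝ := fun x => x ^ (2 * α) * wft (α + 1) x with hg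
  -- the scaled integrand
  have hscale : ∀ q : ℝ, 0 < q → ∀ ξ : ℝ, 0 < ξ →
      ξ ^ (2 * α) * (gammaDensity (α + 1 + 1 / 2) q * wft (α + 1) (√q * ξ)) =
        Real.exp (-q) * q ^ (3 / 2 : ℝ) * g (√q * ξ) := by
    intro q hq ξ hξ
    simp only [hg, gammaDensity]
    rw [max_eq_left hq.le, Real.mul_rpow (Real.sqrt_nonneg _) hξ.le, Real.sqrt_eq_rpow,
      ← Real.rpow_mul hq.le, show α + 1 + 1 / 2 = 3 / 2 + 1 / 2 * (2 * α) by ring,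
      Real.rpow_add hq]
    ring
  have hq32 : ∀ q : ℝ, 0 < q → q ^ (3 / 2 : ℝ) * (√q)⁻¹ = q := by
    intro q hq
    rw [Real.sqrt_eq_rpow, ← Real.rpow_neg hq.le, ← Real.rpow_add hq]
    norm_num
  have hqexp : IntegrableOn (fun q : ℝ => Real.exp (-q) * q) (Ioi 0) := by
    have := Real.GammaIntegral_convergent (s := 2) two_pos
    norm_num at this
    exact this
  have hcont : Continuous (fun p : ℝ × ℝ =>
      p.1 ^ (2 * α) * (gammaDensity (α + 1 + 1 / 2) p.2 * wft (α + 1) (√p.2 * p.1))) :=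
    (cr.comp continuous_fst).mul (((continuous_gammaDensity (by linarith)).comp
      continuous_snd).mul (c1.comp ((Real.continuous_sqrt.comp continuous_snd).mul
      continuous_fst)))
  have hint : Integrable (Function.uncurry fun ξ q : ℝ =>
      ξ ^ (2 * α) * (gammaDensity (α + 1 + 1 / 2) q * wft (α + 1) (√q * ξ)))
      ((volume.restrict (Ioi 0)).prod (volume.restrict (Ioi 0))) := by
    refine (integrable_prod_iff' (f := fun p : ℝ × ℝ =>
      p.1 ^ (2 * α) * (gammaDensity (α + 1 + 1 / 2) p.2 * wft (α + 1) (√p.2 * p.1)))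
      hcont.aestronglyMeasurable).2 ⟨?_, ?_⟩
    · filter_upwards [ae_restrict_mem measurableSet_Ioi] with q hq
      have hq : 0 < q := hq
      have : IntegrableOn (fun ξ => Real.exp (-q) * q ^ (3 / 2 : ℝ) * g (√q * ξ)) (Ioi 0) := by
        refine Integrable.const_mul ?_ _
        exact (integrableOn_Ioi_comp_mul_left_iff g 0 (Real.sqrt_pos.2 hq)).2 (by simpa using hi)
      exact this.congr_fun (fun ξ hξ => (hscale q hq ξ hξ).symm) measurableSet_Ioi
    · have hqg : IntegrableOn (fun q => Real.exp (-q) * q * ∫ x in Ioi (0 : ℝ), ‖g x‖) (Ioi 0) :=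
        hqexp.mul_const _
      refine hqg.congr_fun (fun q hq => ?_) measurableSet_Ioi
      have hq : 0 < q := hq
      have en : ∫ ξ in Ioi (0 : ℝ), ‖ξ ^ (2 * α) *
          (gammaDensity (α + 1 + 1 / 2) q * wft (α + 1) (√q * ξ))‖ =
          ∫ ξ in Ioi (0 : ℝ), Real.exp (-q) * q ^ (3 / 2 : ℝ) * ‖g (√q * ξ)‖ := by
        refine setIntegral_congr_fun measurableSet_Ioi fun ξ hξ => ?_
        rw [hscale q hq ξ hξ, norm_mul, Real.norm_of_nonneg (by positivity)]
      simp only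
      rw [en, integral_const_mul, integral_comp_mul_left_Ioi (fun x => ‖g x‖) 0
        (Real.sqrt_pos.2 hq), mul_zero, smul_eq_mul, ← mul_assoc,
        mul_assoc (Real.exp _) (q ^ (3 / 2 : ℝ)), hq32 q hq]
  have h3 := integral_integral_swap hint
  have e1 : ∀ ξ : ℝ, ∫ q in Ioi (0 : ℝ),
      ξ ^ (2 * α) * (gammaDensity (α + 1 + 1 / 2) q * wft (α + 1) (√q * ξ)) =
      Real.Gamma (α + 2) * √Real.pi * (ξ ^ (2 * α) * Real.exp (-(1 / 4) * ξ ^ (2 : ℝ))) := by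
    intro ξ
    rw [integral_const_mul, setIntegral_eq_integral_of_forall_compl_eq_zero fun q hq => by
      rw [gammaDensity_of_nonpos (by linarith) (not_lt.1 hq), zero_mul],
      integral_gammaDensity_wft (by linarith), Real.rpow_two]
    ring_nf
  have e2 : ∫ q in Ioi (0 : ℝ), ∫ ξ in Ioi (0 : ℝ),
      ξ ^ (2 * α) * (gammaDensity (α + 1 + 1 / 2) q * wft (α + 1) (√q * ξ)) =
      ∫ q in Ioi (0 : ℝ), Real.exp (-q) * q * ∫ x in Ioi (0 : ℝ), g x := by
    refine setIntegral_congr_fun measurableSet_Ioi fun q hq => ?_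
    have hq : 0 < q := hq
    rw [setIntegral_congr_fun measurableSet_Ioi (fun ξ hξ => hscale q hq ξ hξ),
      integral_const_mul, integral_comp_mul_left_Ioi g 0 (Real.sqrt_pos.2 hq),
      mul_zero, smul_eq_mul, ← mul_assoc, mul_assoc (Real.exp _) (q ^ (3 / 2 : ℝ)), hq32 q hq]
  have e3 : ∫ q in Ioi (0 : ℝ), Real.exp (-q) * q = 1 := by
    have := Real.Gamma_eq_integral (s := 2) two_pos
    norm_num at this
    exact this.symm
  rw [e2, integral_mul_const, e3, one_mul] at h3
  simp_rw [e1] at h3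
  rw [← h3, integral_const_mul, integral_rpow_mul_exp_neg_mul_rpow two_pos (by linarith)
    (by norm_num)]
  have e4 : ((1 : ℝ) / 4) ^ (-(2 * α + 1) / 2) * (1 / 2) = 4 ^ α := by
    rw [one_div, Real.inv_rpow (by norm_num), ← Real.rpow_neg (by norm_num),
      show -(-(2 * α + 1) / 2) = α + 1 / 2 by ring, Real.rpow_add (by norm_num),
      ← Real.sqrt_eq_rpow, show (4 : ℝ) = 2 ^ 2 by norm_num, Real.sqrt_sq (by norm_num)]
    ring
  rw [e4, show (2 * α + 1) / 2 = α + 1 / 2 by ring]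
  ring

/-- All Gamma factors cancel: Γ(α+1/2) from the Gaussian moment against the denominator of
Φ_{α+1}(0) given by `wft_zero_eq`, and Γ(α+1)² against the normalisation of `sphBessel`. The two
factors √π make π. -/
theorem sphPair_self_of_lt (hα : 0 ≤ α) (hα1 : α < 1) :
    (2 * α + 1) * sphPair α α = 2 * Real.pi := by
  have h1 := wftMoment_self hα hα1
  rw [integral_rpow_mul_wft hα hα1] at h1
  have h2 := wft_zero_eq (show 0 < α + 1 by linarith)
  have h3 := wft_zero_succ (show 0 < α + 1 by linarith)
  rw [add_sub_cancel_right] at h3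
  have g1 : Real.Gamma (α + 1 + 1 / 2 + 1) = (α + 3 / 2) * ((α + 1 / 2) * Real.Gamma (α + 1 / 2)) := by
    rw [show α + 1 + 1 / 2 + 1 = α + 1 / 2 + 1 + 1 by ring, Real.Gamma_add_one (by linarith),
      Real.Gamma_add_one (by linarith)]
    ring
  have g2 : Real.Gamma (α + 2) = (α + 1) * Real.Gamma (α + 1) := by
    rw [show α + 2 = α + 1 + 1 by ring, Real.Gamma_add_one (by linarith)]
  have p1 : 0 < Real.Gamma (α + 1 / 2) := Real.Gamma_pos_of_pos (by linarith)
  have p2 : 0 < Real.Gamma (α + 1) := Real.Gamma_pos_of_pos (by linarith)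
  have p3 : √Real.pi ^ 2 = Real.pi := Real.sq_sqrt Real.pi_pos.le
  have e : sphPair α α = wftMoment α α α / (4 ^ α * Real.Gamma (α + 1) ^ 2) := by
    unfold sphPair wftMoment
    rw [← integral_div]
    refine setIntegral_congr_fun measurableSet_Ioi fun x hx => ?_
    have hx : 0 < x := hx
    simp only [sphBessel]
    rw [show (4 : ℝ) = 2 * 2 by norm_num, Real.mul_rpow (by norm_num) (by norm_num), two_mul α,
      Real.rpow_add hx]
    field_simp
  rw [show α + 1 + 1 = α + 2 by ring, g1, g2] at h2
  rw [g2] at h1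
  have p4 : (0 : ℝ) < 4 ^ α := by positivity
  rw [e, ← mul_div_assoc, div_eq_iff (by positivity)]
  generalize Real.Gamma (α + 1 / 2) = G at *
  generalize Real.Gamma (α + 1) = K at *
  generalize (4 : ℝ) ^ α = F at *
  generalize wft (α + 1) 0 = B at *
  generalize wft α 0 = A at *
  generalize wftMoment α α α = N at *
  have hα1' : α + 1 ≠ 0 := by linarith
  have h1' : N = A * (K * √Real.pi * F * G) := by
    refine mul_left_cancel₀ hα1' ?_
    rw [h1]; ring
  have h3' : A * (2 * (α + 1)) = (2 * (α + 1) + 1) * B := by linarith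
  rw [h1']
  refine mul_left_cancel₀ hα1' ?_
  have : (α + 1) * ((2 * α + 1) * (A * (K * √Real.pi * F * G))) =
    2 * (K * √Real.pi * F) * ((α + 3 / 2) * ((α + 1 / 2) * G) * B) := by
    linear_combination ((2 * α + 1) / 2 * (K * √Real.pi * F * G)) * h3'
  rw [this, h2]
  linear_combination (2 * K ^ 2 * F * (α + 1)) * p3

theorem sphPair_self (hν : 0 ≤ ν) : (2 * ν + 1) * sphPair ν ν = 2 * Real.pi := by
  have key : ∀ n : ℕ, (2 * (Int.fract ν + n) + 1) *
      sphPair (Int.fract ν + n) (Int.fract ν + n) = 2 * Real.pi := by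
    intro n
    induction n with
    | zero => simpa using sphPair_self_of_lt (Int.fract_nonneg ν) (Int.fract_lt_one ν)
    | succ n ih =>
      rw [← ih, sphPair_self_succ (add_nonneg (Int.fract_nonneg ν) n.cast_nonneg)]
      push_cast
      ring_nf
  have h := key ⌊ν⌋.toNat
  have e : Int.fract ν + (⌊ν⌋.toNat : ℝ) = ν := by
    have : ((⌊ν⌋.toNat : ℤ) : ℝ) = (⌊ν⌋ : ℝ) := by
      rw [Int.toNat_of_nonneg (Int.floor_nonneg.2 hν)]
    rw [Int.cast_natCast] at this
    rw [this, add_comm, Int.floor_add_fract]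
  rwa [e] at h

end

end RieszJacobi

/-! ### Rodrigues' formula and the Fourier transform of J_n. -/

namespace RieszJacobi

noncomputable section

open MeasureTheory Set

/-- The coefficients of the ultraspherical polynomial `P_n^{a,a}` in powers of `(x - 1) / 2`. -/
def ultraCoeff (n : ℕ) (a : ℝ) (m : ℕ) : ℝ :=
  (ascPochhammer ℝ m).eval (n + a + a + 1) *
    (ascPochhammer ℝ (n - m)).eval (a + m + 1) / (m.factorial * (n - m).factorial)

/-- The ultraspherical polynomial `P_n^{a,a}` in the variable `y = (x - 1) / 2`. -/
def ultraPoly (n : ℕ) (a : ℝ) : Polynomial ℝ :=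
  ∑ m ∈ Finset.range (n + 1), Polynomial.C (ultraCoeff n a m) * Polynomial.X ^ m

theorem jacobiP_eq_comp (n : ℕ) (a : ℝ) :
    jacobiP n a a = (ultraPoly n a).comp (Polynomial.C (1 / 2) * (Polynomial.X - 1)) := by
  simp only [jacobiP, ultraPoly, ultraCoeff, Polynomial.sum_comp, Polynomial.mul_comp,
    Polynomial.C_comp, Polynomial.pow_comp, Polynomial.X_comp]

theorem coeff_ultraPoly (n : ℕ) (a : ℝ) (k : ℕ) :
    (ultraPoly n a).coeff k = if k < n + 1 then ultraCoeff n a k else 0 := by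
  simp [ultraPoly, Polynomial.coeff_C_mul, Polynomial.coeff_X_pow]

theorem ascPochhammer_succ_left_eval (n : ℕ) (x : ℝ) :
    (ascPochhammer ℝ (n + 1)).eval x = x * (ascPochhammer ℝ n).eval (x + 1) := by
  rw [ascPochhammer_succ_left]; simp [Polynomial.eval_comp]

theorem ultraCoeff_zero_rec (N : ℕ) (a : ℝ) :
    (a + 1) * ultraCoeff N (a + 1) 0 = (N + 1) * ultraCoeff (N + 1) a 0 := by
  simp only [ultraCoeff, Nat.sub_zero, ascPochhammer_succ_left_eval, ascPochhammer_zero,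
    Polynomial.eval_one, Nat.factorial_succ, Nat.factorial_zero]
  have : (N.factorial : ℝ) ≠ 0 := by positivity
  push_cast
  field_simp
  ring_nf

theorem ultraCoeff_rec (r j : ℕ) (a : ℝ) :
    (j + 1 + a + 1) * ultraCoeff (r + j + 1) (a + 1) (j + 1) +
      (j + 1 + 2 * a + 1) * ultraCoeff (r + j + 1) (a + 1) j =
      (r + j + 1 + 1) * ultraCoeff (r + j + 1 + 1) a (j + 1) := by
  have s1 : r + j + 1 - (j + 1) = r := by omega
  have s2 : r + j + 1 - j = r + 1 := by omega
  have s3 : r + j + 1 + 1 - (j + 1) = r + 1 := by omega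
  simp only [ultraCoeff, s1, s2, s3]
  have e1 : ((r + j + 1 + 1 : ℕ) : ℝ) + a + a + 1 + 1 = (r + j + 1 : ℕ) + (a + 1) + (a + 1) + 1 := by
    push_cast; ring
  have e2 : a + ((j + 1 : ℕ) : ℝ) + 1 + 1 = a + 1 + (j + 1 : ℕ) + 1 := by ring
  have e3 : a + 1 + (j : ℝ) + 1 = a + ((j + 1 : ℕ) : ℝ) + 1 := by push_cast; ring
  rw [ascPochhammer_succ_left_eval j (((r + j + 1 + 1 : ℕ) : ℝ) + a + a + 1), e1, e3,
    ascPochhammer_succ_eval j, ascPochhammer_succ_left_eval r, e2]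
  simp only [Nat.factorial_succ]
  have : (r.factorial : ℝ) ≠ 0 := by positivity
  have : (j.factorial : ℝ) ≠ 0 := by positivity
  push_cast
  field_simp
  ring

theorem ultraCoeff_top_rec (N : ℕ) (a : ℝ) :
    (N + 1 + 2 * a + 1) * ultraCoeff N (a + 1) N = (N + 1) * ultraCoeff (N + 1) a (N + 1) := by
  simp only [ultraCoeff, Nat.sub_self, ascPochhammer_zero, Polynomial.eval_one,
    ascPochhammer_succ_left_eval, Nat.factorial_succ, Nat.factorial_zero]
  have e1 : ((N + 1 : ℕ) : ℝ) + a + a + 1 + 1 = N + (a + 1) + (a + 1) + 1 := by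
    push_cast; ring
  rw [e1]
  have : (N.factorial : ℝ) ≠ 0 := by positivity
  push_cast
  field_simp
  ring

theorem coeff_X_mul_derivative (p : Polynomial ℝ) (k : ℕ) :
    (Polynomial.X * Polynomial.derivative p).coeff k = k * p.coeff k := by
  rcases k with _ | k
  · simp
  · rw [Polynomial.coeff_X_mul, Polynomial.coeff_derivative]; push_cast; ring

/-- With y = (x-1)/2 one has 1-x² = -4y(1+y), and this is the identity (1-x²)P' - 2(a+1)xP =
-2(N+1)Q with P = P_N^{a+1,a+1} and Q = P_{N+1}^{a,a}. Coefficients are compared separately in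
degree 0, in degrees 1 to N, and in degree N+1. -/
theorem ultraPoly_rec (N : ℕ) (a : ℝ) :
    Polynomial.X * Polynomial.derivative (ultraPoly N (a + 1)) +
      Polynomial.X * (Polynomial.X * Polynomial.derivative (ultraPoly N (a + 1))) +
      Polynomial.C (a + 1) * ultraPoly N (a + 1) +
      Polynomial.C (2 * (a + 1)) * (Polynomial.X * ultraPoly N (a + 1)) =
      Polynomial.C ((N : ℝ) + 1) * ultraPoly (N + 1) a := by
  ext k
  simp only [Polynomial.coeff_add, Polynomial.coeff_C_mul]
  rcases k with _ | j
  · rw [coeff_X_mul_derivative, Polynomial.coeff_X_mul_zero, Polynomial.coeff_X_mul_zero]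
    simp only [coeff_ultraPoly]
    simpa using ultraCoeff_zero_rec N a
  · rw [coeff_X_mul_derivative, Polynomial.coeff_X_mul, coeff_X_mul_derivative,
      Polynomial.coeff_X_mul]
    simp only [coeff_ultraPoly]
    rcases lt_trichotomy j N with h | h | h
    · obtain ⟨r, rfl⟩ : ∃ r, N = r + j + 1 := ⟨N - j - 1, by omega⟩
      rw [if_pos (by omega), if_pos (by omega), if_pos (by omega)]
      have := ultraCoeff_rec r j a
      push_cast
      linear_combination this
    · subst h
      rw [if_neg (by omega), if_pos (by omega), if_pos (by omega)]
      have := ultraCoeff_top_rec j a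
      linear_combination this
    · rw [if_neg (by omega), if_neg (by omega), if_neg (by omega)]
      ring

theorem hasDerivAt_gjfFun (N : ℕ) {a : ℝ} {x : ℝ} (hx : x ∈ Ioo (-1 : ℝ) 1) :
    HasDerivAt (gjfFun (a + 1) N) (-(2 * (N + 1)) * gjfFun a (N + 1) x) x := by
  have hpos : 0 < 1 - x ^ 2 := by nlinarith [hx.1, hx.2]
  have h1 : HasDerivAt (fun x : ℝ => 1 - x ^ 2) (-(2 * x)) x := by
    simpa using (hasDerivAt_pow 2 x).const_sub 1
  have h2 := (h1.rpow_const (p := a + 1) (Or.inl hpos.ne')).mul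
    ((jacobiP N (a + 1) (a + 1)).hasDerivAt x)
  refine h2.congr_deriv ?_
  have r := congrArg (Polynomial.eval ((x - 1) / 2)) (ultraPoly_rec N a)
  simp only [Polynomial.eval_add, Polynomial.eval_mul, Polynomial.eval_X, Polynomial.eval_C] at r
  simp only [gjfFun, jacobiP_eq_comp, Polynomial.derivative_comp, Polynomial.eval_mul,
    Polynomial.eval_comp, Polynomial.derivative_C_mul, Polynomial.derivative_sub,
    Polynomial.derivative_X, Polynomial.derivative_one, Polynomial.eval_sub, Polynomial.eval_C,
    Polynomial.eval_X, Polynomial.eval_one, sub_zero]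
  rw [show (1 / 2 : ℝ) * (x - 1) = (x - 1) / 2 by ring, Real.rpow_add_one hpos.ne',
    add_sub_cancel_right]
  linear_combination (-2 * (1 - x ^ 2) ^ a) * r

theorem continuous_gjfFun {a : ℝ} (ha : 0 ≤ a) (n : ℕ) : Continuous (gjfFun a n) := by
  unfold gjfFun
  exact (Continuous.rpow_const (by fun_prop) fun _ => Or.inr ha).mul (Polynomial.continuous _)

/-- One derivative lowers the exponent and raises the degree by one. Hence the induction on n runs
over all exponents at once, with a+n preserved. -/
theorem intervalFT_gjfFun (n : ℕ) : ∀ a : ℝ, 0 ≤ a → ∀ ξ : ℝ,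
    intervalFT (fun x => gjfFun a n x) ξ =
      (-Complex.I * ξ) ^ n / (2 ^ n * n.factorial) * wft (a + n) ξ := by
  induction n with
  | zero =>
    intro a ha ξ
    have e : (fun x => (gjfFun a 0 x : ℂ)) = fun x => (wmon a 0 x : ℂ) := by
      funext x
      simp [gjfFun, wmon, jacobiP]
    rw [e, intervalFT_wmon_zero (by linarith)]
    simp
  | succ N ih =>
    intro a ha ξ
    have h := intervalFT_deriv (f := fun x => (gjfFun (a + 1) N x : ℂ))
      (f' := fun x => (-(2 * (N + 1)) : ℂ) * gjfFun a (N + 1) x)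
      (Complex.continuous_ofReal.comp (continuous_gjfFun (by linarith) N)).continuousOn
      (by simp [gjfFun, Real.zero_rpow (show a + 1 ≠ 0 by linarith)])
      (by simp [gjfFun, Real.zero_rpow (show a + 1 ≠ 0 by linarith)])
      (fun x hx => (hasDerivAt_gjfFun N hx).ofReal_comp.congr_deriv (by push_cast; ring))
      ((continuous_const.mul (Complex.continuous_ofReal.comp
        (continuous_gjfFun ha (N + 1)))).intervalIntegrable _ _) ξ
    rw [intervalFT_const_mul, ih (a + 1) (by linarith)] at h
    have hN : (2 * (N + 1) : ℂ) ≠ 0 := by exact_mod_cast (by positivity : (2 * (N + 1) : ℝ) ≠ 0)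
    have hf : (N.factorial : ℂ) ≠ 0 := by exact_mod_cast N.factorial_ne_zero
    refine mul_left_cancel₀ (neg_ne_zero.2 hN) (h.trans ?_)
    rw [show a + 1 + (N : ℝ) = a + ((N + 1 : ℕ) : ℝ) by push_cast; ring, Nat.factorial_succ]
    push_cast
    have hN1 : (N + 1 : ℂ) ≠ 0 := by exact_mod_cast (by positivity : (N + 1 : ℝ) ≠ 0)
    field_simp
    ring

theorem natDegree_ultraPoly {a : ℝ} (ha : 0 ≤ a) (n : ℕ) : (ultraPoly n a).natDegree = n := by
  refine Polynomial.natDegree_eq_of_le_of_coeff_ne_zero ?_ ?_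
  · refine Polynomial.natDegree_le_iff_coeff_eq_zero.2 fun k hk => ?_
    rw [coeff_ultraPoly, if_neg (by omega)]
  · rw [coeff_ultraPoly, if_pos (by omega), ultraCoeff, Nat.sub_self]
    have : 0 < (ascPochhammer ℝ n).eval (n + a + a + 1) := ascPochhammer_pos _ _ (by positivity)
    rw [ascPochhammer_zero, Polynomial.eval_one, mul_one, Nat.factorial_zero, Nat.cast_one, mul_one]
    exact div_ne_zero this.ne' (by positivity)

theorem natDegree_jacobiP {a : ℝ} (ha : 0 ≤ a) (n : ℕ) : (jacobiP n a a).natDegree = n := by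
  rw [jacobiP_eq_comp, Polynomial.natDegree_comp, natDegree_ultraPoly ha,
    Polynomial.natDegree_C_mul (by norm_num), ← Polynomial.C_1, Polynomial.natDegree_X_sub_C,
    mul_one]

theorem span_jacobiP {a : ℝ} (ha : 0 ≤ a) :
    Submodule.span ℝ (Set.range fun n => jacobiP n a a) = ⊤ := by
  have hne : ∀ n, jacobiP n a a ≠ 0 := by
    intro n h
    rcases n with _ | n
    · simp [jacobiP] at h
    · have := natDegree_jacobiP ha (n + 1)
      rw [h] at this
      simp at this
  let S : Polynomial.Sequence ℝ := ⟨fun n => jacobiP n a a, fun n => by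
    rw [Polynomial.degree_eq_natDegree (hne n), natDegree_jacobiP ha]⟩
  exact S.span fun n => (Polynomial.leadingCoeff_ne_zero.2 (hne n)).isUnit

end

end RieszJacobi

/-! ### Plancherel: Sobolev membership and the values of the form. -/

namespace RieszJacobi

noncomputable section

open MeasureTheory Set FourierTransform TemperedDistribution
open scoped SchwartzMap

/-- On integrable functions the `L²` Fourier transform is given by the Fourier integral. -/
theorem coeFn_fourier_of_integrable (w : L2R) (hw : Integrable w) :
    ((𝓕 w : L2R) : ℝ → ℂ) =ᵐ[volume] 𝓕 (w : ℝ → ℂ) := by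
  have hcont : Continuous (𝓕 (w : ℝ → ℂ)) :=
    VectorFourier.fourierIntegral_continuous Real.continuous_fourierChar
      (innerSL ℝ).continuous₂ hw
  have hT := Lp.fourier_toTemperedDistribution_eq w
  apply ae_eq_of_integral_contDiff_smul_eq
  · exact (Lp.memLp _).locallyIntegrable (by norm_num)
  · exact hcont.locallyIntegrable
  · intro g g_smooth g_cpt
    have hg₁ : HasCompactSupport (Complex.ofRealCLM ∘ g) := g_cpt.comp_left rfl
    have hg₂ : ContDiff ℝ (⊤ : ℕ∞) (Complex.ofRealCLM ∘ g) := by fun_prop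
    set φ : 𝓢(ℝ, ℂ) := hg₁.toSchwartzMap hg₂ with hφ
    have h1 := congrArg (fun T : 𝓢'(ℝ, ℂ) => T φ) hT
    simp only [TemperedDistribution.fourier_apply, Lp.toTemperedDistribution_apply] at h1
    -- The multiplication formula ∫ φ̂ w = ∫ φ ŵ; its left side is also the definition of the
    -- distributional transform of `w` tested on φ.
    have h2 := VectorFourier.integral_fourierIntegral_smul_eq_flip (L := innerₗ ℝ) (μ := volume)
      (ν := volume) (f := φ) (g := (w : ℝ → ℂ)) Real.continuous_fourierChar
      (innerSL ℝ).continuous₂ φ.integrable hw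
    rw [flip_innerₗ] at h2
    have h3 : ∫ x, φ x • (𝓕 w : L2R) x = ∫ x, φ x • 𝓕 (w : ℝ → ℂ) x := by
      rw [← h1]
      refine Eq.trans ?_ h2
      rw [SchwartzMap.fourier_coe]
      rfl
    refine Eq.trans (integral_congr_ae (Filter.Eventually.of_forall fun x => ?_))
      (h3.trans (integral_congr_ae (Filter.Eventually.of_forall fun x => ?_)))
    · simp [hφ]
    · simp [hφ]

theorem integrable_coe_L2Lam (v : L2Lam) : Integrable v (volume.restrict Lam) :=
  (Lp.memLp v).integrable (by norm_num)

theorem intervalIntegrable_coe_L2Lam (v : L2Lam) : IntervalIntegrable v volume (-1) 1 := by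
  rw [intervalIntegrable_iff_integrableOn_Ioo_of_le (by norm_num)]
  exact integrable_coe_L2Lam v

theorem intervalFT_eq_fourier (f : ℝ → ℂ) (η : ℝ) :
    𝓕 (Lam.indicator f) η = intervalFT f (2 * Real.pi * η) := by
  rw [Real.fourier_real_eq_integral_exp_smul, intervalFT, intervalIntegral.integral_of_le
    (by norm_num), integral_Ioc_eq_integral_Ioo, ← integral_indicator measurableSet_Ioo]
  refine integral_congr_ae (Filter.Eventually.of_forall fun x => ?_)
  simp only [indicator]
  split_ifs
  · rw [smul_eq_mul, mul_comm]
    congr 2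
    push_cast
    ring
  · simp

theorem coeFn_zeroExt (v : L2Lam) : (zeroExt v : ℝ → ℂ) =ᵐ[volume] Lam.indicator v :=
  (memLp_indicator v).coeFn_toLp

theorem integrable_zeroExt (v : L2Lam) : Integrable (zeroExt v : ℝ → ℂ) := by
  refine Integrable.congr ?_ (coeFn_zeroExt v).symm
  exact (integrable_indicator_iff measurableSet_Ioo).2 (integrable_coe_L2Lam v)

theorem fourier_zeroExt (v : L2Lam) :
    ((𝓕 (zeroExt v) : L2R) : ℝ → ℂ) =ᵐ[volume] fun η => intervalFT v (2 * Real.pi * η) := by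
  refine (coeFn_fourier_of_integrable _ (integrable_zeroExt v)).trans
    (Filter.Eventually.of_forall fun η => ?_)
  rw [Real.fourier_congr_ae (coeFn_zeroExt v), intervalFT_eq_fourier]

theorem intervalFT_congr_ae {f g : ℝ → ℂ} (h : f =ᵐ[volume.restrict Lam] g) (ξ : ℝ) :
    intervalFT f ξ = intervalFT g ξ := by
  unfold intervalFT
  rw [intervalIntegral.integral_of_le (by norm_num), intervalIntegral.integral_of_le (by norm_num),
    integral_Ioc_eq_integral_Ioo, integral_Ioc_eq_integral_Ioo]
  refine integral_congr_ae ?_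
  filter_upwards [h] with x hx
  rw [hx]

theorem continuous_intervalFT {f : ℝ → ℂ} (hf : IntervalIntegrable f volume (-1) 1) :
    Continuous (intervalFT f) :=
  continuous_iff_continuousAt.2 fun ξ => (hasDerivAt_intervalFT hf ξ).continuousAt

theorem one_add_le_of_two_pi (η : ℝ) : 1 + |η| ≤ 1 + |2 * Real.pi * η| := by
  rw [abs_mul, abs_of_pos (by positivity : 0 < 2 * Real.pi)]
  have := Real.pi_gt_three
  nlinarith [abs_nonneg η]

theorem sobolevWeight_le {s : ℝ} (hs : 0 ≤ s) (η : ℝ) :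
    (1 + ‖η‖ ^ 2) ^ (s / 2) ≤ (1 + |η|) ^ s := by
  have h : (1 + |η|) ^ s = ((1 + |η|) ^ 2) ^ (s / 2) := by
    rw [← Real.rpow_natCast, ← Real.rpow_mul (by positivity)]; congr 1; push_cast; ring
  rw [h, Real.norm_eq_abs]
  refine Real.rpow_le_rpow (by positivity) ?_ (by linarith)
  nlinarith [abs_nonneg η]

theorem memLp_one_add_abs_inv : MemLp (fun x : ℝ => (1 + |x|)⁻¹) 2 volume := by
  have hc : Continuous fun x : ℝ => (1 + |x|)⁻¹ :=
    Continuous.inv₀ (by fun_prop) fun x => by positivity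
  rw [memLp_two_iff_integrable_sq hc.aestronglyMeasurable]
  have h : Integrable (fun x : ℝ => (1 + ‖x‖) ^ (-2 : ℝ)) := integrable_one_add_norm (by simp)
  refine h.congr (Filter.Eventually.of_forall fun x => ?_)
  simp only [Real.norm_eq_abs]
  rw [Real.rpow_neg (by positivity), Real.rpow_two, inv_pow]

/-- After multiplication by the Sobolev weight a bound (1+|η|)^{-1} remains, which is square
integrable. -/
theorem mem_hStar_of_decay {s : ℝ} (hs : 0 ≤ s) {v : L2Lam} {C : ℝ}
    (h : ∀ ξ : ℝ, ‖intervalFT v ξ‖ ≤ C * (1 + |ξ|) ^ (-(s + 1))) : v ∈ hStar s := by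
  refine (memSobolev_iff_memLp s _).2 ?_
  have hae := fourier_zeroExt v
  have hcont := continuous_intervalFT (intervalIntegrable_coe_L2Lam v)
  have hC : 0 ≤ C := by
    have := (norm_nonneg _).trans (h 0)
    simpa using this
  refine (memLp_congr_ae (g := fun η : ℝ => (((1 + ‖η‖ ^ 2) ^ (s / 2) : ℝ) : ℂ) *
    intervalFT v (2 * Real.pi * η)) (by filter_upwards [hae] with η hη; rw [hη])).2 ?_
  have hg : Continuous (fun η : ℝ => (((1 + ‖η‖ ^ 2) ^ (s / 2) : ℝ) : ℂ)) :=
    Complex.continuous_ofReal.comp (Continuous.rpow_const (by fun_prop) fun x =>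
      Or.inl (by positivity))
  refine MemLp.of_le_mul (c := C) memLp_one_add_abs_inv
    (hg.mul (hcont.comp (by fun_prop))).aestronglyMeasurable
    (Filter.Eventually.of_forall fun η => ?_)
  have h1 : 0 < 1 + |η| := by positivity
  have hw : 0 ≤ (1 + ‖η‖ ^ 2) ^ (s / 2) := by positivity
  have hi : 0 ≤ (1 + |η|)⁻¹ := by positivity
  rw [norm_mul, Complex.norm_of_nonneg hw, Real.norm_of_nonneg hi]
  calc _ ≤ (1 + |η|) ^ s * (C * (1 + |η|) ^ (-(s + 1))) := by
        refine mul_le_mul (sobolevWeight_le hs η) ((h _).trans ?_) (norm_nonneg _) (by positivity)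
        exact mul_le_mul_of_nonneg_left (Real.rpow_le_rpow_of_nonpos h1
          (one_add_le_of_two_pi η) (by linarith)) hC
    _ = C * ((1 + |η|) ^ s * (1 + |η|) ^ (-(s + 1))) := by ring
    _ = _ := by
        rw [← Real.rpow_add h1, ← Real.rpow_neg_one]
        congr 2; ring

theorem intervalFT_gjf {α : ℝ} (hα : 0 ≤ α) (m : ℕ) (ξ : ℝ) :
    intervalFT (gjf α hα m) ξ =
      (-Complex.I * ξ) ^ m / (2 ^ m * m.factorial) * wft (α + m) ξ := by
  exact (intervalFT_congr_ae (memLp_gjf hα m).coeFn_toLp ξ).trans (intervalFT_gjfFun m α hα ξ)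

/-- The factor ξ^m absorbs the extra decay of Φ_{α+m}, so the rate -(α+1) is the same for all m. -/
theorem gjf_mem_hStar {α : ℝ} (hα : 0 ≤ α) (m : ℕ) : gjf α hα m ∈ hStar α := by
  obtain ⟨C, hC, h⟩ := wft_decay (show 0 ≤ α + m by positivity)
  refine mem_hStar_of_decay hα (C := 1 / (2 ^ m * m.factorial) * C) fun ξ => ?_
  have h1 : 0 < 1 + |ξ| := by positivity
  rw [intervalFT_gjf, norm_mul, norm_div, norm_pow, norm_mul, norm_neg, Complex.norm_I, one_mul,
    Complex.norm_real, Complex.norm_real, Real.norm_eq_abs, Real.norm_eq_abs]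
  have e : ‖(2 ^ m * m.factorial : ℂ)‖ = 2 ^ m * m.factorial := by
    rw [norm_mul, norm_pow, Complex.norm_natCast]; simp
  rw [e]
  calc |ξ| ^ m / (2 ^ m * m.factorial) * |wft (α + m) ξ|
      ≤ (1 + |ξ|) ^ m / (2 ^ m * m.factorial) * (C * (1 + |ξ|) ^ (-(α + m + 1))) := by
        gcongr
        · linarith
        · exact h ξ
    _ = 1 / (2 ^ m * m.factorial) * C * ((1 + |ξ|) ^ (-(α + m + 1)) * (1 + |ξ|) ^ m) := by ring
    _ = _ := by
        rw [← Real.rpow_add_natCast h1.ne']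
        congr 2; ring

/-- Plancherel. The sign in the symbol has modulus one and disappears; rescaling η to ξ = 2πη
produces the prefactor. -/
theorem form_eq {s : ℝ} (hs : 0 ≤ s) (u v : hStar s) :
    form s hs u v = (2 * Real.pi)⁻¹ * ∫ ξ : ℝ, ((|ξ| ^ (2 * s) : ℝ) : ℂ) *
      (intervalFT u ξ * (starRingEnd ℂ) (intervalFT v ξ)) := by
  have h1 : form s hs u v = ∫ η : ℝ, ((|2 * Real.pi * η| ^ (2 * s) : ℝ) : ℂ) *
      (intervalFT u (2 * Real.pi * η) * (starRingEnd ℂ) (intervalFT v (2 * Real.pi * η))) := by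
    rw [form, ← Lp.inner_fourier_eq, rieszDeriv, rieszDeriv, fourier_fourierInv_eq,
      fourier_fourierInv_eq, L2.inner_def]
    refine integral_congr_ae ?_
    filter_upwards [(memLp_riesz hs u).coeFn_toLp, (memLp_riesz hs v).coeFn_toLp,
      fourier_zeroExt u, fourier_zeroExt v] with η h1 h2 h3 h4
    rw [h1, h2, h3, h4, RCLike.inner_apply, map_mul]
    have e1 : rieszSymbol s (2 * Real.pi * η) * (starRingEnd ℂ) (rieszSymbol s (2 * Real.pi * η)) =
        ((|2 * Real.pi * η| ^ (2 * s) : ℝ) : ℂ) := by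
      rw [Complex.mul_conj, Complex.normSq_eq_norm_sq, rieszSymbol, norm_mul, norm_zpow, norm_neg,
        norm_one, one_zpow, one_mul, Complex.norm_of_nonneg (by positivity),
        ← Real.rpow_natCast, ← Real.rpow_mul (abs_nonneg _)]
      congr 2
      push_cast; ring
    rw [← e1]
    ring
  rw [h1, Measure.integral_comp_mul_left (fun ξ : ℝ => ((|ξ| ^ (2 * s) : ℝ) : ℂ) *
      (intervalFT u ξ * (starRingEnd ℂ) (intervalFT v ξ))) (2 * Real.pi),
    abs_of_pos (by positivity), Complex.real_smul]

theorem integral_wft_mul_odd {α : ℝ} {m n : ℕ} (h : Odd (m + n)) :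
    ∫ ξ : ℝ, |ξ| ^ (2 * α) * ξ ^ (m + n) * (wft (α + m) ξ * wft (α + n) ξ) = 0 := by
  have e := integral_neg_eq_self
    (fun ξ : ℝ => |ξ| ^ (2 * α) * ξ ^ (m + n) * (wft (α + m) ξ * wft (α + n) ξ)) volume
  simp only [abs_neg, h.neg_pow, wft_neg, mul_neg, neg_mul, integral_neg] at e
  linarith

theorem integral_wft_mul_even {α : ℝ} (hα : 0 ≤ α) {m n : ℕ} (h : Even (m + n)) :
    ∫ ξ : ℝ, |ξ| ^ (2 * α) * ξ ^ (m + n) * (wft (α + m) ξ * wft (α + n) ξ) =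
      2 * (2 ^ (2 * α) * 2 ^ (m + n) * (Real.Gamma (α + m + 1) * Real.Gamma (α + n + 1)) *
        sphPair (α + m) (α + n)) := by
  have e : ∀ ξ : ℝ, |ξ| ^ (2 * α) * ξ ^ (m + n) * (wft (α + m) ξ * wft (α + n) ξ) =
      |ξ| ^ (2 * α) * |ξ| ^ (m + n) * (wft (α + m) |ξ| * wft (α + n) |ξ|) := by
    intro ξ
    rw [h.pow_abs]
    rcases abs_choice ξ with h | h <;> rw [h]
    simp only [wft_neg]
  simp_rw [e]
  rw [integral_comp_abs (f := fun ξ : ℝ => ξ ^ (2 * α) * ξ ^ (m + n) *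
    (wft (α + m) ξ * wft (α + n) ξ)), sphPair]
  congr 1
  rw [← integral_const_mul]
  refine setIntegral_congr_fun measurableSet_Ioi fun x hx => ?_
  have hx : 0 < x := hx
  have g1 : 0 < Real.Gamma (α + m + 1) := Real.Gamma_pos_of_pos (by positivity)
  have g2 : 0 < Real.Gamma (α + n + 1) := Real.Gamma_pos_of_pos (by positivity)
  simp only [sphBessel]
  rw [Real.rpow_add hx, Real.rpow_add hx, Real.rpow_add two_pos, Real.rpow_add two_pos, two_mul α,
    Real.rpow_add hx, Real.rpow_add two_pos, Real.rpow_natCast, Real.rpow_natCast,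
    Real.rpow_natCast, Real.rpow_natCast]
  field_simp
  ring

theorem form_gjf {α : ℝ} (hα : 0 ≤ α) (m n : ℕ) :
    form α hα ⟨gjf α hα m, gjf_mem_hStar hα m⟩ ⟨gjf α hα n, gjf_mem_hStar hα n⟩ =
      if m = n then
        (((2 : ℝ) ^ (2 * α + 1) * Real.Gamma (m + α + 1) ^ 2 /
          ((m.factorial : ℝ) ^ 2 * (2 * m + 2 * α + 1)) : ℝ) : ℂ)
      else 0 := by
  have h1 : form α hα ⟨gjf α hα m, gjf_mem_hStar hα m⟩ ⟨gjf α hα n, gjf_mem_hStar hα n⟩ =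
      (2 * Real.pi)⁻¹ * ((-Complex.I) ^ m * Complex.I ^ n /
        ((2 ^ m * m.factorial) * (2 ^ n * n.factorial)) *
      ((∫ ξ : ℝ, |ξ| ^ (2 * α) * ξ ^ (m + n) * (wft (α + m) ξ * wft (α + n) ξ) : ℝ) : ℂ)) := by
    rw [form_eq]
    congr 1
    rw [← integral_complex_ofReal, ← integral_const_mul]
    refine integral_congr_ae (Filter.Eventually.of_forall fun ξ => ?_)
    simp only [intervalFT_gjf]
    simp only [map_mul, map_div₀, map_pow, map_neg, Complex.conj_I, Complex.conj_ofReal,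
      Complex.conj_natCast, map_ofNat, neg_neg]
    push_cast
    rw [mul_pow, mul_pow, pow_add]
    ring
  rw [h1]
  rcases Nat.even_or_odd (m + n) with h | h
  · rw [integral_wft_mul_even hα h]
    split_ifs with hmn
    · subst hmn
      have hs := sphPair_self (show 0 ≤ α + m by positivity)
      have hI : (-Complex.I) ^ m * Complex.I ^ m = 1 := by
        rw [← mul_pow]; simp
      have hA : sphPair (α + m) (α + m) = 2 * Real.pi / (2 * (α + m) + 1) := by
        rw [← hs]; field_simp
      rw [hI, hA]
      have hf : (m.factorial : ℝ) ≠ 0 := by positivity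
      have key : (2 * Real.pi)⁻¹ * (1 / ((2 ^ m * m.factorial) * (2 ^ m * m.factorial)) *
          (2 * (2 ^ (2 * α) * 2 ^ (m + m) * (Real.Gamma (α + m + 1) * Real.Gamma (α + m + 1)) *
            (2 * Real.pi / (2 * (α + m) + 1))))) =
          2 ^ (2 * α + 1) * Real.Gamma (m + α + 1) ^ 2 /
            ((m.factorial : ℝ) ^ 2 * (2 * m + 2 * α + 1)) := by
        rw [add_comm (m : ℝ) α, Real.rpow_add_one two_ne_zero, pow_add,
          show 2 * (α + m) + 1 = 2 * m + 2 * α + 1 by ring]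
        have : 2 * (m : ℝ) + 2 * α + 1 ≠ 0 := by positivity
        have := Real.pi_pos.ne'
        field_simp
      rw [← key]
      push_cast
      rfl
    · have hz : sphPair (α + m) (α + n) = 0 := by
        rcases lt_or_gt_of_ne hmn with hlt | hlt
        · obtain ⟨k, hk⟩ : ∃ k, n = m + 2 * (k + 1) := by
            obtain ⟨r, hr⟩ := h
            exact ⟨r - m - 1, by omega⟩
          rw [sphPair_comm, hk]
          have := sphPair_even k (α + m) (by positivity)
          rw [← this]
          push_cast
          ring_nf
        · obtain ⟨k, hk⟩ : ∃ k, m = n + 2 * (k + 1) := by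
            obtain ⟨r, hr⟩ := h
            exact ⟨r - n - 1, by omega⟩
          rw [hk]
          have := sphPair_even k (α + n) (by positivity)
          rw [← this]
          push_cast
          ring_nf
      rw [hz]
      simp
  · rw [integral_wft_mul_odd h, if_neg (by rintro rfl; exact (Nat.not_odd_iff_even.2 ⟨m, rfl⟩) h)]
    simp

end

end RieszJacobi

/-! ### Completeness: from Jacobi functions to weighted Schwartz functions. -/

namespace RieszJacobi

noncomputable section

open MeasureTheory Set FourierTransform
open scoped SchwartzMap

variable {α : ℝ} {G : ℝ → ℂ}

/-- The condition on `G` is the one met by an L² function times (1+ξ²)^{α/2}; see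
`integrable_weight_mul_decay`. -/
theorem integrable_mul_of_decay (hGm : AEStronglyMeasurable G volume)
    (hG : Integrable (fun ξ : ℝ => ‖G ξ‖ * (1 + |ξ|) ^ (-(α + 1)))) {f : ℝ → ℂ}
    (hf : Continuous f) {C : ℝ} (h : ∀ ξ : ℝ, ‖f ξ‖ ≤ C * (1 + |ξ|) ^ (-(α + 1))) :
    Integrable (fun ξ => G ξ * f ξ) := by
  refine (hG.const_mul C).mono' (hGm.mul hf.aestronglyMeasurable)
    (Filter.Eventually.of_forall fun ξ => ?_)
  rw [norm_mul]
  calc _ ≤ ‖G ξ‖ * (C * (1 + |ξ|) ^ (-(α + 1))) := by gcongr; exact h ξ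
    _ = _ := by ring

theorem continuous_weight_mul (hα : 0 ≤ α) {f : ℝ → ℝ} (hf : Continuous f) :
    Continuous fun x : ℝ => (((1 - x ^ 2) ^ α * f x : ℝ) : ℂ) :=
  Complex.continuous_ofReal.comp
    ((Continuous.rpow_const (by fun_prop) fun _ => Or.inr hα).mul hf)

theorem integral_mul_intervalFT_poly (hα : 0 ≤ α)
    (hJ : ∀ m : ℕ, Integrable (fun ξ => G ξ * intervalFT (fun x => gjfFun α m x) ξ) ∧
      ∫ ξ, G ξ * intervalFT (fun x => gjfFun α m x) ξ = 0) (p : Polynomial ℝ) :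
    Integrable (fun ξ => G ξ * intervalFT (fun x => ((1 - x ^ 2) ^ α * p.eval x : ℝ)) ξ) ∧
      ∫ ξ, G ξ * intervalFT (fun x => ((1 - x ^ 2) ^ α * p.eval x : ℝ)) ξ = 0 := by
  have hp : p ∈ Submodule.span ℝ (Set.range fun n => jacobiP n α α) := by
    rw [span_jacobiP hα]; trivial
  induction hp using Submodule.span_induction with
  | mem q hq =>
    obtain ⟨n, rfl⟩ := hq
    exact hJ n
  | zero => simp [intervalFT]
  | add q r _ _ hq hr =>
    have e : ∀ ξ, G ξ * intervalFT (fun x => ((1 - x ^ 2) ^ α * (q + r).eval x : ℝ)) ξ =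
        G ξ * intervalFT (fun x => ((1 - x ^ 2) ^ α * q.eval x : ℝ)) ξ +
        G ξ * intervalFT (fun x => ((1 - x ^ 2) ^ α * r.eval x : ℝ)) ξ := by
      intro ξ
      rw [← mul_add, ← intervalFT_add
        ((continuous_weight_mul hα q.continuous).intervalIntegrable _ _)
        ((continuous_weight_mul hα r.continuous).intervalIntegrable _ _)]
      congr 2
      funext x
      rw [Polynomial.eval_add]; push_cast; ring
    simp_rw [e]
    exact ⟨hq.1.add hr.1, by rw [integral_add hq.1 hr.1, hq.2, hr.2, add_zero]⟩
  | smul c q _ hq =>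
    have e : ∀ ξ, G ξ * intervalFT (fun x => ((1 - x ^ 2) ^ α * (c • q).eval x : ℝ)) ξ =
        c * (G ξ * intervalFT (fun x => ((1 - x ^ 2) ^ α * q.eval x : ℝ)) ξ) := by
      intro ξ
      rw [mul_left_comm, ← intervalFT_const_mul (c : ℂ)]
      congr 2
      funext x
      rw [Polynomial.eval_smul, smul_eq_mul]; push_cast; ring
    simp_rw [e]
    exact ⟨hq.1.const_mul _, by rw [integral_const_mul, hq.2, mul_zero]⟩

theorem integral_mul_intervalFT_wmon (hα : 0 ≤ α)
    (hJ : ∀ m : ℕ, Integrable (fun ξ => G ξ * intervalFT (fun x => gjfFun α m x) ξ) ∧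
      ∫ ξ, G ξ * intervalFT (fun x => gjfFun α m x) ξ = 0) (n : ℕ) :
    ∫ ξ, G ξ * intervalFT (fun x => wmon α n x) ξ = 0 := by
  have := (integral_mul_intervalFT_poly hα hJ (Polynomial.X ^ n)).2
  simpa [wmon] using this

/-- The polynomial factor is at most k! e^{n+1}, which leaves an exponential series in e|t|. It
accounts for the n-dependence in `intervalFT_wmon_decay`. -/
theorem summable_pow_mul_pow_div_factorial (k : ℕ) (t : ℝ) :
    Summable fun n : ℕ => ((n : ℝ) + 1) ^ k * (|t| ^ n / n.factorial) := by
  have h := (Real.summable_pow_div_factorial (Real.exp 1 * |t|)).mul_left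
    (k.factorial * Real.exp 1)
  refine Summable.of_nonneg_of_le (fun n => by positivity) (fun n => ?_) h
  have h1 : ((n : ℝ) + 1) ^ k / k.factorial ≤ Real.exp (n + 1) :=
    Real.pow_div_factorial_le_exp _ (by positivity) k
  rw [div_le_iff₀ (by positivity)] at h1
  have h2 : Real.exp (n + 1) = Real.exp 1 ^ n * Real.exp 1 := by
    rw [Real.exp_add, ← Real.exp_nat_mul, mul_one]
  rw [h2] at h1
  calc _ ≤ (Real.exp 1 ^ n * Real.exp 1 * k.factorial) * (|t| ^ n / n.factorial) := by gcongr
    _ = _ := by rw [mul_pow]; ring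

theorem hasSum_intervalFT_exp (hα : 0 ≤ α) (t ξ : ℝ) :
    HasSum (fun n : ℕ => (Complex.I * t) ^ n / n.factorial * intervalFT (fun x => wmon α n x) ξ)
      (wft α (ξ - t)) := by
  have h := intervalIntegral.hasSum_integral_of_dominated_convergence (μ := volume)
    (a := -1) (b := 1)
    (F := fun (n : ℕ) (x : ℝ) => (Complex.I * t) ^ n / n.factorial *
      (wmon α n x * Complex.exp (-(x * ξ) * Complex.I)))
    (f := fun x : ℝ => wmon α 0 x * Complex.exp (-(x * ((ξ - t : ℝ) : ℂ)) * Complex.I))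
    (fun n _ => |t| ^ n / n.factorial)
    (fun n => by
      have := Complex.continuous_ofReal.comp (continuous_wmon hα n)
      have h2 : Continuous fun x : ℝ => (wmon α n x : ℂ) := this
      exact (continuous_const.mul (h2.mul (continuous_exp_neg_mul_I ξ))).aestronglyMeasurable)
    (fun n => Filter.Eventually.of_forall fun x hx => by
      rw [uIoc_of_le (by norm_num)] at hx
      rw [norm_mul, norm_mul, norm_exp_neg_mul_I, norm_div, norm_pow, norm_mul, Complex.norm_I,
        Complex.norm_natCast, Complex.norm_real, Complex.norm_real, one_mul, mul_one,
        Real.norm_eq_abs, Real.norm_eq_abs]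
      exact mul_le_of_le_one_right (by positivity)
        (abs_wmon_le_one hα n (Ioc_subset_Icc_self hx)))
    (Filter.Eventually.of_forall fun x _ => Real.summable_pow_div_factorial |t|)
    (by simp)
    (Filter.Eventually.of_forall fun x _ => by
      have h1 : HasSum (fun n : ℕ => (Complex.I * t * x) ^ n / n.factorial)
          (Complex.exp (Complex.I * t * x)) := by
        rw [Complex.exp_eq_exp_ℂ]
        exact NormedSpace.expSeries_div_hasSum_exp (Complex.I * t * x)
      have h2 := h1.mul_right ((wmon α 0 x : ℂ) * Complex.exp (-(x * ξ) * Complex.I))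
      have e : Complex.exp (Complex.I * t * x) *
          ((wmon α 0 x : ℂ) * Complex.exp (-(x * ξ) * Complex.I)) =
          wmon α 0 x * Complex.exp (-(x * ((ξ - t : ℝ) : ℂ)) * Complex.I) := by
        rw [mul_left_comm, ← Complex.exp_add]
        congr 2
        push_cast; ring
      rw [e] at h2
      refine h2.congr_fun fun n => ?_
      simp only [wmon, pow_zero, mul_one, Complex.ofReal_mul, Complex.ofReal_pow]
      rw [mul_pow]
      ring)
  have e := intervalFT_wmon_zero (show -1 < α by linarith) (ξ - t)
  unfold intervalFT at e ⊢
  rw [← e]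
  simpa only [intervalIntegral.integral_const_mul] using h

/-- Translating Φ_α by t multiplies the weight by e^{itx}. Its power series may be integrated
against `G` term by term, since the decay constants of (1-x²)^α x^n grow only polynomially in n. -/
theorem integral_mul_wft_shift (hα : 0 ≤ α) (hGm : AEStronglyMeasurable G volume)
    (hG : Integrable (fun ξ : ℝ => ‖G ξ‖ * (1 + |ξ|) ^ (-(α + 1))))
    (hw : ∀ n : ℕ, ∫ ξ, G ξ * intervalFT (fun x => wmon α n x) ξ = 0) (t : ℝ) :
    ∫ ξ, G ξ * wft α (ξ - t) = 0 := by
  obtain ⟨C, k, hC, h⟩ := intervalFT_wmon_decay hα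
  have hc : ∀ n, Continuous (intervalFT fun x => (wmon α n x : ℂ)) := fun n =>
    continuous_intervalFT (intervalIntegrable_ofReal (intervalIntegrable_wmon (by linarith) n))
  have hint : ∀ n : ℕ, Integrable (fun ξ => (Complex.I * t) ^ n / n.factorial *
      (G ξ * intervalFT (fun x => wmon α n x) ξ)) := fun n =>
    (integrable_mul_of_decay hGm hG (hc n) (h n)).const_mul _
  have hs := hasSum_integral_of_summable_integral_norm hint (by
    refine Summable.of_nonneg_of_le (fun n => by positivity) (fun n => ?_)
      ((summable_pow_mul_pow_div_factorial k t).mul_left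
        (C * ∫ ξ : ℝ, ‖G ξ‖ * (1 + |ξ|) ^ (-(α + 1))))
    have hb : ∫ ξ, ‖(Complex.I * t) ^ n / n.factorial *
        (G ξ * intervalFT (fun x => wmon α n x) ξ)‖ ≤
        ∫ ξ, (C * (n + 1) ^ k * (|t| ^ n / n.factorial)) *
          (‖G ξ‖ * (1 + |ξ|) ^ (-(α + 1))) := by
      refine integral_mono (hint n).norm (hG.const_mul _) fun ξ => ?_
      simp only
      rw [norm_mul, norm_mul, norm_div, norm_pow, norm_mul, Complex.norm_I,
        Complex.norm_natCast, Complex.norm_real, one_mul, Real.norm_eq_abs]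
      calc _ ≤ |t| ^ n / n.factorial * (‖G ξ‖ * (C * (n + 1) ^ k * (1 + |ξ|) ^ (-(α + 1)))) := by
            gcongr
            exact h n ξ
        _ = _ := by ring
    rw [integral_const_mul] at hb
    refine hb.trans (le_of_eq ?_)
    ring)
  have e1 : ∀ n : ℕ, ∫ ξ, (Complex.I * t) ^ n / n.factorial *
      (G ξ * intervalFT (fun x => wmon α n x) ξ) = 0 := fun n => by
    rw [integral_const_mul, hw n, mul_zero]
  have e2 : ∀ ξ, ∑' n : ℕ, (Complex.I * t) ^ n / n.factorial *
      (G ξ * intervalFT (fun x => wmon α n x) ξ) = G ξ * wft α (ξ - t) := by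
    intro ξ
    rw [← ((hasSum_intervalFT_exp hα t ξ).mul_left (G ξ)).tsum_eq]
    exact tsum_congr fun n => by ring
  simp_rw [e1, e2] at hs
  exact hs.unique hasSum_zero

theorem one_add_abs_sub_rpow_le (hα : 0 ≤ α) (ξ s : ℝ) :
    (1 + |ξ - s|) ^ (-(α + 1)) ≤ (1 + |ξ|) ^ (-(α + 1)) * (1 + |s|) ^ (α + 1) := by
  have h : 1 + |ξ| ≤ (1 + |ξ - s|) * (1 + |s|) := by
    have : |ξ| ≤ |ξ - s| + |s| := by simpa using abs_add_le (ξ - s) s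
    nlinarith [abs_nonneg (ξ - s), abs_nonneg s]
  have h1 := Real.rpow_le_rpow_of_nonpos (by positivity) h (show -(α + 1) ≤ 0 by linarith)
  rw [Real.mul_rpow (by positivity) (by positivity), Real.rpow_neg (by positivity : 0 ≤ 1 + |s|)]
    at h1
  rwa [← div_le_iff₀ (by positivity), div_eq_mul_inv]

theorem integrable_schwartz_mul_rpow (h : 𝓢(ℝ, ℂ)) (a c : ℝ) :
    Integrable fun t : ℝ => ‖h t‖ * (1 + |c * t|) ^ a := by
  obtain ⟨k, hk⟩ := exists_nat_ge a
  have h0 := h.integrable_pow_mul volume 0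
  have h1 := h.integrable_pow_mul volume k
  have hcont : Continuous fun t : ℝ => ‖h t‖ * (1 + |c * t|) ^ a :=
    h.continuous.norm.mul (Continuous.rpow_const (by fun_prop) fun t =>
      Or.inl (by positivity))
  refine ((h0.add (h1.const_mul (|c| ^ k))).const_mul (2 ^ k)).mono' hcont.aestronglyMeasurable
    (Filter.Eventually.of_forall fun t => ?_)
  rw [Real.norm_of_nonneg (by positivity)]
  simp only [Pi.add_apply, pow_zero, one_mul]
  have h2 : (1 + |c * t|) ^ a ≤ 2 ^ k * (1 + |c| ^ k * ‖t‖ ^ k) := by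
    calc (1 + |c * t|) ^ a ≤ (1 + |c * t|) ^ (k : ℝ) :=
          Real.rpow_le_rpow_of_exponent_le (by linarith [abs_nonneg (c * t)]) hk
      _ = (1 + |c * t|) ^ k := Real.rpow_natCast _ _
      _ ≤ 2 ^ k * (1 + |c * t| ^ k) := by
          rcases le_total |c * t| 1 with h | h
          · calc (1 + |c * t|) ^ k ≤ 2 ^ k := by gcongr; linarith
              _ ≤ _ := le_mul_of_one_le_right (by positivity)
                (by linarith [pow_nonneg (abs_nonneg (c * t)) k])
          · calc (1 + |c * t|) ^ k ≤ (2 * |c * t|) ^ k := by gcongr; linarith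
              _ = 2 ^ k * |c * t| ^ k := mul_pow _ _ _
              _ ≤ _ := by gcongr; linarith
      _ = _ := by rw [abs_mul, mul_pow, Real.norm_eq_abs]
  calc _ ≤ ‖h t‖ * (2 ^ k * (1 + |c| ^ k * ‖t‖ ^ k)) := by gcongr
    _ = _ := by ring

/-- Fourier inversion writes h as a superposition of exponentials, hence the transform of the
weighted h as one of translates of Φ_α. -/
theorem intervalFT_schwartz (hα : 0 ≤ α) (h : 𝓢(ℝ, ℂ)) (ξ : ℝ) :
    intervalFT (fun x => wmon α 0 x * h x) ξ =
      ∫ t : ℝ, 𝓕 h t * wft α (ξ - 2 * Real.pi * t) := by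
  have hinv : ∀ x : ℝ, h x = ∫ t : ℝ, 𝓕 h t * Complex.exp (2 * Real.pi * t * x * Complex.I) := by
    intro x
    have h1 : (𝓕⁻ (𝓕 h)) x = h x := by rw [FourierTransform.fourierInv_fourier_eq]
    rw [← h1, SchwartzMap.fourierInv_coe, Real.fourierInv_eq']
    refine integral_congr_ae (Filter.Eventually.of_forall fun t => ?_)
    simp only [smul_eq_mul]
    rw [mul_comm]
    congr 2
    simp
    ring
  have hw : Continuous fun x : ℝ => (wmon α 0 x : ℂ) :=
    Complex.continuous_ofReal.comp (continuous_wmon hα 0)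
  have hint : Integrable (Function.uncurry fun x t : ℝ =>
      (wmon α 0 x * Complex.exp (-(x * ξ) * Complex.I)) *
        (𝓕 h t * Complex.exp (2 * Real.pi * t * x * Complex.I)))
      ((volume.restrict (Ioc (-1 : ℝ) 1)).prod volume) := by
    have h1 : Integrable (fun x : ℝ => (wmon α 0 x : ℂ) * Complex.exp (-(x * ξ) * Complex.I))
        (volume.restrict (Ioc (-1 : ℝ) 1)) :=
      (hw.mul (continuous_exp_neg_mul_I ξ)).integrableOn_Ioc
    have h2 := h1.mul_prod ((𝓕 h).integrable (μ := volume))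
    refine (h2.bdd_mul (c := 1)
      (f := fun p : ℝ × ℝ => Complex.exp (2 * Real.pi * p.2 * p.1 * Complex.I))
      (Continuous.aestronglyMeasurable (by fun_prop))
      (Filter.Eventually.of_forall fun p => ?_)).congr
      (Filter.Eventually.of_forall fun p => ?_)
    · have := Complex.norm_exp_ofReal_mul_I (2 * Real.pi * p.2 * p.1)
      push_cast at this
      rw [this]
    · simp only [Function.uncurry]
      ring
  have hswap := integral_integral_swap hint
  rw [intervalFT, intervalIntegral.integral_of_le (by norm_num)]
  refine Eq.trans ?_ (hswap.trans ?_)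
  · refine integral_congr_ae (Filter.Eventually.of_forall fun x => ?_)
    simp only
    rw [integral_const_mul, ← hinv x]
    ring
  · refine integral_congr_ae (Filter.Eventually.of_forall fun t => ?_)
    simp only
    rw [← intervalFT_wmon_zero (by linarith), intervalFT,
      intervalIntegral.integral_of_le (by norm_num), ← integral_const_mul]
    refine integral_congr_ae (Filter.Eventually.of_forall fun x => ?_)
    simp only
    have e : Complex.exp (-(x * ((ξ - 2 * Real.pi * t : ℝ) : ℂ)) * Complex.I) =
        Complex.exp (-(x * ξ) * Complex.I) * Complex.exp (2 * Real.pi * t * x * Complex.I) := by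
      rw [← Complex.exp_add]
      congr 1
      push_cast; ring
    rw [e]
    ring

/-- Fubini reduces this to the translates. The double integral converges absolutely because
`one_add_abs_sub_rpow_le` moves the effect of the shift onto the rapidly decreasing 𝓕 h. -/
theorem integral_mul_intervalFT_schwartz (hα : 0 ≤ α) (hGm : AEStronglyMeasurable G volume)
    (hG : Integrable (fun ξ : ℝ => ‖G ξ‖ * (1 + |ξ|) ^ (-(α + 1))))
    (hw : ∀ t : ℝ, ∫ ξ, G ξ * wft α (ξ - t) = 0) (h : 𝓢(ℝ, ℂ)) :
    ∫ ξ, G ξ * intervalFT (fun x => wmon α 0 x * h x) ξ = 0 := by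
  obtain ⟨C, hC, hd⟩ := wft_decay hα
  have cw : Continuous (wft α) := continuous_wft (by linarith)
  have hint : Integrable (Function.uncurry fun ξ t : ℝ =>
      G ξ * (𝓕 h t * wft α (ξ - 2 * Real.pi * t))) (volume.prod volume) := by
    have h1 := (hG.mul_prod (integrable_schwartz_mul_rpow (𝓕 h) (α + 1) (2 * Real.pi))).const_mul C
    refine h1.mono' ?_ (Filter.Eventually.of_forall fun p => ?_)
    · have c2 : Continuous fun p : ℝ × ℝ =>
          𝓕 h p.2 * (wft α (p.1 - 2 * Real.pi * p.2) : ℂ) :=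
        ((𝓕 h).continuous.comp continuous_snd).mul
          (Complex.continuous_ofReal.comp (cw.comp (by fun_prop)))
      exact hGm.comp_fst.mul c2.aestronglyMeasurable
    · simp only [Function.uncurry]
      rw [norm_mul, norm_mul, Complex.norm_real, Real.norm_eq_abs]
      calc _ ≤ ‖G p.1‖ * (‖𝓕 h p.2‖ * (C * ((1 + |p.1|) ^ (-(α + 1)) *
            (1 + |2 * Real.pi * p.2|) ^ (α + 1)))) := by
            gcongr
            refine (hd _).trans ?_
            gcongr
            exact one_add_abs_sub_rpow_le hα _ _
        _ = _ := by ring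
  have hswap := integral_integral_swap hint
  simp_rw [intervalFT_schwartz hα, ← integral_const_mul]
  rw [hswap]
  refine integral_eq_zero_of_ae (Filter.Eventually.of_forall fun t => ?_)
  simp only [Pi.zero_apply]
  simp_rw [mul_left_comm (G _)]
  rw [integral_const_mul, hw, mul_zero]

end

end RieszJacobi

/-! ### Weak limits in L², dilation and mollification. -/

namespace RieszJacobi

noncomputable section

open MeasureTheory Set FourierTransform Filter
open scoped SchwartzMap Topology Convolution ENNReal

theorem enorm_integral_mul_le {f g : ℝ → ℂ} (hf : AEStronglyMeasurable f volume)
    (hg : AEStronglyMeasurable g volume) :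
    ‖∫ x, f x * g x‖ₑ ≤ eLpNorm f 2 volume * eLpNorm g 2 volume := by
  refine (enorm_integral_le_lintegral_enorm _).trans ?_
  have h := eLpNorm_smul_le_mul_eLpNorm (p := 2) (q := 2) (r := 1) hg hf
  rwa [eLpNorm_one_eq_lintegral_enorm] at h

theorem norm_integral_mul_le {f g : ℝ → ℂ} (hf : MemLp f 2 volume) (hg : MemLp g 2 volume) :
    ‖∫ x, f x * g x‖ ≤ (eLpNorm f 2 volume).toReal * (eLpNorm g 2 volume).toReal := by
  rw [← ENNReal.toReal_mul, ← toReal_enorm]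
  exact ENNReal.toReal_mono (ENNReal.mul_ne_top hf.2.ne hg.2.ne) (enorm_integral_mul_le hf.1 hg.1)

/-- Orthogonality passes to pointwise limits of bounded sequences in `L²`. -/
theorem integral_mul_eq_zero_of_tendsto {g U : ℝ → ℂ} {V : ℕ → ℝ → ℂ} {B : ℝ → ℝ} {M : ℝ≥0∞}
    (hM : M ≠ ⊤) (hg : MemLp g 2 volume) (hU : MemLp U 2 volume) (hV : ∀ n, MemLp (V n) 2 volume)
    (hVM : ∀ n, eLpNorm (V n) 2 volume ≤ M) (hB : Continuous B) (hVB : ∀ n ξ, ‖V n ξ‖ ≤ B ξ)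
    (hlim : ∀ ξ, Tendsto (fun n => V n ξ) atTop (𝓝 (U ξ))) (h0 : ∀ n, ∫ ξ, g ξ * V n ξ = 0) :
    ∫ ξ, g ξ * U ξ = 0 := by
  set K : ℝ := M.toReal + (eLpNorm U 2 volume).toReal with hK
  have hK0 : 0 ≤ K := by positivity
  have key : ∀ ε : ℝ, 0 < ε → ‖∫ ξ, g ξ * U ξ‖ ≤ ε * K := by
    intro ε hε
    -- Replacing g by a compactly supported continuous k costs at most ε times the uniform L²
    -- bounds. Against k, the locally bounded majorant `B` allows dominated convergence.
    obtain ⟨k, hkc, hke, hkcont, hkL⟩ := hg.exists_hasCompactSupport_eLpNorm_sub_le (by norm_num)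
      (ε := ENNReal.ofReal ε) (by simpa using hε)
    have hsub : (eLpNorm (g - k) 2 volume).toReal ≤ ε :=
      ENNReal.toReal_le_of_le_ofReal hε.le hke
    have hdiff : ∀ {W : ℝ → ℂ}, MemLp W 2 volume →
        ∫ ξ, g ξ * W ξ = (∫ ξ, (g - k) ξ * W ξ) + ∫ ξ, k ξ * W ξ := by
      intro W hW
      have i1 : Integrable (fun ξ => (g - k) ξ * W ξ) := (hg.sub hkL).integrable_mul hW
      have i2 : Integrable (fun ξ => k ξ * W ξ) := hkL.integrable_mul hW
      rw [← integral_add i1 i2]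
      refine integral_congr_ae (Eventually.of_forall fun ξ => ?_)
      simp only [Pi.sub_apply]
      ring
    have hlimk : Tendsto (fun n => ∫ ξ, k ξ * V n ξ) atTop (𝓝 (∫ ξ, k ξ * U ξ)) := by
      refine tendsto_integral_of_dominated_convergence (fun ξ => ‖k ξ‖ * B ξ)
        (fun n => hkL.1.mul (hV n).1) ?_ (fun n => Eventually.of_forall fun ξ => ?_)
        (Eventually.of_forall fun ξ => (hlim ξ).const_mul _)
      · exact (hkcont.norm.mul hB).integrable_of_hasCompactSupport hkc.norm.mul_right
      · rw [norm_mul]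
        exact mul_le_mul_of_nonneg_left (hVB n ξ) (norm_nonneg _)
    have hk : ‖∫ ξ, k ξ * U ξ‖ ≤ ε * M.toReal := by
      refine le_of_tendsto hlimk.norm (Eventually.of_forall fun n => ?_)
      have h1 := hdiff (hV n)
      rw [h0 n] at h1
      rw [← norm_neg, ← eq_neg_of_add_eq_zero_left h1.symm]
      exact (norm_integral_mul_le (hg.sub hkL) (hV n)).trans
        (mul_le_mul hsub (ENNReal.toReal_mono hM (hVM n)) ENNReal.toReal_nonneg hε.le)
    rw [hdiff hU, hK, mul_add, add_comm (ε * _)]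
    refine (norm_add_le _ _).trans (add_le_add ?_ hk)
    exact (norm_integral_mul_le (hg.sub hkL) hU).trans
      (mul_le_mul_of_nonneg_right hsub ENNReal.toReal_nonneg)
  rw [← norm_le_zero_iff]
  refine le_of_forall_pos_le_add fun η hη => ?_
  refine (key (η / (K + 1)) (by positivity)).trans ?_
  rw [zero_add, div_mul_eq_mul_div, div_le_iff₀ (by positivity)]
  nlinarith

theorem eLpNorm_comp_mul_left (f : ℝ → ℂ) {a : ℝ} (ha : a ≠ 0) :
    eLpNorm (fun x => f (a * x)) 2 volume =
      ENNReal.ofReal |a⁻¹| ^ (1 / 2 : ℝ) * eLpNorm f 2 volume := by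
  have h := (Homeomorph.mulLeft₀ a ha).measurableEmbedding.eLpNorm_map_measure (p := 2)
    (μ := volume) (g := f)
  rw [Homeomorph.coe_mulLeft₀, Real.map_volume_mul_left ha,
    eLpNorm_smul_measure_of_ne_zero (by simpa using ha)] at h
  rw [show (fun x => f (a * x)) = f ∘ (fun x => a * x) from rfl, ← h, smul_eq_mul]
  congr 2
  simp

theorem memLp_comp_mul_left {f : ℝ → ℂ} (hf : MemLp f 2 volume) {a : ℝ} (ha : a ≠ 0) :
    MemLp (fun x => f (a * x)) 2 volume := by
  refine ⟨hf.1.comp_quasiMeasurePreserving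
    (Measure.quasiMeasurePreserving_smul (volume : Measure ℝ) (r := a) ha), ?_⟩
  rw [eLpNorm_comp_mul_left f ha]
  exact ENNReal.mul_lt_top (ENNReal.rpow_lt_top_of_nonneg (by norm_num) ENNReal.ofReal_ne_top) hf.2

theorem norm_intervalFT_le_integral (f : ℝ → ℂ) (ξ : ℝ) :
    ‖intervalFT f ξ‖ ≤ ∫ x in (-1 : ℝ)..1, ‖f x‖ := by
  refine (intervalIntegral.norm_integral_le_integral_norm (by norm_num)).trans_eq ?_
  simp only [norm_mul, norm_exp_neg_mul_I, mul_one]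

theorem fourier_comp_div (f : ℝ → ℂ) {r : ℝ} (hr : 0 < r) (η : ℝ) :
    𝓕 (fun x => f (x / r)) η = r * 𝓕 f (r * η) := by
  rw [Real.fourier_real_eq_integral_exp_smul, Real.fourier_real_eq_integral_exp_smul]
  have h := Measure.integral_comp_div
    (fun y : ℝ => Complex.exp (↑(-2 * Real.pi * y * (r * η)) * Complex.I) • f y) r
  rw [abs_of_pos hr, Complex.real_smul] at h
  rw [← h]
  refine integral_congr_ae (Eventually.of_forall fun x => ?_)
  simp only
  congr 4
  field_simp

section Mollifier

variable (ρ : ContDiffBump (0 : ℝ))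

theorem integrable_normed : Integrable (fun x => ((ρ.normed volume x : ℝ) : ℂ)) :=
  ρ.integrable_normed.ofReal

theorem norm_fourier_normed_le (η : ℝ) :
    ‖𝓕 (fun x => ((ρ.normed volume x : ℝ) : ℂ)) η‖ ≤ 1 := by
  rw [Real.fourier_real_eq_integral_exp_smul]
  refine (norm_integral_le_integral_norm _).trans_eq ?_
  rw [← ρ.integral_normed (μ := volume)]
  refine integral_congr_ae (Eventually.of_forall fun x => ?_)
  simp only
  rw [norm_smul, Complex.norm_exp_ofReal_mul_I, one_mul, Complex.norm_of_nonneg (ρ.nonneg_normed x)]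

theorem norm_fourier_normed_sub_one_le (η : ℝ) :
    ‖𝓕 (fun x => ((ρ.normed volume x : ℝ) : ℂ)) η - 1‖ ≤ 2 * Real.pi * |η| * ρ.rOut := by
  have h1 : (1 : ℂ) = ∫ x : ℝ, ((ρ.normed volume x : ℝ) : ℂ) := by
    rw [integral_complex_ofReal, ρ.integral_normed, Complex.ofReal_one]
  have hi : Integrable (fun x : ℝ => Complex.exp (↑(-2 * Real.pi * x * η) * Complex.I) •
      ((ρ.normed volume x : ℝ) : ℂ)) := by
    refine (integrable_normed ρ).bdd_mul (c := 1) (Continuous.aestronglyMeasurable (by fun_prop))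
      (Eventually.of_forall fun x => ?_)
    rw [Complex.norm_exp_ofReal_mul_I]
  rw [Real.fourier_real_eq_integral_exp_smul, h1, ← integral_sub hi (integrable_normed ρ)]
  have h2 : 2 * Real.pi * |η| * ρ.rOut =
      ∫ x : ℝ, 2 * Real.pi * |η| * ρ.rOut * ρ.normed volume x := by
    rw [integral_const_mul, ρ.integral_normed, mul_one]
  rw [h2]
  refine norm_integral_le_of_norm_le (ρ.integrable_normed.const_mul _)
    (Eventually.of_forall fun x => ?_)
  have hn := ρ.nonneg_normed (μ := volume) x
  rw [smul_eq_mul, ← sub_one_mul, norm_mul, Complex.norm_of_nonneg hn]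
  by_cases hx : x ∈ Function.support (ρ.normed volume)
  · rw [ρ.support_normed_eq, mem_ball_zero_iff, Real.norm_eq_abs] at hx
    refine mul_le_mul_of_nonneg_right ?_ hn
    rw [mul_comm _ Complex.I]
    refine Real.norm_exp_I_mul_ofReal_sub_one_le.trans ?_
    rw [Real.norm_eq_abs, abs_mul, abs_mul, abs_mul, abs_of_pos Real.pi_pos]
    simp only [abs_neg, Nat.abs_ofNat]
    nlinarith [mul_nonneg Real.pi_pos.le (abs_nonneg η)]
  · rw [Function.notMem_support.1 hx]
    simp

end Mollifier

theorem contDiff_inv_weight_mul (α : ℝ) {φ : ℝ → ℂ} (hφ : ContDiff ℝ (⊤ : ℕ∞) φ) {a : ℝ}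
    (ha : a < 1) (hsupp : Function.support φ ⊆ Icc (-a) a) :
    ContDiff ℝ (⊤ : ℕ∞) fun x => (((1 - x ^ 2) ^ (-α) : ℝ) : ℂ) * φ x := by
  rw [contDiff_iff_contDiffAt]
  intro x
  by_cases hx : x ∈ Icc (-a) a
  · have h1 : 1 - x ^ 2 ≠ 0 := by nlinarith [hx.1, hx.2]
    have h2 : ContDiffAt ℝ (⊤ : ℕ∞) (fun x : ℝ => (1 - x ^ 2) ^ (-α)) x :=
      ContDiffAt.rpow_const_of_ne (by fun_prop) h1
    exact (Complex.ofRealCLM.contDiff.contDiffAt.comp x h2).mul hφ.contDiffAt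
  · have h1 : x ∉ tsupport φ := fun h => hx (closure_minimal hsupp isClosed_Icc h)
    refine contDiffAt_const (c := (0 : ℂ)) |>.congr_of_eventuallyEq ?_
    filter_upwards [notMem_tsupport_iff_eventuallyEq.1 h1] with y hy
    rw [hy]; simp

/-- Contract the zero extension of f by r = 1-2δ, then mollify at scale δ: the result is smooth with
support in [-(1-δ), 1-δ]. There (1-x²)^{-α} is smooth, so dividing by the weight gives a test
function h. The multiplier m is the transform of the mollifier. -/
theorem exists_schwartz_intervalFT_eq (α : ℝ) {f : ℝ → ℂ}
    (hf : IntegrableOn f Lam) {δ : ℝ} (h0 : 0 < δ) (h1 : 2 * δ < 1) :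
    ∃ (h : 𝓢(ℝ, ℂ)) (m : ℝ → ℂ), (∀ ξ, ‖m ξ‖ ≤ 1) ∧ (∀ ξ, ‖m ξ - 1‖ ≤ |ξ| * δ) ∧
      ∀ ξ, intervalFT (fun x => wmon α 0 x * h x) ξ =
        m ξ * ((1 - 2 * δ : ℝ) * intervalFT f ((1 - 2 * δ) * ξ)) := by
  set r : ℝ := 1 - 2 * δ with hr
  have hr0 : 0 < r := by linarith
  let ρ : ContDiffBump (0 : ℝ) := ⟨δ / 2, δ, by linarith, by linarith⟩
  set k : ℝ → ℂ := fun x => ((ρ.normed volume x : ℝ) : ℂ) with hk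
  set v : ℝ → ℂ := fun x => Lam.indicator f (x / r) with hv
  have hki : Integrable k := integrable_normed ρ
  have hvi : Integrable v :=
    ((integrable_indicator_iff measurableSet_Ioo).2 hf).comp_div hr0.ne'
  set φ : ℝ → ℂ := k ⋆[ContinuousLinearMap.mul ℂ ℂ, volume] v with hφ
  have hkc : HasCompactSupport k := ρ.hasCompactSupport_normed.comp_left Complex.ofReal_zero
  have hkd : ContDiff ℝ (⊤ : ℕ∞) k := Complex.ofRealCLM.contDiff.comp ρ.contDiff_normed
  have hφd : ContDiff ℝ (⊤ : ℕ∞) φ :=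
    hkc.contDiff_convolution_left (ContinuousLinearMap.mul ℝ ℂ) hkd hvi.locallyIntegrable
  have hsupp : Function.support φ ⊆ Icc (-(1 - δ)) (1 - δ) := by
    refine (support_convolution_subset (ContinuousLinearMap.mul ℂ ℂ)).trans ?_
    rintro _ ⟨x, hx, y, hy, rfl⟩
    have hx' : x ∈ Function.support (ρ.normed volume) := by
      intro h
      exact hx (by simp [hk, h])
    rw [ρ.support_normed_eq, mem_ball_zero_iff, Real.norm_eq_abs, abs_lt] at hx'
    have hy' : y / r ∈ Lam := by
      by_contra h
      exact hy (indicator_of_notMem h f)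
    have hy1 := (lt_div_iff₀ hr0).1 hy'.1
    have hy2 := (div_lt_iff₀ hr0).1 hy'.2
    have hx1 : -δ < x := hx'.1
    have hx2 : x < δ := hx'.2
    constructor <;> simp only <;> linarith
  have hc : HasCompactSupport fun x => (((1 - x ^ 2) ^ (-α) : ℝ) : ℂ) * φ x :=
    HasCompactSupport.of_support_subset_isCompact isCompact_Icc
      ((Function.support_mul_subset_right _ _).trans hsupp)
  refine ⟨hc.toSchwartzMap (contDiff_inv_weight_mul α hφd (by linarith) hsupp),
    fun ξ => 𝓕 k (ξ / (2 * Real.pi)), fun ξ => norm_fourier_normed_le ρ _, fun ξ => ?_,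
    fun ξ => ?_⟩
  · refine (norm_fourier_normed_sub_one_le ρ _).trans_eq ?_
    rw [abs_div, abs_of_pos (by positivity : 0 < 2 * Real.pi)]
    have : ρ.rOut = δ := rfl
    rw [this]
    field_simp
  · have e1 : intervalFT (fun x => wmon α 0 x * (hc.toSchwartzMap
        (contDiff_inv_weight_mul α hφd (by linarith) hsupp)) x) ξ = intervalFT φ ξ := by
      refine intervalFT_congr (fun x hx => ?_) ξ
      have hp : 0 < 1 - x ^ 2 := by nlinarith [hx.1, hx.2]
      change (wmon α 0 x : ℂ) * ((((1 - x ^ 2) ^ (-α) : ℝ) : ℂ) * φ x) = φ x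
      rw [← mul_assoc, ← Complex.ofReal_mul, wmon, pow_zero,
        mul_one, ← Real.rpow_add hp]
      simp
    have e2 : Lam.indicator φ = φ := by
      refine indicator_eq_self.2 (hsupp.trans fun x hx => ?_)
      exact ⟨by linarith [hx.1], by linarith [hx.2]⟩
    have e3 : ξ = 2 * Real.pi * (ξ / (2 * Real.pi)) := by field_simp
    have e4 : intervalFT φ ξ = 𝓕 φ (ξ / (2 * Real.pi)) := by
      conv_rhs => rw [← e2]
      rw [intervalFT_eq_fourier, ← e3]
    rw [e1, e4, hφ, Real.fourier_mul_convolution_eq hki hvi, hv, fourier_comp_div _ hr0,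
      intervalFT_eq_fourier]
    congr 3
    field_simp

end

end RieszJacobi

/-! ### The Hilbert space embedding, density and uniqueness. -/

namespace RieszJacobi

noncomputable section

open MeasureTheory Set FourierTransform Filter
open scoped SchwartzMap Topology ENNReal

/-- The function `(1 + ξ²)^{s/2} ṽ^(ξ)`. -/
def weightedFT (s : ℝ) (v : L2Lam) (ξ : ℝ) : ℂ :=
  (((1 + ξ ^ 2) ^ (s / 2) : ℝ) : ℂ) * intervalFT v ξ

theorem continuous_sobolevWeight (s : ℝ) : Continuous fun ξ : ℝ => (1 + ξ ^ 2) ^ (s / 2) :=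
  Continuous.rpow_const (by fun_prop) fun ξ => Or.inl (by positivity)

theorem continuous_intervalFT_coe (v : L2Lam) : Continuous (intervalFT v) :=
  continuous_intervalFT (intervalIntegrable_coe_L2Lam v)

theorem continuous_weightedFT (s : ℝ) (v : L2Lam) : Continuous (weightedFT s v) :=
  (Complex.continuous_ofReal.comp (continuous_sobolevWeight s)).mul (continuous_intervalFT_coe v)

theorem sobolevWeight_le_mul {s : ℝ} (hs : 0 ≤ s) {c ξ η : ℝ} (hc : 1 ≤ c) (h : |ξ| ≤ c * |η|) :
    (1 + ξ ^ 2) ^ (s / 2) ≤ c ^ s * (1 + η ^ 2) ^ (s / 2) := by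
  have hc0 : 0 ≤ c := by linarith
  have e : c ^ s = (c ^ 2) ^ (s / 2) := by
    rw [← Real.rpow_natCast, ← Real.rpow_mul hc0]; congr 1; push_cast; ring
  rw [e, ← Real.mul_rpow (by positivity) (by positivity)]
  refine Real.rpow_le_rpow (by positivity) ?_ (by linarith)
  have h2 : ξ ^ 2 ≤ c ^ 2 * η ^ 2 := by
    rw [← mul_pow, ← sq_abs ξ, ← sq_abs (c * η), abs_mul, abs_of_nonneg hc0]
    exact pow_le_pow_left₀ (abs_nonneg _) h 2
  nlinarith

theorem memLp_weightedFT {s : ℝ} (hs : 0 ≤ s) (v : hStar s) :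
    MemLp (weightedFT s v) 2 volume := by
  have hpi : 0 < 2 * Real.pi := by positivity
  have h1 := (memLp_congr_ae (g := fun η : ℝ => (((1 + ‖η‖ ^ 2) ^ (s / 2) : ℝ) : ℂ) *
    intervalFT v (2 * Real.pi * η)) (by
      filter_upwards [fourier_zeroExt (v : L2Lam)] with η hη
      rw [hη])).1 ((memSobolev_iff_memLp s _).1 v.2)
  refine (memLp_comp_mul_left h1 (inv_ne_zero hpi.ne')).of_le_mul (c := (2 * Real.pi) ^ s)
    (continuous_weightedFT s v).aestronglyMeasurable (Eventually.of_forall fun ξ => ?_)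
  have e : 2 * Real.pi * ((2 * Real.pi)⁻¹ * ξ) = ξ := by field_simp
  rw [weightedFT, e, norm_mul, norm_mul, ← mul_assoc, Complex.norm_of_nonneg (by positivity),
    Complex.norm_of_nonneg (by positivity), Real.norm_eq_abs, sq_abs]
  refine mul_le_mul_of_nonneg_right (sobolevWeight_le_mul hs ?_ ?_) (norm_nonneg _)
  · linarith [Real.pi_gt_three]
  · rw [← abs_of_pos hpi, ← abs_mul, abs_of_pos hpi, e]

theorem intervalFT_coe_add (u v : L2Lam) (ξ : ℝ) :
    intervalFT (u + v : L2Lam) ξ = intervalFT u ξ + intervalFT v ξ := by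
  rw [← intervalFT_add (intervalIntegrable_coe_L2Lam u) (intervalIntegrable_coe_L2Lam v)]
  exact intervalFT_congr_ae (Lp.coeFn_add u v) ξ

theorem intervalFT_coe_smul (c : ℂ) (v : L2Lam) (ξ : ℝ) :
    intervalFT (c • v : L2Lam) ξ = c * intervalFT v ξ := by
  rw [← intervalFT_const_mul]
  exact intervalFT_congr_ae (Lp.coeFn_smul c v) ξ

/-- The embedding `v ↦ (1 + ξ²)^{s/2} ṽ^` of `H^s_*(Λ)` into `L²(ℝ)`. -/
def starMap {s : ℝ} (hs : 0 ≤ s) : hStar s →ₗ[ℂ] L2R where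
  toFun v := (memLp_weightedFT hs v).toLp _
  map_add' u v := by
    rw [← MemLp.toLp_add]
    refine MemLp.toLp_congr _ _ (Eventually.of_forall fun ξ => ?_)
    simp only [weightedFT, Pi.add_apply, Submodule.coe_add, intervalFT_coe_add]
    ring
  map_smul' c v := by
    rw [RingHom.id_apply, ← MemLp.toLp_const_smul]
    refine MemLp.toLp_congr _ _ (Eventually.of_forall fun ξ => ?_)
    simp only [weightedFT, Pi.smul_apply, Submodule.coe_smul, intervalFT_coe_smul, smul_eq_mul]
    ring

theorem coeFn_starMap {s : ℝ} (hs : 0 ≤ s) (v : hStar s) :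
    (starMap hs v : ℝ → ℂ) =ᵐ[volume] weightedFT s v :=
  (memLp_weightedFT hs v).coeFn_toLp

theorem fhat_zeroExt (v : L2Lam) : fhat (zeroExt v) =ᵐ[volume] intervalFT v := by
  have hq := Measure.quasiMeasurePreserving_smul (volume : Measure ℝ)
    (r := (2 * Real.pi)⁻¹) (by positivity)
  filter_upwards [hq.ae (fourier_zeroExt v)] with ξ hξ
  have e : (2 * Real.pi)⁻¹ • ξ = ξ / (2 * Real.pi) := by rw [smul_eq_mul]; ring
  rw [e] at hξ
  rw [fhat, hξ]
  congr 1
  field_simp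

theorem norm_weightedFT_sq (s : ℝ) (v : L2Lam) (ξ : ℝ) :
    ‖weightedFT s v ξ‖ ^ 2 = (1 + ξ ^ 2) ^ s * ‖intervalFT v ξ‖ ^ 2 := by
  rw [weightedFT, norm_mul, mul_pow, Complex.norm_of_nonneg (by positivity), ← Real.rpow_natCast,
    ← Real.rpow_mul (by positivity)]
  congr 2
  push_cast; ring

theorem norm_starMap_sq {s : ℝ} (hs : 0 ≤ s) (v : hStar s) :
    ‖starMap hs v‖ ^ 2 = ∫ ξ : ℝ, (1 + ξ ^ 2) ^ s * ‖intervalFT v ξ‖ ^ 2 := by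
  have h : ((‖starMap hs v‖ ^ 2 : ℝ) : ℂ) =
      ((∫ ξ : ℝ, (1 + ξ ^ 2) ^ s * ‖intervalFT v ξ‖ ^ 2 : ℝ) : ℂ) := by
    have h1 := inner_self_eq_norm_sq_to_K (𝕜 := ℂ) (starMap hs v)
    refine Eq.trans (by push_cast; exact h1.symm) ?_
    rw [L2.inner_def]
    refine Eq.trans ?_ integral_complex_ofReal
    refine integral_congr_ae ?_
    filter_upwards [coeFn_starMap hs v] with ξ hξ
    rw [hξ, inner_self_eq_norm_sq_to_K, ← norm_weightedFT_sq]
    push_cast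
    rfl
  exact_mod_cast h

theorem starNorm_eq {s : ℝ} (hs : 0 ≤ s) (v : hStar s) :
    starNorm s v = √((2 * Real.pi)⁻¹ * ‖starMap hs v‖ ^ 2) := by
  rw [starNorm, norm_starMap_sq]
  congr 2
  refine integral_congr_ae ?_
  filter_upwards [fhat_zeroExt (v : L2Lam)] with ξ hξ
  rw [hξ]

theorem starNorm_le {s : ℝ} (hs : 0 ≤ s) (v : hStar s) : starNorm s v ≤ ‖starMap hs v‖ := by
  rw [starNorm_eq hs]
  refine Real.sqrt_le_iff.2 ⟨norm_nonneg _, ?_⟩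
  have : (2 * Real.pi)⁻¹ ≤ 1 := inv_le_one_of_one_le₀ (by linarith [Real.pi_gt_three])
  nlinarith [sq_nonneg ‖starMap hs v‖]

theorem inner_starMap {s : ℝ} (hs : 0 ≤ s) (g : L2R) (v : hStar s) :
    inner ℂ g (starMap hs v) = ∫ ξ : ℝ, (starRingEnd ℂ) (g ξ) * weightedFT s v ξ := by
  rw [L2.inner_def]
  refine integral_congr_ae ?_
  filter_upwards [coeFn_starMap hs v] with ξ hξ
  rw [hξ, RCLike.inner_apply, mul_comm]

section Completeness

variable {α : ℝ} {g : ℝ → ℂ}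

theorem integrable_weight_mul_decay (hα : 0 ≤ α) (hg : MemLp g 2 volume) :
    Integrable fun ξ : ℝ => ‖g ξ * (((1 + ξ ^ 2) ^ (α / 2) : ℝ) : ℂ)‖ * (1 + |ξ|) ^ (-(α + 1)) := by
  have h1 : Integrable (fun ξ : ℝ => ‖g ξ‖ * (1 + |ξ|)⁻¹) :=
    hg.norm.integrable_mul memLp_one_add_abs_inv
  have c1 : Continuous fun ξ : ℝ => (1 + |ξ|) ^ (-(α + 1)) :=
    Continuous.rpow_const (by fun_prop) fun ξ => Or.inl (by positivity)
  refine h1.mono' (((hg.1.mul (Complex.continuous_ofReal.comp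
    (continuous_sobolevWeight α)).aestronglyMeasurable).norm).mul c1.aestronglyMeasurable)
    (Eventually.of_forall fun ξ => ?_)
  have hp : 0 < 1 + |ξ| := by positivity
  have hW := sobolevWeight_le hα ξ
  rw [Real.norm_eq_abs, sq_abs] at hW
  rw [Real.norm_of_nonneg (by positivity), norm_mul, Complex.norm_of_nonneg (by positivity),
    mul_assoc]
  refine mul_le_mul_of_nonneg_left ?_ (norm_nonneg _)
  calc _ ≤ (1 + |ξ|) ^ α * (1 + |ξ|) ^ (-(α + 1)) :=
        mul_le_mul_of_nonneg_right hW (by positivity)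
    _ = (1 + |ξ|)⁻¹ := by
        rw [← Real.rpow_add hp, ← Real.rpow_neg_one]; congr 1; ring

theorem integral_mul_weight_schwartz (hα : 0 ≤ α) (hg : MemLp g 2 volume)
    (hJ : ∀ m : ℕ, ∫ ξ, g ξ * weightedFT α (gjf α hα m) ξ = 0) (h : 𝓢(ℝ, ℂ)) :
    ∫ ξ, g ξ * ((((1 + ξ ^ 2) ^ (α / 2) : ℝ) : ℂ) * intervalFT (fun x => wmon α 0 x * h x) ξ) =
      0 := by
  set G : ℝ → ℂ := fun ξ => g ξ * (((1 + ξ ^ 2) ^ (α / 2) : ℝ) : ℂ) with hG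
  have hGm : AEStronglyMeasurable G volume := hg.1.mul
    (Complex.continuous_ofReal.comp (continuous_sobolevWeight α)).aestronglyMeasurable
  have hGi := integrable_weight_mul_decay hα hg
  have hJ' : ∀ m : ℕ, Integrable (fun ξ => G ξ * intervalFT (fun x => gjfFun α m x) ξ) ∧
      ∫ ξ, G ξ * intervalFT (fun x => gjfFun α m x) ξ = 0 := by
    intro m
    have e : (fun ξ => G ξ * intervalFT (fun x => gjfFun α m x) ξ) =
        fun ξ => g ξ * weightedFT α (gjf α hα m) ξ := by
      funext ξ
      have e1 := intervalFT_congr_ae (memLp_gjf hα m).coeFn_toLp ξ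
      rw [← e1, weightedFT, gjf, hG, mul_assoc]
    rw [e]
    exact ⟨hg.integrable_mul (memLp_weightedFT hα ⟨_, gjf_mem_hStar hα m⟩), hJ m⟩
  have := integral_mul_intervalFT_schwartz hα hGm hGi
    (integral_mul_wft_shift hα hGm hGi (integral_mul_intervalFT_wmon hα hJ')) h
  simpa only [hG, mul_assoc] using this

theorem eLpNorm_comp_mul_left_le (f : ℝ → ℂ) {r : ℝ} (hr : 2⁻¹ ≤ r) :
    eLpNorm (fun x => f (r * x)) 2 volume ≤ 2 * eLpNorm f 2 volume := by
  have hr0 : 0 < r := by linarith [inv_pos.2 (zero_lt_two' ℝ)]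
  rw [eLpNorm_comp_mul_left f hr0.ne']
  refine mul_le_mul_left ?_ _
  have h1 : ENNReal.ofReal |r⁻¹| ≤ 2 := by
    rw [abs_of_pos (inv_pos.2 hr0), ← ENNReal.ofReal_ofNat]
    exact ENNReal.ofReal_le_ofReal (inv_le_of_inv_le₀ (by norm_num) hr)
  calc _ ≤ (2 : ℝ≥0∞) ^ (1 / 2 : ℝ) := ENNReal.rpow_le_rpow h1 (by norm_num)
    _ ≤ (2 : ℝ≥0∞) ^ (1 : ℝ) := ENNReal.rpow_le_rpow_of_exponent_le (by norm_num) (by norm_num)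
    _ = 2 := ENNReal.rpow_one _

/-- The approximants have transforms m_n(ξ) r_n û(r_n ξ), with r_n → 1 and m_n → 1 pointwise.
Comparing the Sobolev weights at ξ and at r_n ξ bounds their weighted L² norms by that of u, so
pointwise convergence is enough for the limit. -/
theorem integral_mul_weightedFT_eq_zero (hα : 0 ≤ α) (hg : MemLp g 2 volume)
    (hJ : ∀ m : ℕ, ∫ ξ, g ξ * weightedFT α (gjf α hα m) ξ = 0) (u : hStar α) :
    ∫ ξ, g ξ * weightedFT α u ξ = 0 := by
  -- The factor 1/4 ensures r_n = 1-2δ_n ≥ 1/2, whence the constants 2^α and 2 below.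
  set δ : ℕ → ℝ := fun n => 1 / 4 * (1 / ((n : ℝ) + 1)) with hδ
  have hδ0 : ∀ n, 0 < δ n := fun n => by positivity
  have hδ1 : ∀ n, δ n ≤ 1 / 4 := fun n => by
    have : 1 / ((n : ℝ) + 1) ≤ 1 := by
      rw [div_le_one (by positivity)]; linarith [n.cast_nonneg (α := ℝ)]
    simp only [hδ]; linarith
  have hδl : Tendsto δ atTop (𝓝 0) := by
    have := (tendsto_one_div_add_atTop_nhds_zero_nat (𝕜 := ℝ)).const_mul (1 / 4)
    rwa [mul_zero] at this
  have hu : IntegrableOn (u : L2Lam) Lam := integrable_coe_L2Lam u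
  have hd := fun n => exists_schwartz_intervalFT_eq α hu (hδ0 n) (by linarith [hδ1 n])
  choose h m hm1 hm2 hm using hd
  set r : ℕ → ℝ := fun n => 1 - 2 * δ n with hr
  have hr1 : ∀ n, 2⁻¹ ≤ r n := fun n => by simp only [hr]; linarith [hδ1 n]
  have hr2 : ∀ n, r n ≤ 1 := fun n => by simp only [hr]; linarith [hδ0 n]
  have hr0 : ∀ n, 0 < r n := fun n => by linarith [hr1 n]
  have hrl : Tendsto r atTop (𝓝 1) := by simpa [hr] using (hδl.const_mul 2).const_sub 1
  set V : ℕ → ℝ → ℂ := fun n ξ => (((1 + ξ ^ 2) ^ (α / 2) : ℝ) : ℂ) *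
    intervalFT (fun x => wmon α 0 x * h n x) ξ with hV
  have hVle : ∀ n ξ, ‖V n ξ‖ ≤ (1 + ξ ^ 2) ^ (α / 2) * ‖intervalFT (u : L2Lam) (r n * ξ)‖ := by
    intro n ξ
    simp only [hV]
    rw [norm_mul, Complex.norm_of_nonneg (by positivity), hm]
    refine mul_le_mul_of_nonneg_left ?_ (by positivity)
    rw [norm_mul, norm_mul, Complex.norm_of_nonneg (hr0 n).le]
    have := mul_le_mul (hm1 n ξ) (mul_le_mul_of_nonneg_right (hr2 n)
      (norm_nonneg (intervalFT (u : L2Lam) (r n * ξ)))) (by have := hr0 n; positivity) zero_le_one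
    simpa using this
  have hVle2 : ∀ n ξ, ‖V n ξ‖ ≤ 2 ^ α * ‖weightedFT α u (r n * ξ)‖ := by
    intro n ξ
    refine (hVle n ξ).trans ?_
    rw [weightedFT, norm_mul, Complex.norm_of_nonneg (by positivity), ← mul_assoc]
    refine mul_le_mul_of_nonneg_right (sobolevWeight_le_mul hα one_le_two ?_) (norm_nonneg _)
    rw [abs_mul, abs_of_pos (hr0 n)]
    nlinarith [hr1 n, abs_nonneg ξ]
  have hVc : ∀ n, Continuous (V n) := by
    intro n
    refine (Complex.continuous_ofReal.comp (continuous_sobolevWeight α)).mul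
      (continuous_intervalFT (Continuous.intervalIntegrable ?_ _ _))
    exact (Complex.continuous_ofReal.comp (continuous_wmon hα 0)).mul (h n).continuous
  have hU := memLp_weightedFT hα u
  refine integral_mul_eq_zero_of_tendsto (V := V) (U := weightedFT α u)
    (B := fun ξ => (1 + ξ ^ 2) ^ (α / 2) * ∫ x in (-1 : ℝ)..1, ‖(u : L2Lam) x‖)
    (M := ENNReal.ofReal (2 ^ α) * (2 * eLpNorm (weightedFT α u) 2 volume))
    (ENNReal.mul_ne_top ENNReal.ofReal_ne_top (ENNReal.mul_ne_top (by norm_num) hU.2.ne)) hg hU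
    (fun n => (memLp_comp_mul_left hU (hr0 n).ne').of_le_mul (hVc n).aestronglyMeasurable
      (Eventually.of_forall (hVle2 n)))
    (fun n => ?_) ((continuous_sobolevWeight α).mul continuous_const) (fun n ξ => ?_) (fun ξ => ?_)
    (fun n => integral_mul_weight_schwartz hα hg hJ (h n))
  · exact (eLpNorm_le_mul_eLpNorm_of_ae_le_mul (Eventually.of_forall (hVle2 n)) 2).trans
      (mul_le_mul_right (eLpNorm_comp_mul_left_le _ (hr1 n)) _)
  · exact (hVle n ξ).trans (mul_le_mul_of_nonneg_left (norm_intervalFT_le_integral _ _)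
      (by positivity))
  · simp only [hV, hm]
    have l1 : Tendsto (fun n => m n ξ) atTop (𝓝 1) := by
      rw [tendsto_iff_norm_sub_tendsto_zero]
      refine squeeze_zero (fun n => norm_nonneg _) (fun n => hm2 n ξ) ?_
      simpa using hδl.const_mul |ξ|
    have l2 : Tendsto (fun n => intervalFT (u : L2Lam) (r n * ξ)) atTop
        (𝓝 (intervalFT (u : L2Lam) ξ)) := by
      have := hrl.mul_const ξ
      rw [one_mul] at this
      exact ((continuous_intervalFT_coe u).tendsto ξ).comp this
    have l3 : Tendsto (fun n => ((r n : ℝ) : ℂ)) atTop (𝓝 1) :=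
      (Complex.continuous_ofReal.tendsto' 1 1 Complex.ofReal_one).comp hrl
    have := (l1.mul (l3.mul l2)).const_mul (((1 + ξ ^ 2) ^ (α / 2) : ℝ) : ℂ)
    rwa [one_mul, one_mul] at this

theorem exists_span_gjf_norm_lt (hα : 0 ≤ α) (u : hStar α) {ε : ℝ} (hε : 0 < ε) :
    ∃ w ∈ Submodule.span ℂ
        (Set.range fun m : ℕ => (⟨gjf α hα m, gjf_mem_hStar hα m⟩ : hStar α)),
      ‖starMap hα (u - w)‖ < ε := by
  set K := (Submodule.span ℂ
    (Set.range fun m : ℕ => (⟨gjf α hα m, gjf_mem_hStar hα m⟩ : hStar α))).map (starMap hα)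
  have hmem : starMap hα u ∈ K.topologicalClosure := by
    rw [← Submodule.orthogonal_orthogonal_eq_closure, Submodule.mem_orthogonal]
    intro g hg
    rw [inner_starMap]
    -- The inner product is conjugate linear in its first slot, so the annihilating function is the
    -- conjugate of `g`.
    refine integral_mul_weightedFT_eq_zero hα (Lp.memLp g).star (fun m => ?_) u
    have := Submodule.inner_left_of_mem_orthogonal
      (Submodule.mem_map_of_mem (f := starMap hα)
        (Submodule.subset_span (mem_range_self m))) hg
    rwa [inner_starMap] at this
  obtain ⟨_, ⟨w, hw, rfl⟩, hlt⟩ := Metric.mem_closure_iff.1 hmem ε hε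
  exact ⟨w, hw, by rwa [map_sub, ← dist_eq_norm]⟩

theorem eq_zero_of_intervalFT_ae_eq_zero {v : L2Lam} (h : intervalFT v =ᵐ[volume] 0) : v = 0 := by
  have hq := Measure.quasiMeasurePreserving_smul (volume : Measure ℝ)
    (r := 2 * Real.pi) (by positivity)
  have h1 : (𝓕 (zeroExt v) : L2R) = 0 := by
    rw [Lp.eq_zero_iff_ae_eq_zero]
    filter_upwards [fourier_zeroExt v, hq.ae h] with η h2 h3
    rw [h2]
    exact h3
  have h2 : zeroExt v = 0 := by
    rw [← fourierInv_fourier_eq (F := L2R) (zeroExt v), h1]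
    exact map_zero (Lp.fourierTransformₗᵢ ℝ ℂ).symm
  rw [Lp.eq_zero_iff_ae_eq_zero]
  refine (ae_eq_restrict_iff_indicator_ae_eq measurableSet_Ioo).2 ?_
  refine (coeFn_zeroExt v).symm.trans ?_
  rw [h2, indicator_zero']
  exact Lp.coeFn_zero _ _ _

theorem rpow_two_mul_le_sobolevWeight_sq (hα : 0 ≤ α) (ξ : ℝ) :
    |ξ| ^ (2 * α) ≤ (1 + ξ ^ 2) ^ (α / 2) * (1 + ξ ^ 2) ^ (α / 2) := by
  have e : |ξ| ^ (2 * α) = (ξ ^ 2) ^ α := by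
    rw [← sq_abs, ← Real.rpow_natCast, ← Real.rpow_mul (abs_nonneg _)]; norm_num
  rw [e, ← Real.rpow_add (by positivity), add_halves]
  exact Real.rpow_le_rpow (by positivity) (by linarith) hα

/-- The form against u is an L² pairing with g = |ξ|^{2α}(1+ξ²)^{-α/2} times the conjugate of û.
Since g annihilates every J_m it annihilates u itself, which gives ∫ |ξ|^{2α}|û|² = 0 and û = 0
almost everywhere. No coercivity of the form is needed. -/
theorem eq_zero_of_form_gjf_eq_zero (hα : 0 ≤ α) (u : hStar α)
    (h : ∀ m : ℕ, form α hα u ⟨gjf α hα m, gjf_mem_hStar hα m⟩ = 0) : u = 0 := by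
  set W : ℝ → ℝ := fun ξ => (1 + ξ ^ 2) ^ (α / 2) with hW
  have hW0 : ∀ ξ, 0 < W ξ := fun ξ => by positivity
  have hWc : Continuous W := continuous_sobolevWeight α
  have hU := memLp_weightedFT hα u
  have hUc := continuous_intervalFT_coe (u : L2Lam)
  have hpc : Continuous fun ξ : ℝ => |ξ| ^ (2 * α) :=
    Continuous.rpow_const (by fun_prop) fun ξ => Or.inr (by positivity)
  set g : ℝ → ℂ := fun ξ => ((|ξ| ^ (2 * α) / W ξ : ℝ) : ℂ) * (starRingEnd ℂ) (intervalFT u ξ)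
    with hg
  have hgL : MemLp g 2 volume := by
    refine hU.of_le (Continuous.aestronglyMeasurable ?_) (Eventually.of_forall fun ξ => ?_)
    · exact (Complex.continuous_ofReal.comp (hpc.div hWc fun ξ => (hW0 ξ).ne')).mul
        (Complex.continuous_conj.comp hUc)
    · rw [hg, weightedFT, norm_mul, norm_mul, RCLike.norm_conj,
        Complex.norm_of_nonneg (div_nonneg (by positivity) (hW0 ξ).le),
        Complex.norm_of_nonneg (by positivity)]
      refine mul_le_mul_of_nonneg_right ?_ (norm_nonneg _)
      rw [div_le_iff₀ (hW0 ξ)]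
      exact rpow_two_mul_le_sobolevWeight_sq hα ξ
  have hgv : ∀ (v : L2Lam) (ξ : ℝ), g ξ * weightedFT α v ξ = (starRingEnd ℂ)
      (((|ξ| ^ (2 * α) : ℝ) : ℂ) * (intervalFT u ξ * (starRingEnd ℂ) (intervalFT v ξ))) := by
    intro v ξ
    have := (hW0 ξ).ne'
    have hWW : (W ξ : ℂ) ≠ 0 := Complex.ofReal_ne_zero.2 this
    simp only [hg, weightedFT, map_mul, Complex.conj_ofReal, Complex.conj_conj]
    change _ * ((W ξ : ℂ) * _) = _
    push_cast
    field_simp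
  have hJ : ∀ m : ℕ, ∫ ξ, g ξ * weightedFT α (gjf α hα m) ξ = 0 := by
    intro m
    have h1 := h m
    rw [form_eq] at h1
    have h2 := (mul_eq_zero.1 h1).resolve_left (by simp [Real.pi_ne_zero])
    simp_rw [hgv]
    rw [integral_conj, h2, map_zero]
  have h0 := integral_mul_weightedFT_eq_zero hα hgL hJ u
  have e : ∀ ξ, g ξ * weightedFT α u ξ =
      ((|ξ| ^ (2 * α) * ‖intervalFT u ξ‖ ^ 2 : ℝ) : ℂ) := by
    intro ξ
    rw [hgv, Complex.mul_conj, map_mul, Complex.conj_ofReal, Complex.conj_ofReal,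
      Complex.normSq_eq_norm_sq]
    push_cast; ring
  have hi : Integrable fun ξ : ℝ => |ξ| ^ (2 * α) * ‖intervalFT u ξ‖ ^ 2 := by
    have : Integrable fun ξ => g ξ * weightedFT α u ξ := hgL.integrable_mul hU
    simp_rw [e] at this
    exact this.re
  simp_rw [e] at h0
  rw [integral_complex_ofReal, Complex.ofReal_eq_zero,
    integral_eq_zero_iff_of_nonneg (fun ξ => by positivity) hi] at h0
  refine Subtype.ext (eq_zero_of_intervalFT_ae_eq_zero ?_)
  have hne : ∀ᵐ ξ : ℝ, ξ ≠ 0 := by simp [ae_iff]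
  filter_upwards [h0, hne] with ξ h1 h2
  have h3 : 0 < |ξ| ^ (2 * α) := Real.rpow_pos_of_pos (abs_pos.2 h2) _
  simpa [h3.ne'] using h1

end Completeness

end

end RieszJacobi

open RieszJacobi in
theorem mainTheorem5 (α : ℝ) (hα : 0 ≤ α) :
    ∃ hJ : ∀ m : ℕ, gjf α hα m ∈ hStar α,
      (∀ m n : ℕ, form α hα ⟨gjf α hα m, hJ m⟩ ⟨gjf α hα n, hJ n⟩ =
        if m = n then
          (((2 : ℝ) ^ (2 * α + 1) * Real.Gamma (m + α + 1) ^ 2 /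
            ((m.factorial : ℝ) ^ 2 * (2 * m + 2 * α + 1)) : ℝ) : ℂ)
        else 0) ∧
      (∀ u : hStar α, ∀ ε : ℝ, 0 < ε →
        ∃ w ∈ Submodule.span ℂ (Set.range fun m : ℕ => (⟨gjf α hα m, hJ m⟩ : hStar α)),
          starNorm α (u - w) < ε) ∧
      (∀ u : hStar α, (∀ m : ℕ, form α hα u ⟨gjf α hα m, hJ m⟩ = 0) → u = 0) := by
  refine ⟨gjf_mem_hStar hα, form_gjf hα, fun u ε hε => ?_, eq_zero_of_form_gjf_eq_zero hα⟩
  obtain ⟨w, hw, h⟩ := exists_span_gjf_norm_lt hα u hε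
  exact ⟨w, hw, (starNorm_le hα _).trans_lt h⟩
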